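/- **Setting (convolutional network).** Fix integers $L\ge 1$ (hidden layers), $P\ge1$ (inputs), $C_0,C_{L+1}\ge 1$ (input and output channels), spatial dimensions $N_0,\dots,N_{L+1}\ge 1$, finite nonempty sets $\mathcal M_0,\dots,\mathcal M_L$ with $M_\ell=|\mathcal M_\ell|$, constants $\lambda_0,\dots,\lambda_L>0$, a function $\sigma:\mathbb R\to\mathbb R$, patch extractors $R^{(i,\ell)}:\mathbb R^{N_\ell}\to\mathbb R^{\mathcal M_\ell}$ ($0\le \ell\le L$, $1\le i\le N_{\ell+1}$), and inputs $\mathbf x_\mu=[x_{\mu,c,i}]\in\mathbb R^{C_0\times N_0}$, $\mu=1,\dots,P$. Put $D_\ell=N_\ell P$. For each $n$ let $C_1(n),\dots,C_L(n)$ be the numbers of channels of the hidden layers, $C_0(n)=C_0$, $C_{L+1}(n)=C_{L+1}$, and let $W^{(\ell)}_{m,c',c}$ ($0\le\ell\le L$, $m\in\mathcal M_\ell$, $c'\le C_\ell(n)$, $c\le C_{\ell+1}(n)$) be real random weights. Define $$h^{(1)}_{c,i}(\mathbf x)=\frac1{\sqrt{M_0C_0}}\sum_{c'=1}^{C_0}\sum_{m\in\mathcal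 M_0}W^{(0)}_{m,c',c}R^{(i,0)}_m(x_{c',:}),\qquad h^{(\ell+1)}_{c,i}(\mathbf x)=\frac1{\sqrt{M_\ell C_\ell(n)}}\sum_{c'=1}^{C_\ell(n)}\sum_{m\in\mathcal M_\ell}W^{(\ell)}_{m,c',c}\,\sigma\big(R^{(i,\ell)}_m(h^{(\ell)}_{c',:}(\mathbf x))\big)$$ for $1\le\ell\le L$, and $H^{(\ell)}_{c,i,\mu}=h^{(\ell)}_{c,i}(\mathbf x_\mu)$. Let $\mathcal S^+_D$ be the set of symmetric positive semidefinite $D\times D$ real matrices. For $z\in\mathbb R^{N_\ell\times P}$ let $$G^{(\ell)}(z)_{i,\mu;j,\nu}=\frac1{\lambda_\ell M_\ell}\sum_{m\in\mathcal M_\ell}\sigma(R_m^{(i,\ell)}(z_{:,\mu}))\,\sigma(R_m^{(j,\ell)}(z_{:,\nu})),\qquad \mathbf K^{(\ell+1,n)}=\frac1{C_\ell(n)}\sum_{c=1}^{C_\ell(n)}G^{(\ell)}(H^{(\ell)}_{c,:,:})\in\mathcal S^+_{D_{\ell+1}}\quad(1\le\ell\le L),$$ and $\mathbf K^{(1)}_{i,\mu;j,\nu}=\frac1{\lambda_0C_0M_0}\sum_{c=1}^{C_0}\sum_{m\in\mathcal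 M_0}R^{(i,0)}_m(x_{\mu,c,:})R^{(j,0)}_m(x_{\nu,c,:})$. **Assumptions.** 1. For each $n$ the weights are independent and $W^{(\ell)}_{m,c',c}\sim\mathcal N(0,\lambda_\ell^{-1})$. 2. $C_\ell(n)/n\to\alpha_\ell\in(0,\infty)$ as $n\to\infty$, for $\ell=1,\dots,L$. 3. $\sigma$ is continuous, and there are $L_\sigma\ge0$ and a locally bounded $\rho_\sigma$ with $\rho_\sigma(x)=o(|x|)$ as $|x|\to\infty$ such that $|\sigma(x)-\sigma(y)|\le L_\sigma|x-y|+\rho_\sigma(x)+\rho_\sigma(y)$ for all $x,y\in\mathbb R$. For $1\le\ell\le L$ and all $i$, $R^{(i,\ell)}$ is continuous, and there are $L_R\ge0$ and $\rho_R$ with $\rho_R(z)=o(\|z\|)$ as $\|z\|\to\infty$ such that $\|R^{(i,\ell)}(z)-R^{(i,\ell)}(z')\|\le L_R\|z-z'\|+\rho_R(z)+\rho_R(z')$ for all $z,z'\in\mathbb R^{N_\ell}$. **Rate functions.** For $Q_1\in\mathcal S^+_{D_\ell}$ and $Q_2\in\mathcal S^+_{D_{\ell+1}}$ let $$I_\ell(Q_2\mid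 Q_1)=\sup_{Q_0=Q_0^\top}\Big\{\operatorname{tr}(Q_0^\top Q_2)-\log\int e^{\operatorname{tr}(Q_0^\top G^{(\ell)}(z))}\,\mathcal N(dz\mid 0,Q_1)\Big\},$$ $$I_{L+1}(Q)=\inf\Big\{\alpha_1I_1(Q_2\mid\mathbf K^{(1)})+\sum_{\ell=2}^L\alpha_\ell I_\ell(Q_{\ell+1}\mid Q_\ell)\;:\;Q_\ell\in\mathcal S^+_{D_\ell}\ (2\le \ell\le L+1),\ Q_{L+1}=Q\Big\}.$$ For $Q\in\mathcal S^+_{D}$ and $Z\in\mathbb R^{D}$ let $\|Z\|_Q^2=V^\top QV$ if $Z=QV$ for some $V$ (the value does not depend on $V$), and $\|Z\|_Q^2=+\infty$ if $Z\notin\operatorname{Im}(Q)$. A sequence $(X_n)$ of random elements of a metric space $\mathbb X$ satisfies an LDP with speed $n$ and rate function $I:\mathbb X\to\mathbb R\cup\{+\infty\}$ if $I$ is lower semicontinuous, $\liminf_n\frac1n\log\mathbb P(X_n\in O)\ge-\inf_OI$ for every open $O$, and $\limsup_n\frac1n\log\mathbb P(X_n\in F)\le-\inf_FI$ for every closed $F$.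 **Proposition.** Under assumptions 1–3, the sequence $\big(\tfrac1{\sqrt n}H^{(L+1)},\mathbf K^{(L+1,n)}\big)_{n\ge1}$ in $\mathbb R^{C_{L+1}D_{L+1}}\times\mathcal S^+_{D_{L+1}}$ satisfies an LDP with speed $n$ and rate function $$\mathbf J(Q,Z)=\tfrac12\sum_{c=1}^{C_{L+1}}\|Z_c\|_Q^2+I_{L+1}(Q),\qquad Q\in\mathcal S^+_{D_{L+1}},\ Z=(Z_1,\dots,Z_{C_{L+1}})\in\mathbb R^{C_{L+1}D_{L+1}},$$ where $Z_c\in\mathbb R^{D_{L+1}}$. Moreover, $\big(\tfrac1{\sqrt n}H^{(L+1)}\big)_{n\ge1}$ satisfies an LDP with speed $n$ and rate function $Z\mapsto\inf_{Q\in\mathcal S^+_{D_{L+1}}}\mathbf J(Q,Z)$. -/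

import Mathlib

open MeasureTheory ProbabilityTheory Filter Topology Bornology
open scoped ENNReal Matrix

noncomputable section

/-! ### Large deviation principles -/

/-- The sequence of random elements `X n` of the topological space `𝕏` satisfies a large deviation
principle with speed `n` and rate function `I : 𝕏 → ℝ ∪ {+∞}` (lower semicontinuous).
`ENNReal.log 0 = ⊥`, and infima over the empty set are `⊤`. -/
structure SatisfiesLDP {Ω 𝕏 : Type*} [MeasurableSpace Ω] [TopologicalSpace 𝕏]
    (Pr : Measure Ω) (X : ℕ → Ω → 𝕏) (I : 𝕏 → EReal) : Prop where
  ne_bot : ∀ x, I x ≠ ⊥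
  lowerSemicontinuous : LowerSemicontinuous I
  lower_bound : ∀ O : Set 𝕏, IsOpen O →
    -(⨅ x ∈ O, I x) ≤
      liminf (fun n : ℕ => (((n : ℝ)⁻¹ : ℝ) : EReal) * ENNReal.log (Pr {ω | X n ω ∈ O})) atTop
  upper_bound : ∀ F : Set 𝕏, IsClosed F →
    limsup (fun n : ℕ => (((n : ℝ)⁻¹ : ℝ) : EReal) * ENNReal.log (Pr {ω | X n ω ∈ F})) atTop ≤
      -(⨅ x ∈ F, I x)

/-! ### The generalized norm induced by `Q^{-1/2}` -/

open Classical in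
/-- `‖Z‖_Q² = Vᵀ Q V` if `Z = Q V` for some `V`, and `+∞` if `Z` is not in the image of `Q`. -/
def genNormSq {ι : Type*} [Fintype ι] (Q : Matrix ι ι ℝ) (Z : ι → ℝ) : EReal :=
  if h : ∃ V : ι → ℝ, Z = Q *ᵥ V then ((h.choose ⬝ᵥ (Q *ᵥ h.choose) : ℝ) : EReal) else ⊤

/-- For symmetric `Q` the value does not depend on the choice of `V`. -/
theorem genNormSq_mulVec {ι : Type*} [Fintype ι] {Q : Matrix ι ι ℝ} (hQ : Q.IsSymm)
    (V : ι → ℝ) : genNormSq Q (Q *ᵥ V) = ((V ⬝ᵥ (Q *ᵥ V) : ℝ) : EReal) := by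
  have h : ∃ V' : ι → ℝ, Q *ᵥ V = Q *ᵥ V' := ⟨V, rfl⟩
  have hs := h.choose_spec
  rw [genNormSq, dif_pos h]
  congr 1
  have key : ∀ a b : ι → ℝ, a ⬝ᵥ (Q *ᵥ b) = b ⬝ᵥ (Q *ᵥ a) := fun a b => by
    rw [Matrix.dotProduct_mulVec, ← Matrix.mulVec_transpose, hQ.eq, dotProduct_comm]
  rw [← hs, key, ← hs]

/-! ### Convolutional neural networks -/

/-- The data of a family, indexed by `n`, of convolutional networks evaluated at `P` fixed inputs.
Layers are numbered `0, …, L + 1`; the values of `N`, `mask`, `R`, `lam` at other layers,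
and of `C n ℓ` for `ℓ` outside `1, …, L`, play no role. -/
structure ConvNet where
  /-- number of hidden layers -/
  L : ℕ
  /-- number of inputs -/
  P : ℕ
  /-- number of input channels -/
  Cin : ℕ
  /-- number of output channels -/
  Cout : ℕ
  /-- `C n ℓ`: number of channels of the hidden layer `ℓ`, for `1 ≤ ℓ ≤ L` -/
  C : ℕ → ℕ → ℕ
  /-- `N ℓ`: spatial dimension of layer `ℓ` -/
  N : ℕ → ℕ
  /-- `mask ℓ`: the finite index set of the receptive fields of the neurons at layer `ℓ + 1` -/
  mask : ℕ → Type
  [maskFintype : ∀ ℓ, Fintype (mask ℓ)]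
  /-- activation function -/
  σ : ℝ → ℝ
  /-- `R ℓ i`: patch extractor of neuron `i` of layer `ℓ + 1` at layer `ℓ` -/
  R : ∀ ℓ, Fin (N (ℓ + 1)) → EuclideanSpace ℝ (Fin (N ℓ)) → EuclideanSpace ℝ (mask ℓ)
  /-- `lam ℓ`: precision (inverse variance) of the weights between layers `ℓ` and `ℓ + 1` -/
  lam : ℕ → ℝ
  lam_pos : ∀ ℓ, 0 < lam ℓ
  /-- `x μ c i`: the inputs -/
  x : Fin P → Fin Cin → EuclideanSpace ℝ (Fin (N 0))

attribute [instance] ConvNet.maskFintype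

namespace ConvNet

variable (net : ConvNet)

/-- `|M_ℓ|`. -/
abbrev maskCard (ℓ : ℕ) : ℕ := Fintype.card (net.mask ℓ)

/-- Number of channels of layer `ℓ`, for `0 ≤ ℓ ≤ L + 1`, in the network of index `n`. -/
def width (n ℓ : ℕ) : ℕ :=
  if ℓ = 0 then net.Cin else if ℓ = net.L + 1 then net.Cout else net.C n ℓ

/-- The pairs (spatial index, input) of layer `ℓ`; there are `D_ℓ = N_ℓ P` of them. -/
abbrev Site (ℓ : ℕ) : Type := Fin (net.N ℓ) × Fin net.P

/-- The space of positive semidefinite `D_ℓ × D_ℓ` matrices. -/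
abbrev Cov (ℓ : ℕ) : Type := {Q : Matrix (net.Site ℓ) (net.Site ℓ) ℝ // Q.PosSemidef}

/-- Arrays containing the values of all the weights: `w ℓ m c' c` is `W^{(ℓ)}_{m,c',c}`, the weight
from channel `c'` of layer `ℓ` to channel `c` of layer `ℓ + 1`. Channels are numbered from `0`;
only entries with `ℓ ≤ L`, `c' < width n ℓ`, `c < width n (ℓ + 1)` are used in the network of
index `n`. -/
abbrev Weights : Type := ∀ ℓ, net.mask ℓ → ℕ → ℕ → ℝ

/-- `preAct n w x ℓ c i` is the pre-activation `h^{(ℓ+1)}_{c,i}(x)`. -/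
def preAct (n : ℕ) (w : net.Weights) (x : Fin net.Cin → EuclideanSpace ℝ (Fin (net.N 0))) :
    (ℓ : ℕ) → ℕ → EuclideanSpace ℝ (Fin (net.N (ℓ + 1)))
  | 0, c => WithLp.toLp 2 fun i =>
      1 / √((net.maskCard 0 : ℝ) * net.Cin) *
        ∑ c' : Fin net.Cin, ∑ m : net.mask 0, w 0 m c' c * net.R 0 i (x c') m
  | ℓ + 1, c => WithLp.toLp 2 fun i =>
      1 / √((net.maskCard (ℓ + 1) : ℝ) * net.C n (ℓ + 1)) *
        ∑ c' ∈ Finset.range (net.C n (ℓ + 1)), ∑ m : net.mask (ℓ + 1),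
          w (ℓ + 1) m c' c * net.σ (net.R (ℓ + 1) i (preAct n w x ℓ c') m)

/-- The slice `z_{:,μ}` of `z ∈ ℝ^{N_ℓ × P}`. -/
def slice {ℓ : ℕ} (z : EuclideanSpace ℝ (net.Site ℓ)) (μ : Fin net.P) :
    EuclideanSpace ℝ (Fin (net.N ℓ)) :=
  WithLp.toLp 2 fun i => z (i, μ)

/-- `layer n w ℓ c` is the slice `H^{(ℓ+1)}_{c,:,:} = [h^{(ℓ+1)}_{c,i}(x_μ)]_{i,μ}`. -/
def layer (n : ℕ) (w : net.Weights) (ℓ c : ℕ) : EuclideanSpace ℝ (net.Site (ℓ + 1)) :=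
  WithLp.toLp 2 fun s => net.preAct n w (net.x s.2) ℓ c s.1

/-- The function `G^{(ℓ)} : ℝ^{N_ℓ × P} → ℝ^{D_{ℓ+1} × D_{ℓ+1}}`. -/
def G (ℓ : ℕ) (z : EuclideanSpace ℝ (net.Site ℓ)) :
    Matrix (net.Site (ℓ + 1)) (net.Site (ℓ + 1)) ℝ :=
  Matrix.of fun s t => 1 / (net.lam ℓ * net.maskCard ℓ) *
    ∑ m : net.mask ℓ,
      net.σ (net.R ℓ s.1 (net.slice z s.2) m) * net.σ (net.R ℓ t.1 (net.slice z t.2) m)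

/-- The deterministic covariance matrix `K^{(1)}` of the first layer. -/
def K₁ : Matrix (net.Site 1) (net.Site 1) ℝ :=
  Matrix.of fun s t => 1 / (net.lam 0 * net.Cin * net.maskCard 0) *
    ∑ c : Fin net.Cin, ∑ m : net.mask 0,
      net.R 0 s.1 (net.x s.2 c) m * net.R 0 t.1 (net.x t.2 c) m

/-- `covMatrix n w ℓ` is the conditional covariance matrix `K^{(ℓ+1,n)}`. -/
def covMatrix (n : ℕ) (w : net.Weights) :
    (ℓ : ℕ) → Matrix (net.Site (ℓ + 1)) (net.Site (ℓ + 1)) ℝ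
  | 0 => net.K₁
  | ℓ + 1 => (1 / (net.C n (ℓ + 1) : ℝ)) •
      ∑ c ∈ Finset.range (net.C n (ℓ + 1)), net.G (ℓ + 1) (net.layer n w ℓ c)

theorem posSemidef_of_sum_mul {ι κ : Type*} [Finite ι] [Fintype κ] {a : ℝ} (ha : 0 ≤ a)
    (f : κ → ι → ℝ) : (Matrix.of fun s t => a * ∑ k, f k s * f k t).PosSemidef := by
  have h : (Matrix.of fun s t => a * ∑ k, f k s * f k t) =
      a • ∑ k, Matrix.vecMulVec (f k) (star (f k)) := by
    ext s t
    simp [Matrix.sum_apply, Matrix.vecMulVec_apply]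
  rw [h]
  exact (Matrix.posSemidef_sum _ fun k _ => Matrix.posSemidef_vecMulVec_self_star (f k)).smul ha

theorem posSemidef_G (ℓ : ℕ) (z : EuclideanSpace ℝ (net.Site ℓ)) : (net.G ℓ z).PosSemidef :=
  posSemidef_of_sum_mul (by have := net.lam_pos ℓ; positivity)
    fun m (s : net.Site (ℓ + 1)) => net.σ (net.R ℓ s.1 (net.slice z s.2) m)

theorem posSemidef_K₁ : net.K₁.PosSemidef := by
  have h := posSemidef_of_sum_mul (a := 1 / (net.lam 0 * net.Cin * net.maskCard 0))
    (by have := net.lam_pos 0; positivity)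
    fun (k : Fin net.Cin × net.mask 0) (s : net.Site 1) => net.R 0 s.1 (net.x s.2 k.1) k.2
  simp only [Fintype.sum_prod_type] at h
  exact h

theorem posSemidef_covMatrix (n : ℕ) (w : net.Weights) :
    ∀ ℓ, (net.covMatrix n w ℓ).PosSemidef
  | 0 => net.posSemidef_K₁
  | ℓ + 1 => (Matrix.posSemidef_sum _ fun _ _ => net.posSemidef_G (ℓ + 1) _).smul (by positivity)

/-- `K^{(L+1,n)}` as an element of the space of positive semidefinite matrices. -/
def outputCov (n : ℕ) (w : net.Weights) : net.Cov (net.L + 1) :=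
  ⟨net.covMatrix n w net.L, net.posSemidef_covMatrix n w net.L⟩

/-- The space `ℝ^{C_{L+1} D_{L+1}}` of the network outputs at the `P` inputs. -/
abbrev Output : Type := Fin net.Cout → net.Site (net.L + 1) → ℝ

/-- The rescaled output `n^{-1/2} H^{(L+1)}`. -/
def rescaledOutput (n : ℕ) (w : net.Weights) : net.Output :=
  fun c s => 1 / √(n : ℝ) * net.layer n w net.L c s

/-! ### Assumptions -/

/-- The labels of the weights of the network of index `n`. -/
abbrev WeightIndex (n : ℕ) : Type :=
  Σ ℓ : Fin (net.L + 1), net.mask ℓ × Fin (net.width n ℓ) × Fin (net.width n (ℓ + 1))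

/-- For each `n`, the weights `W n` of the network of index `n` are independent, and those of layer
`ℓ` have law `𝒩(0, 1/λ_ℓ)`. Nothing is assumed on the joint law of weights for different `n`. -/
def GaussianPrior {Ω : Type*} [MeasurableSpace Ω] (Pr : Measure Ω)
    (W : ℕ → Ω → net.Weights) : Prop :=
  ∀ n, (∀ k : net.WeightIndex n,
      HasLaw (fun ω => W n ω k.1 k.2.1 k.2.2.1 k.2.2.2)
        (gaussianReal 0 (net.lam k.1)⁻¹.toNNReal) Pr) ∧
    iIndepFun (fun (k : net.WeightIndex n) ω => W n ω k.1 k.2.1 k.2.2.1 k.2.2.2) Pr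

/-- The hidden widths grow linearly in `n`, with proportions `α ℓ ∈ (0, ∞)`. -/
def LinearWidths (α : ℕ → ℝ) : Prop :=
  ∀ ℓ ∈ Finset.Icc 1 net.L,
    0 < α ℓ ∧ Tendsto (fun n : ℕ => (net.C n ℓ : ℝ) / n) atTop (𝓝 (α ℓ))

/-- The asymptotic Lipschitz condition on the activation and on the patch extractors. -/
structure AsymptoticLipschitz : Prop where
  continuous_σ : Continuous net.σ
  bound_σ : ∃ K : ℝ, 0 ≤ K ∧ ∃ ρ : ℝ → ℝ,
    (∀ x, ∃ B : ℝ, ∀ᶠ y in 𝓝 x, |ρ y| ≤ B) ∧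
    ρ =o[cobounded ℝ] (fun x => |x|) ∧
    ∀ x y, |net.σ x - net.σ y| ≤ K * |x - y| + ρ x + ρ y
  continuous_R : ∀ ℓ ∈ Finset.Icc 1 net.L, ∀ i, Continuous (net.R ℓ i)
  bound_R : ∀ ℓ ∈ Finset.Icc 1 net.L, ∀ i, ∃ K : ℝ, 0 ≤ K ∧
    ∃ ρ : EuclideanSpace ℝ (Fin (net.N ℓ)) → ℝ,
      ρ =o[cobounded _] (fun z => ‖z‖) ∧
      ∀ z z', ‖net.R ℓ i z - net.R ℓ i z'‖ ≤ K * ‖z - z'‖ + ρ z + ρ z'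

/-! ### Rate functions -/

/-- `I_ℓ(Q₂ | Q₁)`: the supremum over symmetric `Q₀` of
`tr(Q₀ᵀ Q₂) - log ∫ exp(tr(Q₀ᵀ G^{(ℓ)}(z))) 𝒩(dz | 0, Q₁)`; the integral may be `+∞`. -/
def layerRate (ℓ : ℕ) (Q₂ : Matrix (net.Site (ℓ + 1)) (net.Site (ℓ + 1)) ℝ)
    (Q₁ : Matrix (net.Site ℓ) (net.Site ℓ) ℝ) : EReal :=
  ⨆ Q₀ : {Q : Matrix (net.Site (ℓ + 1)) (net.Site (ℓ + 1)) ℝ // Q.IsSymm},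
    ((Q₀.1ᵀ * Q₂).trace : EReal) -
      ENNReal.log (∫⁻ z, ENNReal.ofReal (Real.exp (Q₀.1ᵀ * net.G ℓ z).trace)
        ∂(multivariateGaussian 0 Q₁))

/-- `I_{2,…,L+1}(Q_2, …, Q_{L+1}) = α_1 I_1(Q_2 | K^{(1)}) + ∑_{ℓ=2}^L α_ℓ I_ℓ(Q_{ℓ+1} | Q_ℓ)`;
only the entries `Q 2, …, Q (L + 1)` of the family are used (for `L ≥ 1`). -/
def jointRate (α : ℕ → ℝ) (Q : ∀ ℓ, net.Cov ℓ) : EReal :=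
  (α 1 : EReal) * net.layerRate 1 (Q 2).1 net.K₁ +
    ∑ ℓ ∈ Finset.Icc 2 net.L, (α ℓ : EReal) * net.layerRate ℓ (Q (ℓ + 1)).1 (Q ℓ).1

/-- `I_{L+1}(Q) = inf_{Q_2, …, Q_L} I_{2,…,L+1}(Q_2, …, Q_L, Q)`. -/
def covRate (α : ℕ → ℝ) (Q : net.Cov (net.L + 1)) : EReal :=
  ⨅ (q : ∀ ℓ, net.Cov ℓ) (_ : q (net.L + 1) = Q), net.jointRate α q

/-- `J(Q, Z) = ½ ∑_c ‖Z_c‖_Q² + I_{L+1}(Q)`. -/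
def outputRate (α : ℕ → ℝ) (Q : net.Cov (net.L + 1)) (Z : net.Output) : EReal :=
  ((1 / 2 : ℝ) : EReal) * ∑ c, genNormSq Q.1 (Z c) + net.covRate α Q

end ConvNet

end

noncomputable section

set_option linter.unusedSectionVars false

/-! ### Exponential bounds -/

/-! Freeze the weights below a layer. Its pre-activations are then linear combinations of fresh
independent Gaussian weights, so its channels are independent centred Gaussian vectors whose common
covariance is the Gram matrix of the frozen features, `covMatrix`. Hence the conditional covariances
form a Markov chain started at the deterministic `K₁`: given `Q` at layer `ℓ`, the next matrix is
the mean of `C n ℓ` independent copies of `G ℓ (√Q ξ)` with `ξ` standard Gaussian (`covLaw_succ`).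
Given the last matrix `Q`, the rescaled output is `n^{-1/2}` times a Gaussian vector, which has the
law of a mean of `n` independent Gaussian vectors of covariance `Q` (`gaussianMeanKernel_apply`).
Every transition is thus an empirical mean ruled by Cramér's theorem. Passing from speed `C n ℓ` to
speed `n` multiplies the rate by `α ℓ`, and the Legendre transform of the Gaussian output is half
the generalized norm (`cramerRate_channelLaw`).

To chain the transitions, the bounds must be locally uniform in the conditioning matrix
(`KernelLDP`). Then `GoodLDP.compProd` adds the rates, and the contraction principle `GoodLDP.map`
takes the infimum over the forgotten matrices. Uniformity comes from a coupling: the same noise `ξ`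
is used for all `Q`, and `G ℓ (√Q' ξ) - G ℓ (√Q ξ)` is at most `ε (1 + ‖ξ‖)²` for `Q'` near `Q`,
because the neurons are Lipschitz up to a sublinear error. This weight has an exponential moment by
Fernique's theorem, so the two means are exponentially close (`NoiseControl.exists_close_mean`).

Since `G ℓ` may grow quadratically, its Laplace transform can be infinite away from the origin, so
the lower bound of Cramér's theorem is proved with no moment condition. Superadditivity makes the
pairs (mean, exponent) that are reached a closed convex set `lowerPairs`, and the log-Laplace
transform is bounded by its support function (`laplace_le_of_forall_lowerPairs`). Hahn–Banach
separation then shows that the set contains every `(x, -M)` with `cramerRate μ x < M`. -/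

/-- The number `e^{-nM}` as an extended nonnegative real. -/
def expBound (n : ℕ) (M : ℝ) : ℝ≥0∞ := ENNReal.ofReal (Real.exp (-(n * M)))

theorem expBound_anti {M M' : ℝ} (h : M ≤ M') (n : ℕ) : expBound n M' ≤ expBound n M := by
  apply ENNReal.ofReal_le_ofReal
  apply Real.exp_le_exp.2
  have : (n : ℝ) * M ≤ n * M' := mul_le_mul_of_nonneg_left h n.cast_nonneg
  linarith

theorem expBound_lt {M M' : ℝ} (h : M < M') {n : ℕ} (hn : 0 < n) :
    expBound n M' < expBound n M := by
  apply (ENNReal.ofReal_lt_ofReal_iff (Real.exp_pos _)).2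
  apply Real.exp_lt_exp.2
  have : (n : ℝ) * M < n * M' := mul_lt_mul_of_pos_left h (by exact_mod_cast hn)
  linarith

theorem one_le_expBound {M : ℝ} (h : M ≤ 0) (n : ℕ) : 1 ≤ expBound n M := by
  rw [expBound, ENNReal.one_le_ofReal, Real.one_le_exp_iff]
  have : (n : ℝ) * M ≤ 0 := mul_nonpos_of_nonneg_of_nonpos n.cast_nonneg h
  linarith

theorem expBound_add (n : ℕ) (M M' : ℝ) :
    expBound n (M + M') = expBound n M * expBound n M' := by
  rw [expBound, expBound, expBound, ← ENNReal.ofReal_mul (Real.exp_pos _).le, ← Real.exp_add]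
  congr 2
  ring

theorem expBound_ne_top (n : ℕ) (M : ℝ) : expBound n M ≠ ⊤ := ENNReal.ofReal_ne_top

theorem log_expBound (n : ℕ) (M : ℝ) : ENNReal.log (expBound n M) = ((-(n * M) : ℝ) : EReal) := by
  rw [expBound, ENNReal.log_ofReal_of_pos (Real.exp_pos _), Real.log_exp]

theorem inv_mul_log_expBound {n : ℕ} (hn : 0 < n) (M : ℝ) :
    (((n : ℝ)⁻¹ : ℝ) : EReal) * ENNReal.log (expBound n M) = -(M : EReal) := by
  rw [log_expBound, ← EReal.coe_mul, ← EReal.coe_neg]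
  congr 1
  have : (n : ℝ) ≠ 0 := by positivity
  field_simp

/-- A strict loss in the exponent absorbs any constant factor; the union bounds below pay for their
number of terms in this way. -/
theorem eventually_const_mul_expBound_le {c : ℝ≥0∞} (hc : c ≠ ⊤) {M M' : ℝ} (h : M < M') :
    ∀ᶠ n : ℕ in atTop, c * expBound n M' ≤ expBound n M := by
  lift c to NNReal using hc
  have ht : Tendsto (fun n : ℕ => Real.exp (n * (M' - M))) atTop atTop :=
    Real.tendsto_exp_atTop.comp
      ((tendsto_natCast_atTop_atTop).atTop_mul_const (sub_pos.2 h))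
  filter_upwards [ht.eventually_ge_atTop (c : ℝ)] with n hn
  rw [expBound, expBound, ← ENNReal.ofReal_coe_nnreal, ← ENNReal.ofReal_mul c.coe_nonneg]
  apply ENNReal.ofReal_le_ofReal
  calc (c : ℝ) * Real.exp (-(n * M')) ≤ Real.exp (n * (M' - M)) * Real.exp (-(n * M')) := by
        gcongr
    _ = Real.exp (-(n * M)) := by rw [← Real.exp_add]; congr 1; ring

/-- Splits an exponent between a marginal rate and a conditional rate. Nonnegativity matters when
one rate is infinite: the other then receives the budget `-1`, which lies below it, and the infinite
one carries the rest. -/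
theorem EReal.exists_coe_lt_coe_lt_add_of_lt_add {a b : EReal} (ha : 0 ≤ a) (hb : 0 ≤ b) {M : ℝ}
    (h : (M : EReal) < a + b) :
    ∃ M₁ M₂ : ℝ, (M₁ : EReal) < a ∧ (M₂ : EReal) < b ∧ M ≤ M₁ + M₂ := by
  induction a with
  | bot => simp at ha
  | top =>
    refine ⟨M + 1, -1, EReal.coe_lt_top _, lt_of_lt_of_le ?_ hb, by linarith⟩
    exact_mod_cast (by norm_num : (-1 : ℝ) < 0)
  | coe a =>
    induction b with
    | bot => simp at hb
    | top =>
      refine ⟨-1, M + 1, lt_of_lt_of_le ?_ ha, EReal.coe_lt_top _, by linarith⟩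
      exact_mod_cast (by norm_num : (-1 : ℝ) < 0)
    | coe b =>
      have h' : M < a + b := by exact_mod_cast h
      refine ⟨a - (a + b - M) / 2, b - (a + b - M) / 2, ?_, ?_, by linarith⟩ <;>
      · rw [EReal.coe_lt_coe_iff]; linarith

theorem EReal.exists_lt_coe_lt_coe_add_le_of_add_lt {a b : EReal} (ha : 0 ≤ a) (hb : 0 ≤ b) {M : ℝ}
    (h : a + b < (M : EReal)) :
    ∃ M₁ M₂ : ℝ, a < (M₁ : EReal) ∧ b < (M₂ : EReal) ∧ M₁ + M₂ ≤ M := by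
  induction a with
  | bot => simp at ha
  | top => rw [EReal.top_add_of_ne_bot (ne_of_gt (lt_of_lt_of_le (by simp) hb))] at h; simp at h
  | coe a =>
    induction b with
    | bot => simp at hb
    | top => simp at h
    | coe b =>
      have h' : a + b < M := by exact_mod_cast h
      refine ⟨a + (M - a - b) / 2, b + (M - a - b) / 2, ?_, ?_, by linarith⟩ <;>
      · rw [EReal.coe_lt_coe_iff]; linarith

/-! ### Large deviation principles in local form -/

/-- A large deviation principle with speed `n` for a sequence of measures, in local form: lower
bounds on neighbourhoods of points, upper bounds on small neighbourhoods of points, and exponential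
tightness. -/
structure GoodLDP {𝕏 : Type*} [TopologicalSpace 𝕏] [MeasurableSpace 𝕏]
    (μ : ℕ → Measure 𝕏) (I : 𝕏 → EReal) : Prop where
  lower : ∀ x V, IsOpen V → x ∈ V → ∀ M : ℝ, I x < M → ∀ᶠ n in atTop, expBound n M ≤ μ n V
  upper : ∀ x, ∀ M : ℝ, (M : EReal) < I x →
    ∃ V, IsOpen V ∧ x ∈ V ∧ ∀ᶠ n in atTop, μ n V ≤ expBound n M
  tight : ∀ M : ℝ, ∃ K, IsCompact K ∧ ∀ᶠ n in atTop, μ n Kᶜ ≤ expBound n M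

/-- A large deviation principle in local form for a sequence of kernels, locally uniform in the
parameter. -/
structure KernelLDP {𝕐 𝕏 : Type*} [TopologicalSpace 𝕐] [MeasurableSpace 𝕐]
    [TopologicalSpace 𝕏] [MeasurableSpace 𝕏]
    (κ : ℕ → Kernel 𝕐 𝕏) (J : 𝕐 → 𝕏 → EReal) : Prop where
  lower : ∀ y x V, IsOpen V → x ∈ V → ∀ M : ℝ, J y x < M →
    ∃ U, IsOpen U ∧ y ∈ U ∧ ∀ᶠ n in atTop, ∀ y' ∈ U, expBound n M ≤ κ n y' V
  upper : ∀ y x, ∀ M : ℝ, (M : EReal) < J y x →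
    ∃ V, IsOpen V ∧ x ∈ V ∧ ∃ U, IsOpen U ∧ y ∈ U ∧
      ∀ᶠ n in atTop, ∀ y' ∈ U, κ n y' V ≤ expBound n M
  tight : ∀ y, ∀ M : ℝ, ∃ K, IsCompact K ∧ ∃ U, IsOpen U ∧ y ∈ U ∧
    ∀ᶠ n in atTop, ∀ y' ∈ U, κ n y' Kᶜ ≤ expBound n M

section GoodLDP

variable {𝕏 : Type*} [TopologicalSpace 𝕏] [MeasurableSpace 𝕏] {μ : ℕ → Measure 𝕏} {I : 𝕏 → EReal}

theorem GoodLDP.congr {μ' : ℕ → Measure 𝕏} (h : GoodLDP μ I) (hμ : ∀ᶠ n in atTop, μ' n = μ n) :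
    GoodLDP μ' I where
  lower x V hV hx M hM := by
    filter_upwards [h.lower x V hV hx M hM, hμ] with n hn hn'
    rwa [hn']
  upper x M hM := by
    obtain ⟨V, hV, hx, h⟩ := h.upper x M hM
    refine ⟨V, hV, hx, ?_⟩
    filter_upwards [h, hμ] with n hn hn'
    rwa [hn']
  tight M := by
    obtain ⟨K, hK, h⟩ := h.tight M
    refine ⟨K, hK, ?_⟩
    filter_upwards [h, hμ] with n hn hn'
    rwa [hn']

/-- If `I` were below `M` at a point of the neighbourhood `V` given by the upper bound at `x`, the
lower bound there would force `e^{-nM} ≤ e^{-nM'}` with `M < M'`. -/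
theorem GoodLDP.lowerSemicontinuous (h : GoodLDP μ I) : LowerSemicontinuous I := by
  intro x y hy
  obtain ⟨M, hyM, hM⟩ := EReal.lt_iff_exists_real_btwn.1 hy
  obtain ⟨M', hMM', hM'⟩ := EReal.lt_iff_exists_real_btwn.1 hM
  obtain ⟨V, hV, hxV, hup⟩ := h.upper x M' hM'
  filter_upwards [hV.mem_nhds hxV] with z hz
  refine hyM.trans_le ?_
  by_contra! hlt
  have hlow := h.lower z V hV hz M hlt
  obtain ⟨n, ⟨h1, h2⟩, hn⟩ := ((hup.and hlow).and (eventually_gt_atTop 0)).exists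
  exact absurd (h2.trans h1) (not_le.2 (expBound_lt (by exact_mod_cast hMM') hn))

/-- A finite subcover and a union bound. The extra set `S` lets the same covering serve for closed
sets and, in the contraction principle, for preimages of small neighbourhoods. -/
theorem measure_compact_inter_le_of_local {K : Set 𝕏} (hK : IsCompact K) {S : Set 𝕏}
    {M M' : ℝ} (hM : M < M')
    (hloc : ∀ x ∈ K, ∃ V, IsOpen V ∧ x ∈ V ∧ ∀ᶠ n in atTop, μ n (V ∩ S) ≤ expBound n M') :
    ∀ᶠ n in atTop, μ n (K ∩ S) ≤ expBound n M := by
  have hloc' : ∀ x, ∃ V, x ∈ K → IsOpen V ∧ x ∈ V ∧ ∀ᶠ n in atTop, μ n (V ∩ S) ≤ expBound n M' := by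
    intro x
    by_cases hx : x ∈ K
    · obtain ⟨V, hV⟩ := hloc x hx
      exact ⟨V, fun _ => hV⟩
    · exact ⟨∅, fun h => absurd h hx⟩
  choose V hV using hloc'
  obtain ⟨t, htK, ht⟩ := hK.elim_nhds_subcover V fun x hx => (hV x hx).1.mem_nhds (hV x hx).2.1
  have hall : ∀ᶠ n in atTop, ∀ x ∈ t, μ n (V x ∩ S) ≤ expBound n M' :=
    (eventually_all_finset t).2 fun x hx => (hV x (htK x hx)).2.2
  have hc : (t.card : ℝ≥0∞) ≠ ⊤ := by simp
  filter_upwards [hall, eventually_const_mul_expBound_le hc hM] with n h2 h3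
  calc μ n (K ∩ S) ≤ μ n (⋃ x ∈ t, V x ∩ S) := by
        apply measure_mono
        rintro z ⟨hzK, hz⟩
        obtain ⟨x, hx, hzx⟩ := Set.mem_iUnion₂.1 (ht hzK)
        exact Set.mem_iUnion₂.2 ⟨x, hx, hzx, hz⟩
    _ ≤ ∑ x ∈ t, μ n (V x ∩ S) := measure_biUnion_finset_le _ _
    _ ≤ ∑ x ∈ t, expBound n M' := Finset.sum_le_sum h2
    _ = (t.card : ℝ≥0∞) * expBound n M' := by rw [Finset.sum_const, nsmul_eq_mul]
    _ ≤ expBound n M := h3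

theorem measure_le_of_compact_inter_le {𝕏 : Type*} [MeasurableSpace 𝕏] {μ : ℕ → Measure 𝕏} {K S : Set 𝕏} {M M' : ℝ} (hM : M < M')
    (h₁ : ∀ᶠ n in atTop, μ n (K ∩ S) ≤ expBound n M')
    (h₂ : ∀ᶠ n in atTop, μ n Kᶜ ≤ expBound n M') :
    ∀ᶠ n in atTop, μ n S ≤ expBound n M := by
  have hc : (2 : ℝ≥0∞) ≠ ⊤ := by simp
  filter_upwards [h₁, h₂, eventually_const_mul_expBound_le hc hM] with n h1 h2 h3
  calc μ n S ≤ μ n (K ∩ S ∪ Kᶜ) := measure_mono fun z hz => by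
        by_cases hzK : z ∈ K
        · exact Or.inl ⟨hzK, hz⟩
        · exact Or.inr hzK
    _ ≤ μ n (K ∩ S) + μ n Kᶜ := measure_union_le _ _
    _ ≤ expBound n M' + expBound n M' := by gcongr
    _ = 2 * expBound n M' := by ring
    _ ≤ expBound n M := h3

theorem GoodLDP.measure_closed_le (h : GoodLDP μ I) {F : Set 𝕏} (hF : IsClosed F) {M : ℝ}
    (hM : (M : EReal) < ⨅ x ∈ F, I x) : ∀ᶠ n in atTop, μ n F ≤ expBound n M := by
  obtain ⟨M', hMM', hM'⟩ := EReal.lt_iff_exists_real_btwn.1 hM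
  obtain ⟨M'', hMM'', hM''⟩ := EReal.lt_iff_exists_real_btwn.1 hM'
  obtain ⟨K, hK, htight⟩ := h.tight M'
  refine measure_le_of_compact_inter_le (K := K) (by exact_mod_cast hMM') ?_ htight
  refine measure_compact_inter_le_of_local hK (M' := M'') (by exact_mod_cast hMM'') fun x _ => ?_
  by_cases hx : x ∈ F
  · obtain ⟨V, hV, hxV, hup⟩ := h.upper x M'' (hM''.trans_le (iInf₂_le x hx))
    exact ⟨V, hV, hxV, hup.mono fun n hn => (measure_mono Set.inter_subset_left).trans hn⟩
  · refine ⟨Fᶜ, hF.isOpen_compl, hx, Eventually.of_forall fun n => ?_⟩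
    simp

theorem GoodLDP.satisfiesLDP [BorelSpace 𝕏] {Ω : Type*} [MeasurableSpace Ω] {Pr : Measure Ω}
    {X : ℕ → Ω → 𝕏} (h : GoodLDP μ I) (hI : ∀ x, I x ≠ ⊥)
    (hlaw : ∀ n, ∀ S, MeasurableSet S → Pr {ω | X n ω ∈ S} = μ n S) :
    SatisfiesLDP Pr X I where
  ne_bot := hI
  lowerSemicontinuous := h.lowerSemicontinuous
  lower_bound O hO := by
    rw [EReal.neg_le]
    refine le_iInf₂ fun x hx => ?_
    rw [← EReal.le_of_forall_lt_iff_le]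
    intro M hM
    rw [EReal.neg_le]
    refine le_liminf_of_le (by isBoundedDefault) ?_
    filter_upwards [h.lower x O hO hx M hM, eventually_gt_atTop 0] with n hn hn0
    rw [hlaw n O hO.measurableSet, ← inv_mul_log_expBound hn0]
    gcongr
  upper_bound F hF := by
    rw [← EReal.neg_le_neg_iff, neg_neg, ← EReal.ge_of_forall_gt_iff_ge]
    intro M hM
    rw [EReal.le_neg]
    refine limsup_le_of_le (by isBoundedDefault) ?_
    filter_upwards [h.measure_closed_le hF hM, eventually_gt_atTop 0] with n hn hn0
    rw [hlaw n F hF.measurableSet, ← inv_mul_log_expBound hn0]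
    gcongr

/-- The contraction principle. -/
theorem GoodLDP.map [BorelSpace 𝕏] {𝕐 : Type*} [TopologicalSpace 𝕐] [T2Space 𝕐]
    [MeasurableSpace 𝕐] [BorelSpace 𝕐] (h : GoodLDP μ I) {f : 𝕏 → 𝕐} (hf : Continuous f) :
    GoodLDP (fun n => (μ n).map f) (fun z => ⨅ (x : 𝕏) (_ : f x = z), I x) where
  lower z V hV hz M hM := by
    simp only [iInf_lt_iff] at hM
    obtain ⟨x, rfl, hM⟩ := hM
    filter_upwards [h.lower x (f ⁻¹' V) (hV.preimage hf) hz M hM] with n hn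
    rwa [Measure.map_apply hf.measurable hV.measurableSet]
  upper z M hM := by
    obtain ⟨M', hMM', hM'⟩ := EReal.lt_iff_exists_real_btwn.1 hM
    obtain ⟨M'', hMM'', hM''⟩ := EReal.lt_iff_exists_real_btwn.1 hM'
    obtain ⟨K, hK, htight⟩ := h.tight M''
    -- On the fibre over `z` the rate makes `V` improbable. Off the fibre, separating `f x` from `z`
    -- makes the intersection empty. A finite subcover of `K` leaves finitely many `W`, and their
    -- intersection is the required neighbourhood of `z`.
    have hloc : ∀ x, ∃ V W, IsOpen V ∧ x ∈ V ∧ IsOpen W ∧ z ∈ W ∧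
        ∀ᶠ n in atTop, μ n (V ∩ f ⁻¹' W) ≤ expBound n M'' := by
      intro x
      by_cases hx : f x = z
      · obtain ⟨V, hV, hxV, hup⟩ := h.upper x M'' (hM''.trans_le (iInf₂_le x hx))
        exact ⟨V, Set.univ, hV, hxV, isOpen_univ, trivial,
          hup.mono fun n hn => (measure_mono Set.inter_subset_left).trans hn⟩
      · obtain ⟨A, B, hA, hB, hxA, hzB, hAB⟩ := t2_separation hx
        refine ⟨f ⁻¹' A, B, hA.preimage hf, hxA, hB, hzB, Eventually.of_forall fun n => ?_⟩
        rw [← Set.preimage_inter, hAB.inter_eq]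
        simp
    choose V W hVo hxV hWo hzW hVW using hloc
    obtain ⟨t, -, ht⟩ := hK.elim_nhds_subcover V fun x _ => (hVo x).mem_nhds (hxV x)
    have hWo' : IsOpen (⋂ x ∈ t, W x) := isOpen_biInter_finset fun x _ => hWo x
    refine ⟨⋂ x ∈ t, W x, hWo', Set.mem_iInter₂.2 fun x _ => hzW x, ?_⟩
    have hM'M : M' < M'' := by exact_mod_cast hMM''
    have key := measure_compact_inter_le_of_local (μ := μ) hK (S := f ⁻¹' (⋂ x ∈ t, W x))
      hM'M fun x hx => ?_
    · refine (measure_le_of_compact_inter_le (by exact_mod_cast hMM') key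
        (htight.mono fun n hn => hn.trans (expBound_anti hM'M.le n))).mono fun n hn => ?_
      rwa [Measure.map_apply hf.measurable hWo'.measurableSet]
    · obtain ⟨x', hx', hxx'⟩ := Set.mem_iUnion₂.1 (ht hx)
      refine ⟨V x', hVo x', hxx', (hVW x').mono fun n hn => le_trans (measure_mono ?_) hn⟩
      rintro w ⟨hw1, hw2⟩
      exact ⟨hw1, Set.mem_iInter₂.1 hw2 x' hx'⟩
  tight M := by
    obtain ⟨K, hK, htight⟩ := h.tight M
    refine ⟨f '' K, hK.image hf, htight.mono fun n hn => ?_⟩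
    rw [Measure.map_apply hf.measurable (hK.image hf).isClosed.measurableSet.compl]
    refine le_trans (measure_mono ?_) hn
    intro w hw hwK
    exact hw ⟨w, hwK, rfl⟩

end GoodLDP

/-! ### Joint laws built from a measure and a locally uniform kernel -/

section KernelLDP

variable {𝕐 𝕏 : Type*} [TopologicalSpace 𝕐] [MeasurableSpace 𝕐] [BorelSpace 𝕐] [T2Space 𝕐]
  [TopologicalSpace 𝕏] [MeasurableSpace 𝕏] [BorelSpace 𝕏] [T2Space 𝕏]
  {μ : ℕ → Measure 𝕐} {I : 𝕐 → EReal} {κ : ℕ → Kernel 𝕐 𝕏} {J : 𝕐 → 𝕏 → EReal}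

/-- The bounds on the kernel hold uniformly on a neighbourhood of `y`, so integrating them there
multiplies the two exponential estimates and adds the rates. -/
theorem GoodLDP.compProd [∀ n, IsProbabilityMeasure (μ n)] [∀ n, IsMarkovKernel (κ n)]
    (h : GoodLDP μ I) (hκ : KernelLDP κ J) (hI : ∀ y, 0 ≤ I y) (hJ : ∀ y x, 0 ≤ J y x) :
    GoodLDP (fun n => μ n ⊗ₘ κ n) (fun p : 𝕐 × 𝕏 => I p.1 + J p.1 p.2) where
  lower := by
    rintro ⟨y, x⟩ V hV hxV M hM
    obtain ⟨A, B, hA, hB, hyA, hxB, hAB⟩ := isOpen_prod_iff.1 hV y x hxV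
    obtain ⟨M₁, M₂, h₁, h₂, hle⟩ := EReal.exists_lt_coe_lt_coe_add_le_of_add_lt (hI y) (hJ y x) hM
    obtain ⟨U, hU, hyU, hlow⟩ := hκ.lower y x B hB hxB M₂ h₂
    filter_upwards [hlow, h.lower y (A ∩ U) (hA.inter hU) ⟨hyA, hyU⟩ M₁ h₁] with n hn₂ hn₁
    calc expBound n M ≤ expBound n (M₁ + M₂) := expBound_anti hle n
      _ = expBound n M₂ * expBound n M₁ := by rw [expBound_add, mul_comm]
      _ ≤ expBound n M₂ * μ n (A ∩ U) := by gcongr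
      _ = ∫⁻ _ in A ∩ U, expBound n M₂ ∂(μ n) := by rw [setLIntegral_const]
      _ ≤ ∫⁻ z in A ∩ U, κ n z B ∂(μ n) :=
          setLIntegral_mono' (hA.inter hU).measurableSet fun z hz => hn₂ z hz.2
      _ = (μ n ⊗ₘ κ n) ((A ∩ U) ×ˢ B) :=
          (Measure.compProd_apply_prod (hA.inter hU).measurableSet hB.measurableSet).symm
      _ ≤ (μ n ⊗ₘ κ n) V :=
          measure_mono (le_trans (Set.prod_mono Set.inter_subset_left subset_rfl) hAB)
  upper := by
    rintro ⟨y, x⟩ M hM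
    obtain ⟨M₁, M₂, h₁, h₂, hle⟩ := EReal.exists_coe_lt_coe_lt_add_of_lt_add (hI y) (hJ y x) hM
    obtain ⟨B, hB, hxB, U, hU, hyU, hup⟩ := hκ.upper y x M₂ h₂
    obtain ⟨A, hA, hyA, hup'⟩ := h.upper y M₁ h₁
    refine ⟨(A ∩ U) ×ˢ B, (hA.inter hU).prod hB, ⟨⟨hyA, hyU⟩, hxB⟩, ?_⟩
    filter_upwards [hup, hup'] with n hn₂ hn₁
    calc (μ n ⊗ₘ κ n) ((A ∩ U) ×ˢ B) = ∫⁻ z in A ∩ U, κ n z B ∂(μ n) :=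
          Measure.compProd_apply_prod (hA.inter hU).measurableSet hB.measurableSet
      _ ≤ ∫⁻ _ in A ∩ U, expBound n M₂ ∂(μ n) :=
          setLIntegral_mono' (hA.inter hU).measurableSet fun z hz => hn₂ z hz.2
      _ = expBound n M₂ * μ n (A ∩ U) := by rw [setLIntegral_const]
      _ ≤ expBound n M₂ * expBound n M₁ := by
          gcongr
          exact (measure_mono Set.inter_subset_left).trans hn₁
      _ = expBound n (M₁ + M₂) := by rw [expBound_add, mul_comm]
      _ ≤ expBound n M := expBound_anti hle n
  tight M := by
    obtain ⟨K, hK, htight⟩ := h.tight (M + 1)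
    -- The compact set for the kernel depends on `y` only locally, so finitely many of them cover
    -- all `y ∈ K`.
    obtain ⟨K', hK', htight'⟩ : ∃ K', IsCompact K' ∧
        ∀ᶠ n in atTop, ∀ y ∈ K, κ n y K'ᶜ ≤ expBound n (M + 1) := by
      choose K' hK' U hU hyU hup using fun y => hκ.tight y (M + 1)
      obtain ⟨t, -, ht⟩ := hK.elim_nhds_subcover U fun y _ => (hU y).mem_nhds (hyU y)
      refine ⟨⋃ y ∈ t, K' y, t.isCompact_biUnion fun y _ => hK' y, ?_⟩
      have hall : ∀ᶠ n in atTop, ∀ y ∈ t, ∀ y' ∈ U y, κ n y' (K' y)ᶜ ≤ expBound n (M + 1) :=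
        (eventually_all_finset t).2 fun y _ => hup y
      filter_upwards [hall] with n hn y hy
      obtain ⟨y', hy', hyy'⟩ := Set.mem_iUnion₂.1 (ht hy)
      refine le_trans (measure_mono ?_) (hn y' hy' y hyy')
      rw [Set.compl_subset_compl]
      exact Set.subset_biUnion_of_mem (u := fun y => K' y) hy'
    have hc : (2 : ℝ≥0∞) ≠ ⊤ := by simp
    refine ⟨K ×ˢ K', hK.prod hK', ?_⟩
    filter_upwards [htight, htight', eventually_const_mul_expBound_le hc (lt_add_one M)]
      with n h1 h2 h3
    calc (μ n ⊗ₘ κ n) (K ×ˢ K')ᶜ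
        ≤ (μ n ⊗ₘ κ n) (Kᶜ ×ˢ Set.univ ∪ K ×ˢ K'ᶜ) := by
          refine measure_mono ?_
          rintro ⟨y, x⟩ hyx
          by_cases hy : y ∈ K
          · exact Or.inr ⟨hy, fun hx => hyx ⟨hy, hx⟩⟩
          · exact Or.inl ⟨hy, trivial⟩
      _ ≤ (μ n ⊗ₘ κ n) (Kᶜ ×ˢ Set.univ) + (μ n ⊗ₘ κ n) (K ×ˢ K'ᶜ) := measure_union_le _ _
      _ = μ n Kᶜ + ∫⁻ y in K, κ n y K'ᶜ ∂(μ n) := by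
          rw [Measure.compProd_apply_prod hK.isClosed.measurableSet.compl .univ,
            Measure.compProd_apply_prod hK.isClosed.measurableSet hK'.isClosed.measurableSet.compl]
          simp
      _ ≤ expBound n (M + 1) + ∫⁻ _ in K, expBound n (M + 1) ∂(μ n) := by
          exact add_le_add h1 (setLIntegral_mono' hK.isClosed.measurableSet fun y hy => h2 y hy)
      _ ≤ expBound n (M + 1) + expBound n (M + 1) * 1 := by
          rw [setLIntegral_const]
          gcongr
          exact prob_le_one
      _ = 2 * expBound n (M + 1) := by ring
      _ ≤ expBound n M := h3

end KernelLDP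

/-- A locally uniform large deviation principle may be checked after a closed embedding. -/
theorem KernelLDP.of_map_isClosedEmbedding {𝕐 𝕏 : Type*} [TopologicalSpace 𝕐]
    [MeasurableSpace 𝕐] [TopologicalSpace 𝕏] [MeasurableSpace 𝕏] [BorelSpace 𝕏]
    {κ : ℕ → Kernel 𝕐 𝕏} {𝕎 : Type*} [TopologicalSpace 𝕎] [MeasurableSpace 𝕎]
    [BorelSpace 𝕎] [T2Space 𝕎] {f : 𝕏 → 𝕎} (hf : IsClosedEmbedding f) {J : 𝕐 → 𝕎 → EReal}
    (h : KernelLDP (fun n => (κ n).map f) J) : KernelLDP κ (fun y x => J y (f x)) where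
  lower y x V hV hxV M hM := by
    obtain ⟨W, hW, rfl⟩ := hf.isInducing.isOpen_iff.1 hV
    obtain ⟨U, hU, hyU, hlow⟩ := h.lower y (f x) W hW hxV M hM
    refine ⟨U, hU, hyU, hlow.mono fun n hn y' hy' => ?_⟩
    rw [← Kernel.map_apply' _ hf.continuous.measurable _ hW.measurableSet]
    exact hn y' hy'
  upper y x M hM := by
    obtain ⟨W, hW, hxW, U, hU, hyU, hup⟩ := h.upper y (f x) M hM
    refine ⟨f ⁻¹' W, hW.preimage hf.continuous, hxW, U, hU, hyU, hup.mono fun n hn y' hy' => ?_⟩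
    rw [← Kernel.map_apply' _ hf.continuous.measurable _ hW.measurableSet]
    exact hn y' hy'
  tight y M := by
    obtain ⟨K, hK, U, hU, hyU, hup⟩ := h.tight y M
    refine ⟨f ⁻¹' K, hf.isCompact_preimage hK, U, hU, hyU, hup.mono fun n hn y' hy' => ?_⟩
    rw [← Set.preimage_compl,
      ← Kernel.map_apply' _ hf.continuous.measurable _ hK.isClosed.measurableSet.compl]
    exact hn y' hy'

/-! ### Convolution powers -/

section ConvPow

variable {V : Type*} [NormedAddCommGroup V] [NormedSpace ℝ V] [FiniteDimensional ℝ V]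
  [MeasurableSpace V] [BorelSpace V]

/-- The `n`-fold convolution of a measure with itself. -/
def convPow (μ : Measure V) : ℕ → Measure V
  | 0 => Measure.dirac 0
  | n + 1 => convPow μ n ∗ μ

instance convPow.isFiniteMeasure (μ : Measure V) [IsFiniteMeasure μ] :
    ∀ n, IsFiniteMeasure (convPow μ n)
  | 0 => by rw [convPow]; infer_instance
  | n + 1 => by
    have := convPow.isFiniteMeasure μ n
    rw [convPow]; infer_instance

instance convPow.isProbabilityMeasure (μ : Measure V) [IsProbabilityMeasure μ] :
    ∀ n, IsProbabilityMeasure (convPow μ n)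
  | 0 => by rw [convPow]; infer_instance
  | n + 1 => by
    have := convPow.isProbabilityMeasure μ n
    rw [convPow]; infer_instance

theorem convPow_add (μ : Measure V) [IsFiniteMeasure μ] (n : ℕ) :
    ∀ m, convPow μ (n + m) = convPow μ n ∗ convPow μ m
  | 0 => by simp [convPow]
  | m + 1 => by
    rw [← add_assoc, convPow, convPow_add μ n m, convPow, Measure.conv_assoc]

theorem mul_le_conv_of_add_subset {μ ν : Measure V} [SFinite ν] {A B D : Set V}
    (hD : MeasurableSet D)
    (h : ∀ a ∈ A, ∀ b ∈ B, a + b ∈ D) : μ A * ν B ≤ (μ ∗ ν) D := by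
  rw [Measure.conv, Measure.map_apply (by fun_prop) hD, ← Measure.prod_prod]
  exact measure_mono fun p hp => h _ hp.1 _ hp.2

theorem convPow_mul_le (μ : Measure V) [IsFiniteMeasure μ] {n m : ℕ} {A B D : Set V}
    (hD : MeasurableSet D)
    (h : ∀ a ∈ A, ∀ b ∈ B, a + b ∈ D) :
    convPow μ n A * convPow μ m B ≤ convPow μ (n + m) D := by
  rw [convPow_add]
  exact mul_le_conv_of_add_subset hD h

theorem convPow_mono {μ ν : Measure V} [IsFiniteMeasure ν] [IsFiniteMeasure μ] (h : μ ≤ ν) :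
    ∀ n, convPow μ n ≤ convPow ν n
  | 0 => le_rfl
  | n + 1 => Measure.map_mono (Measure.prod_mono (convPow_mono h n) h) (by fun_prop)

/-- The Laplace transform of a measure. -/
def laplace (μ : Measure V) (L : V →L[ℝ] ℝ) : ℝ≥0∞ := ∫⁻ x, ENNReal.ofReal (Real.exp (L x)) ∂μ

theorem laplace_convPow (μ : Measure V) [IsFiniteMeasure μ] (L : V →L[ℝ] ℝ) :
    ∀ n, laplace (convPow μ n) L = laplace μ L ^ n
  | 0 => by simp [laplace, convPow]
  | n + 1 => by
    have h := laplace_convPow μ L n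
    rw [laplace] at h
    rw [laplace, convPow, Measure.lintegral_conv (by fun_prop)]
    simp only [map_add, Real.exp_add]
    simp_rw [ENNReal.ofReal_mul (Real.exp_pos _).le]
    rw [lintegral_lintegral_mul (by fun_prop) (by fun_prop), h, pow_succ, laplace]

theorem convPow_le_chernoff (μ : Measure V) [IsFiniteMeasure μ] (L : V →L[ℝ] ℝ) (n : ℕ) (c : ℝ) :
    convPow μ n {s | n * c ≤ L s} ≤ ENNReal.ofReal (Real.exp (-(n * c))) * laplace μ L ^ n := by
  rw [← laplace_convPow]
  calc convPow μ n {s | n * c ≤ L s}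
      = ENNReal.ofReal (Real.exp (-(n * c))) *
          (ENNReal.ofReal (Real.exp (n * c)) * convPow μ n {s | n * c ≤ L s}) := by
        rw [← mul_assoc, ← ENNReal.ofReal_mul (Real.exp_pos _).le, ← Real.exp_add]
        simp
    _ ≤ ENNReal.ofReal (Real.exp (-(n * c))) * (ENNReal.ofReal (Real.exp (n * c)) *
          convPow μ n {s | ENNReal.ofReal (Real.exp (n * c)) ≤ ENNReal.ofReal (Real.exp (L s))}) := by
        gcongr
        intro hs
        exact ENNReal.ofReal_le_ofReal (Real.exp_le_exp.2 hs)
    _ ≤ _ := by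
        gcongr
        exact mul_meas_ge_le_lintegral (by fun_prop) _

/-- The law of a sum of independent identically distributed vectors is a convolution power. -/
theorem map_sum_range_eq_convPow {Ω : Type*} [MeasurableSpace Ω] {P : Measure Ω}
    [IsProbabilityMeasure P] {μ : Measure V} {X : ℕ → Ω → V} (m : ℕ)
    (hX : ∀ i < m, Measurable (X i)) (hlaw : ∀ i < m, P.map (X i) = μ)
    (hind : iIndepFun (fun (i : Fin m) => X i) P) :
    P.map (fun ω => ∑ i ∈ Finset.range m, X i ω) = convPow μ m := by
  induction m with
  | zero => simp [convPow]
  | succ m ih =>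
    have h1 := ih (fun i hi => hX i (by omega)) (fun i hi => hlaw i (by omega))
      (hind.precomp (g := Fin.castSucc) (Fin.castSucc_injective m))
    have h2 : IndepFun (∑ i ∈ Finset.univ.map (Fin.castSuccEmb : Fin m ↪ Fin (m + 1)),
        X (i : Fin (m + 1))) (X (Fin.last m : Fin (m + 1))) P :=
      hind.indepFun_finsetSum_of_notMem (fun i => hX i i.2) (by simp [Fin.castSucc_ne_last])
    have h3 : (∑ i ∈ Finset.univ.map (Fin.castSuccEmb : Fin m ↪ Fin (m + 1)),
        X (i : Fin (m + 1))) = fun ω => ∑ i ∈ Finset.range m, X i ω := by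
      ext ω
      rw [Finset.sum_map, Finset.sum_apply, Finset.sum_range]
      simp
    rw [h3] at h2
    have h4 := h2.map_add_eq_map_conv_map (Finset.measurable_fun_sum _ fun i hi => hX i (by
      have := Finset.mem_range.1 hi; omega)) (hX m (by omega))
    rw [h1, hlaw m (by omega)] at h4
    rw [convPow, ← h4]
    congr 1
    ext ω
    simp [Finset.sum_range_succ]

end ConvPow

/-! ### Cramér's theorem -/

section Cramer

variable {V : Type*} [NormedAddCommGroup V] [NormedSpace ℝ V] [FiniteDimensional ℝ V]
  [MeasurableSpace V] [BorelSpace V] (μ : Measure V)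

/-- The Legendre transform of the logarithm of the Laplace transform of `μ`. -/
def cramerRate (x : V) : EReal :=
  ⨆ L : V →L[ℝ] ℝ, ((L x : ℝ) : EReal) - ENNReal.log (laplace μ L)

/-- The pairs `(x, a)` such that the mean of `n` independent variables of law `μ` is close to `x`
with probability at least about `e^{na}`. -/
def lowerPairs : Set (V × ℝ) :=
  {p | ∀ r : ℝ, 0 < r → ∀ᶠ n : ℕ in atTop,
    expBound n (r - p.2) ≤ convPow μ n (Metric.ball ((n : ℝ) • p.1) (n * r))}

variable {μ}

theorem isClosed_lowerPairs : IsClosed (lowerPairs μ) := by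
  rw [← closure_subset_iff_isClosed]
  rintro ⟨x, a⟩ h r hr
  rw [Metric.mem_closure_iff] at h
  obtain ⟨⟨x', a'⟩, hA, hd⟩ := h (r / 2) (by positivity)
  rw [Prod.dist_eq, max_lt_iff] at hd
  filter_upwards [hA (r / 2) (by positivity)] with n hn
  have ha := abs_lt.1 (Real.dist_eq a a' ▸ hd.2)
  refine (expBound_anti (by linarith) n).trans (hn.trans (measure_mono ?_))
  apply Metric.ball_subset_ball'
  simp only [dist_smul₀, Real.norm_natCast]
  have h2 : dist x' x < r / 2 := by rw [dist_comm]; exact hd.1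
  have : (n : ℝ) * dist x' x ≤ n * (r / 2) := by gcongr
  linarith

theorem nonpos_of_mem_lowerPairs [IsProbabilityMeasure μ] {p : V × ℝ} (hp : p ∈ lowerPairs μ) :
    p.2 ≤ 0 := by
  by_contra! h
  obtain ⟨n, hn, hn0⟩ := ((hp (p.2 / 2) (by positivity)).and (eventually_gt_atTop 0)).exists
  have h1 := hn.trans prob_le_one
  have h2 : expBound n 0 < expBound n (p.2 / 2 - p.2) := expBound_lt (by linarith) hn0
  exact absurd (h2.trans_le h1) (not_lt.2 (one_le_expBound le_rfl n))

theorem mem_lowerPairs_of_le {x : V} {a b : ℝ} (h : (x, a) ∈ lowerPairs μ) (hb : b ≤ a) :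
    (x, b) ∈ lowerPairs μ := fun r hr =>
  (h r hr).mono fun n hn => (expBound_anti (by linarith) n).trans hn

/-- A sum of `n` terms splits into independent blocks of lengths `⌊tn⌋` and `n - ⌊tn⌋`, the first
steered towards `x₁` and the second towards `x₂`. -/
theorem convex_lowerPairs [IsProbabilityMeasure μ] : Convex ℝ (lowerPairs μ) := by
  rw [convex_iff_forall_pos]
  rintro ⟨x₁, a₁⟩ h₁ ⟨x₂, a₂⟩ h₂ t s ht hs hts r hr
  have hf : Tendsto (fun n : ℕ => ⌊t * (n : ℝ)⌋₊) atTop atTop :=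
    tendsto_nat_floor_atTop.comp (tendsto_natCast_atTop_atTop.const_mul_atTop ht)
  have hfle : ∀ n : ℕ, (⌊t * (n : ℝ)⌋₊ : ℝ) ≤ t * n := fun n => Nat.floor_le (by positivity)
  have hflt : ∀ n : ℕ, t * n < (⌊t * (n : ℝ)⌋₊ : ℝ) + 1 := fun n => Nat.lt_floor_add_one _
  have hfn : ∀ n : ℕ, ⌊t * (n : ℝ)⌋₊ ≤ n := fun n => by
    have : (⌊t * (n : ℝ)⌋₊ : ℝ) ≤ n := (hfle n).trans (by
      have : (0 : ℝ) ≤ n := n.cast_nonneg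
      nlinarith)
    exact_mod_cast this
  have hg : Tendsto (fun n : ℕ => n - ⌊t * (n : ℝ)⌋₊) atTop atTop := by
    rw [← tendsto_natCast_atTop_iff (R := ℝ)]
    refine tendsto_atTop_mono (fun n => ?_) (tendsto_natCast_atTop_atTop.const_mul_atTop hs)
    rw [Nat.cast_sub (hfn n)]
    have h := hfle n
    have : s * (n : ℝ) = n - t * n := by
      rw [eq_sub_iff_add_eq'.2 hts]; ring
    linarith
  -- Rounding `tn` moves the centre by at most `‖x₁ - x₂‖` and the exponent by at most `|a₁ - a₂|`;
  -- the half of the radius kept in reserve covers both.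
  have hb : ∀ᶠ n : ℕ in atTop, ‖x₁ - x₂‖ + |a₁ - a₂| ≤ n * (r / 2) :=
    (tendsto_natCast_atTop_atTop.atTop_mul_const (by positivity)).eventually_ge_atTop _
  filter_upwards [hf.eventually (h₁ (r / 2) (by positivity)),
    hg.eventually (h₂ (r / 2) (by positivity)), hb] with n hn₁ hn₂ hn
  set k := ⌊t * (n : ℝ)⌋₊ with hk
  have hkn : k + (n - k) = n := Nat.add_sub_cancel' (hfn n)
  have hcast : ((n - k : ℕ) : ℝ) = n - k := Nat.cast_sub (hfn n)
  have hs' : s = 1 - t := by linarith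
  have hθ : |(k : ℝ) - t * n| ≤ 1 := by
    rw [abs_le]; constructor <;> linarith [hfle n, hflt n]
  have hmul := convPow_mul_le μ (n := k) (m := n - k)
    (A := Metric.ball ((k : ℝ) • x₁) (k * (r / 2)))
    (B := Metric.ball (((n - k : ℕ) : ℝ) • x₂) ((n - k : ℕ) * (r / 2)))
    (D := Metric.ball ((n : ℝ) • (t • x₁ + s • x₂)) (n * r))
    measurableSet_ball (by
      intro u hu v hv
      rw [mem_ball_iff_norm] at hu hv ⊢
      rw [hcast] at hv
      have e : u + v - (n : ℝ) • (t • x₁ + s • x₂) = (u - (k : ℝ) • x₁) +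
          (v - ((n : ℝ) - k) • x₂) + ((k : ℝ) - t * n) • (x₁ - x₂) := by
        rw [hs']; module
      have h3 : ‖((k : ℝ) - t * n) • (x₁ - x₂)‖ ≤ ‖x₁ - x₂‖ := by
        rw [norm_smul, Real.norm_eq_abs]
        exact mul_le_of_le_one_left (norm_nonneg _) hθ
      rw [e]
      have h4 := norm_add₃_le (a := u - (k : ℝ) • x₁) (b := v - ((n : ℝ) - k) • x₂)
        (c := ((k : ℝ) - t * n) • (x₁ - x₂))
      have h5 := abs_nonneg (a₁ - a₂)
      nlinarith)
  rw [hkn] at hmul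
  refine le_trans ?_ ((mul_le_mul' hn₁ hn₂).trans hmul)
  rw [expBound, expBound, expBound, ← ENNReal.ofReal_mul (Real.exp_pos _).le, ← Real.exp_add]
  apply ENNReal.ofReal_le_ofReal
  apply Real.exp_le_exp.2
  rw [hcast]
  have h6 : ((k : ℝ) - t * n) * (a₁ - a₂) ≥ -|a₁ - a₂| := by
    have : |((k : ℝ) - t * n) * (a₁ - a₂)| ≤ |a₁ - a₂| := by
      rw [abs_mul]; exact mul_le_of_le_one_left (abs_nonneg _) hθ
    linarith [neg_abs_le (((k : ℝ) - t * n) * (a₁ - a₂))]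
  simp only [Prod.snd_add, Prod.smul_snd, smul_eq_mul, hs']
  have h7 := norm_nonneg (x₁ - x₂)
  nlinarith

/-! ### Superadditivity: a bound at one length gives bounds at all large lengths -/

/-- Controls the remainder of the division of `n` by `m`: finitely many laws are tight together. -/
theorem exists_half_le_convPow_closedBall [IsProbabilityMeasure μ] (m : ℕ) :
    ∃ R : ℝ, ∀ j < m, (2 : ℝ≥0∞)⁻¹ ≤ convPow μ j (Metric.ball 0 R) := by
  have h : ∀ j, ∃ N : ℕ, ∀ R : ℕ, N ≤ R → (2 : ℝ≥0∞)⁻¹ ≤ convPow μ j (Metric.ball 0 (R : ℝ)) := by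
    intro j
    have ht : Tendsto (fun R : ℕ => convPow μ j (Metric.ball 0 (R : ℝ))) atTop
        (𝓝 (convPow μ j (⋃ R : ℕ, Metric.ball 0 (R : ℝ)))) :=
      tendsto_measure_iUnion_atTop fun a b hab => Metric.ball_subset_ball (by exact_mod_cast hab)
    rw [Metric.iUnion_ball_nat, measure_univ] at ht
    exact eventually_atTop.1 (ht.eventually_const_le (by simp))
  choose N hN using h
  refine ⟨((Finset.range m).sup N : ℕ), fun j hj => hN j _ ?_⟩
  exact Finset.le_sup (f := N) (Finset.mem_range.2 hj)

/-- Requires each of `k` independent blocks of length `m` to be near `m • x`. The ball on the right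
is closed because for `k = 0` its radius is `0`, where an open ball would be empty. -/
theorem convPow_ball_mul_le [IsProbabilityMeasure μ] (x : V) (r : ℝ) (m : ℕ) :
    ∀ k, convPow μ m (Metric.ball ((m : ℝ) • x) (m * r)) ^ k ≤
      convPow μ (m * k) (Metric.closedBall (((m * k : ℕ) : ℝ) • x) ((m * k : ℕ) * r))
  | 0 => by simp [convPow]
  | k + 1 => by
    rw [pow_succ, mul_add, mul_one]
    refine (mul_le_mul_left (convPow_ball_mul_le x r m k) _).trans
      (convPow_mul_le μ measurableSet_closedBall ?_)
    intro u hu v hv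
    rw [mem_closedBall_iff_norm] at hu ⊢
    rw [mem_ball_iff_norm] at hv
    rw [Nat.cast_add, add_smul, add_mul, add_sub_add_comm]
    exact (norm_add_le _ _).trans (add_le_add hu hv.le)

/-- Fekete's argument with `n = m (n / m) + n % m`. The gap `r' - r` is used twice: in the radius it
absorbs the bounded remainder, and in the exponent it absorbs the factor `2` lost on it. The sign of
`a` lets `m (n / m)` be replaced by `n`. -/
theorem eventually_expBound_le_convPow_ball [IsProbabilityMeasure μ] {x : V} {a r r' : ℝ} {m : ℕ}
    (hm : 0 < m) (ha : a ≤ 0) (hr : r < r') (hr0 : 0 ≤ r)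
    (h : expBound m (-a) ≤ convPow μ m (Metric.ball ((m : ℝ) • x) (m * r))) :
    ∀ᶠ n : ℕ in atTop,
      expBound n (r' - r - a) ≤ convPow μ n (Metric.ball ((n : ℝ) • x) (n * r')) := by
  obtain ⟨R, hR⟩ := exists_half_le_convPow_closedBall (μ := μ) m
  have hb : ∀ᶠ n : ℕ in atTop, R + m * ‖x‖ < n * (r' - r) :=
    (tendsto_natCast_atTop_atTop.atTop_mul_const (sub_pos.2 hr)).eventually_gt_atTop _
  have hc : (2 : ℝ≥0∞) ≠ ⊤ := by simp
  filter_upwards [hb, eventually_const_mul_expBound_le hc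
    (show -a < r' - r - a by linarith)] with n hn hn2
  have hdiv : m * (n / m) + n % m = n := Nat.div_add_mod n m
  have hmod : n % m < m := Nat.mod_lt n hm
  have hcast : (n : ℝ) = ((m * (n / m) : ℕ) : ℝ) + ((n % m : ℕ) : ℝ) := by exact_mod_cast hdiv.symm
  have hmul := convPow_mul_le μ (n := m * (n / m)) (m := n % m)
    (A := Metric.closedBall (((m * (n / m) : ℕ) : ℝ) • x) ((m * (n / m) : ℕ) * r))
    (B := Metric.ball 0 R) (D := Metric.ball ((n : ℝ) • x) (n * r'))
    measurableSet_ball (by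
      intro u hu v hv
      rw [mem_closedBall_iff_norm] at hu
      rw [mem_ball_iff_norm] at hv ⊢
      rw [sub_zero] at hv
      have e : u + v - (n : ℝ) • x = (u - ((m * (n / m) : ℕ) : ℝ) • x) + v -
          ((n % m : ℕ) : ℝ) • x := by rw [hcast]; module
      have h1 : ‖((n % m : ℕ) : ℝ) • x‖ ≤ m * ‖x‖ := by
        rw [norm_smul, Real.norm_natCast]
        gcongr
      have h2 : ((m * (n / m) : ℕ) : ℝ) * r ≤ n * r := by
        gcongr
        exact Nat.mul_div_le n m
      rw [e]
      have h3 := norm_sub_le ((u - ((m * (n / m) : ℕ) : ℝ) • x) + v) (((n % m : ℕ) : ℝ) • x)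
      have h4 := norm_add_le (u - ((m * (n / m) : ℕ) : ℝ) • x) v
      linarith)
  rw [hdiv] at hmul
  refine le_trans ?_ ((mul_le_mul' (convPow_ball_mul_le x r m (n / m)) (hR _ hmod)).trans hmul)
  have h5 : expBound n (-a) ≤ convPow μ m (Metric.ball ((m : ℝ) • x) (m * r)) ^ (n / m) := by
    refine le_trans ?_ (pow_le_pow_left' h (n / m))
    rw [expBound, expBound, ← ENNReal.ofReal_pow (Real.exp_pos _).le, ← Real.exp_nat_mul]
    apply ENNReal.ofReal_le_ofReal
    apply Real.exp_le_exp.2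
    have h6 : ((n / m : ℕ) : ℝ) * m ≤ n := by exact_mod_cast Nat.div_mul_le_self n m
    nlinarith
  calc expBound n (r' - r - a) = 2 * expBound n (r' - r - a) * 2⁻¹ := by
        rw [mul_comm, ← mul_assoc, ENNReal.inv_mul_cancel (by simp) hc, one_mul]
    _ ≤ expBound n (-a) * 2⁻¹ := by gcongr
    _ ≤ _ := by gcongr

/-- By superadditivity, exceeding `e^{ma}` on the smaller ball at one single length `m` would give
the lower bound on the larger ball at all large lengths. So the failure of the lower bound yields an
upper bound at every positive length. -/
theorem exists_ball_convPow_le [IsProbabilityMeasure μ] {x : V} {a : ℝ}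
    (h : (x, a) ∉ lowerPairs μ) : ∃ r : ℝ, 0 < r ∧ ∀ m : ℕ, 0 < m →
      convPow μ m (Metric.ball ((m : ℝ) • x) (m * r)) ≤ expBound m (-a) := by
  by_cases ha : 0 < a
  · exact ⟨1, one_pos, fun m _ => prob_le_one.trans (one_le_expBound (by linarith) m)⟩
  simp only [lowerPairs, Set.mem_ofPred_eq, not_forall] at h
  obtain ⟨r, hr, hn⟩ := h
  refine ⟨r / 2, by positivity, fun m hm => ?_⟩
  by_contra! hlt
  refine hn ((eventually_expBound_le_convPow_ball hm (not_lt.1 ha) (half_lt_self hr)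
    (by positivity) hlt.le).mono fun n hn => ?_)
  exact (expBound_anti (by linarith) n).trans hn

/-! ### The log-Laplace transform is bounded by the support function of `lowerPairs` -/

theorem convPow_compl_closedBall_eq_zero [IsFiniteMeasure μ] {R : ℝ}
    (h : μ (Metric.closedBall 0 R)ᶜ = 0) :
    ∀ m : ℕ, convPow μ m (Metric.closedBall 0 (m * R))ᶜ = 0
  | 0 => by
    rw [convPow, Measure.dirac_apply' _ measurableSet_closedBall.compl]
    simp
  | m + 1 => by
    have ih := convPow_compl_closedBall_eq_zero h m
    rw [convPow, Measure.conv, Measure.map_apply (by fun_prop) measurableSet_closedBall.compl]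
    refine measure_mono_null (t := (Metric.closedBall 0 (m * R))ᶜ ×ˢ Set.univ ∪
      Set.univ ×ˢ (Metric.closedBall 0 R)ᶜ) ?_ (measure_union_null ?_ ?_)
    · rintro ⟨u, v⟩ huv
      by_contra hc
      simp only [Set.mem_union, Set.mem_prod, Set.mem_compl_iff, Set.mem_univ, and_true,
        true_and, not_or, not_not, mem_closedBall_zero_iff] at hc
      refine huv (mem_closedBall_zero_iff.2 ((norm_add_le u v).trans ?_))
      push_cast
      linarith
    · rw [Measure.prod_prod, ih, zero_mul]
    · rw [Measure.prod_prod, h, mul_zero]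

/-- The `m`-th power of the Laplace transform is that of the `m`-fold convolution, which lives on
the ball of radius `mR`. Dilates by `m` of finitely many small balls cover it. On each, `e^L` is
about `e^{m L x}` and the mass is at most about `e^{m(c - L x)}`. The number of balls does not
depend on `m`, so it disappears on taking `m`-th roots. -/
theorem laplace_restrict_closedBall_le [IsProbabilityMeasure μ] {L : V →L[ℝ] ℝ} {c : ℝ}
    (h : ∀ p ∈ lowerPairs μ, L p.1 + p.2 ≤ c) (R : ℝ) {ε : ℝ} (hε : 0 < ε) :
    laplace (μ.restrict (Metric.closedBall 0 R)) L ≤ ENNReal.ofReal (Real.exp (c + 2 * ε)) := by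
  set ν := μ.restrict (Metric.closedBall (0 : V) R) with hν
  have hloc : ∀ x : V, ∃ r : ℝ, 0 < r ∧ r * ‖L‖ ≤ ε ∧ ∀ m : ℕ, 0 < m →
      convPow μ m (Metric.ball ((m : ℝ) • x) (m * r)) ≤ expBound m (L x - c - ε) := by
    intro x
    have hx : (x, c - L x + ε) ∉ lowerPairs μ := fun hx => by
      have := h _ hx
      simp only at this
      linarith
    obtain ⟨r, hr, hm⟩ := exists_ball_convPow_le hx
    have h1 : 0 < ε / (‖L‖ + 1) := by positivity
    -- The second term of the minimum makes `L` vary by at most `ε` on the ball.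
    refine ⟨min r (ε / (‖L‖ + 1)), lt_min hr h1, ?_, fun m hm0 => ?_⟩
    · calc min r (ε / (‖L‖ + 1)) * ‖L‖ ≤ ε / (‖L‖ + 1) * (‖L‖ + 1) := by
            gcongr
            · exact min_le_right _ _
            · linarith
        _ = ε := by field_simp
    · refine (measure_mono (Metric.ball_subset_ball ?_)).trans
        ((hm m hm0).trans (expBound_anti (by linarith) m))
      gcongr
      exact min_le_left _ _
  choose r hr hrL hrm using hloc
  obtain ⟨t, -, ht⟩ := (isCompact_closedBall (0 : V) R).elim_nhds_subcover
    (fun x => Metric.ball x (r x)) fun x _ => Metric.ball_mem_nhds x (hr x)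
  have hpow : ∀ m : ℕ, 0 < m → laplace ν L ^ m ≤ t.card * expBound m (-(c + 2 * ε)) := by
    intro m hm
    have hm' : (0 : ℝ) < m := by exact_mod_cast hm
    rw [← laplace_convPow, laplace]
    have hnull : convPow ν m (Metric.closedBall 0 (m * R))ᶜ = 0 := by
      refine convPow_compl_closedBall_eq_zero ?_ m
      rw [hν, Measure.restrict_apply measurableSet_closedBall.compl]
      simp
    calc ∫⁻ s, ENNReal.ofReal (Real.exp (L s)) ∂(convPow ν m)
        ≤ ∫⁻ s, ∑ x ∈ t, (Metric.ball ((m : ℝ) • x) (m * r x)).indicator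
            (fun _ => expBound m (-(L x + ε))) s ∂(convPow ν m) := by
          refine lintegral_mono_ae ?_
          have hae : ∀ᵐ s ∂(convPow ν m), s ∈ Metric.closedBall (0 : V) (m * R) := hnull
          filter_upwards [hae] with s hs
          have hs' : (m : ℝ)⁻¹ • s ∈ Metric.closedBall (0 : V) R := by
            rw [mem_closedBall_zero_iff] at hs ⊢
            rw [norm_smul, norm_inv, Real.norm_natCast]
            rwa [inv_mul_le_iff₀ hm']
          obtain ⟨x, hx, hxs⟩ := Set.mem_iUnion₂.1 (ht hs')
          have hsx : s ∈ Metric.ball ((m : ℝ) • x) (m * r x) := by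
            have e : s = (m : ℝ) • ((m : ℝ)⁻¹ • s) := by rw [smul_inv_smul₀ hm'.ne']
            rw [e, Metric.mem_ball, dist_smul₀, Real.norm_natCast]
            gcongr
            exact hxs
          refine le_trans ?_ (Finset.single_le_sum (fun i _ => zero_le) hx)
          rw [Set.indicator_of_mem hsx, expBound]
          apply ENNReal.ofReal_le_ofReal
          apply Real.exp_le_exp.2
          have h1 : L (s - (m : ℝ) • x) ≤ m * ε := by
            rw [mem_ball_iff_norm] at hsx
            calc L (s - (m : ℝ) • x) ≤ ‖L‖ * ‖s - (m : ℝ) • x‖ :=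
                  (le_abs_self _).trans (L.le_opNorm _)
              _ ≤ ‖L‖ * (m * r x) := by gcongr
              _ = m * (r x * ‖L‖) := by ring
              _ ≤ m * ε := by gcongr; exact hrL x
          rw [map_sub, map_smul, smul_eq_mul] at h1
          linarith
      _ = ∑ x ∈ t, expBound m (-(L x + ε)) *
            convPow ν m (Metric.ball ((m : ℝ) • x) (m * r x)) := by
          rw [lintegral_finsetSum _ fun x _ => measurable_const.indicator measurableSet_ball]
          exact Finset.sum_congr rfl fun x _ => lintegral_indicator_const measurableSet_ball _
      _ ≤ ∑ x ∈ t, expBound m (-(L x + ε)) * expBound m (L x - c - ε) := by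
          gcongr with x hx
          exact (convPow_mono Measure.restrict_le_self m _).trans (hrm x m hm)
      _ = t.card * expBound m (-(c + 2 * ε)) := by
          rw [← nsmul_eq_mul, ← Finset.sum_const]
          refine Finset.sum_congr rfl fun x _ => ?_
          rw [← expBound_add]
          congr 1
          ring
  -- The `m`-th root: a number `q` with `log q > c + 2ε` below the Laplace transform would have
  -- powers outgrowing the bound in `hpow`.
  by_contra! hlt
  obtain ⟨q, hq1, hq2⟩ := ENNReal.lt_iff_exists_nnreal_btwn.1 hlt
  have hq0 : (0 : ℝ) < q := by
    have h1 : (0 : ℝ≥0∞) < q := zero_le.trans_lt hq1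
    exact_mod_cast h1
  have hqs : c + 2 * ε < Real.log q := by
    rw [Real.lt_log_iff_exp_lt hq0, ← ENNReal.ofReal_lt_ofReal_iff hq0, ENNReal.ofReal_coe_nnreal]
    exact hq1
  obtain ⟨s, hs1, hs2⟩ := exists_between hqs
  have hc : (t.card : ℝ≥0∞) ≠ ⊤ := by simp
  obtain ⟨m, hm, hm0⟩ := ((eventually_const_mul_expBound_le hc
    (show -s < -(c + 2 * ε) by linarith)).and (eventually_gt_atTop 0)).exists
  have h1 : expBound m (-Real.log q) ≤ laplace ν L ^ m := by
    refine le_trans (le_of_eq ?_) (pow_le_pow_left' hq2.le m)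
    rw [expBound, ← ENNReal.ofReal_coe_nnreal, ← ENNReal.ofReal_pow hq0.le]
    congr 1
    rw [mul_neg, neg_neg, Real.exp_nat_mul, Real.exp_log hq0]
  have h2 := (h1.trans (hpow m hm0)).trans hm
  exact absurd h2 (not_le.2 (expBound_lt (by linarith) hm0))

/-- The truncated Laplace transforms are the masses of growing balls under the density `e^L`, so
they increase to the full one, finite or not; then `ε → 0`. -/
theorem laplace_le_of_forall_lowerPairs [IsProbabilityMeasure μ] {L : V →L[ℝ] ℝ} {c : ℝ}
    (h : ∀ p ∈ lowerPairs μ, L p.1 + p.2 ≤ c) : laplace μ L ≤ ENNReal.ofReal (Real.exp c) := by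
  have h1 : ∀ ε : ℝ, 0 < ε → laplace μ L ≤ ENNReal.ofReal (Real.exp (c + 2 * ε)) := by
    intro ε hε
    set ρ := μ.withDensity fun x => ENNReal.ofReal (Real.exp (L x))
    have ht : Tendsto (fun N : ℕ => ρ (Metric.closedBall 0 (N : ℝ))) atTop
        (𝓝 (ρ (⋃ N : ℕ, Metric.closedBall 0 (N : ℝ)))) :=
      tendsto_measure_iUnion_atTop fun a b hab =>
        Metric.closedBall_subset_closedBall (by exact_mod_cast hab)
    rw [Metric.iUnion_closedBall_nat, withDensity_apply _ .univ, Measure.restrict_univ] at ht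
    refine le_of_tendsto ht (Eventually.of_forall fun N => ?_)
    rw [withDensity_apply _ measurableSet_closedBall]
    exact laplace_restrict_closedBall_le h N hε
  have ht : Tendsto (fun ε : ℝ => ENNReal.ofReal (Real.exp (c + 2 * ε))) (𝓝[>] 0)
      (𝓝 (ENNReal.ofReal (Real.exp (c + 2 * 0)))) :=
    (Continuous.tendsto (ENNReal.continuous_ofReal.comp (by fun_prop)) 0).mono_left nhdsWithin_le_nhds
  rw [mul_zero, add_zero] at ht
  exact ge_of_tendsto ht (eventually_mem_nhdsWithin.mono fun ε hε => h1 ε hε)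

theorem sub_le_cramerRate [IsProbabilityMeasure μ] {L : V →L[ℝ] ℝ} {c : ℝ}
    (h : ∀ p ∈ lowerPairs μ, L p.1 + p.2 ≤ c) (x : V) :
    ((L x - c : ℝ) : EReal) ≤ cramerRate μ x := by
  refine le_trans ?_ (le_iSup (fun L : V →L[ℝ] ℝ =>
    ((L x : ℝ) : EReal) - ENNReal.log (laplace μ L)) L)
  rw [EReal.coe_sub]
  refine EReal.sub_le_sub le_rfl ?_
  have h1 := ENNReal.log_monotone (laplace_le_of_forall_lowerPairs h)
  rwa [ENNReal.log_ofReal_of_pos (Real.exp_pos _), Real.log_exp] at h1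

/-- If the set were empty, the previous bound would hold vacuously for `L = 0` and `c = -1`,
although the Laplace transform at `0` equals `1`. -/
theorem lowerPairs_nonempty [IsProbabilityMeasure μ] : (lowerPairs μ).Nonempty := by
  by_contra hempty
  rw [Set.not_nonempty_iff_eq_empty] at hempty
  have h := laplace_le_of_forall_lowerPairs (μ := μ) (L := 0) (c := -1) (by simp [hempty])
  have h2 : ENNReal.ofReal (Real.exp (-1)) < 1 := by
    rw [ENNReal.ofReal_lt_one, Real.exp_lt_one_iff]
    norm_num
  have h3 : laplace μ 0 = 1 := by simp [laplace]
  rw [h3] at h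
  exact absurd h (not_le.2 h2)

/-! ### Separation of a point from `lowerPairs` -/

/-- A continuous linear form on `V × ℝ` splits into its two components. -/
theorem exists_eq_add_mul_snd (f : StrongDual ℝ (V × ℝ)) :
    ∃ (L : V →L[ℝ] ℝ) (τ : ℝ), ∀ v a, f (v, a) = L v + τ * a := by
  refine ⟨f.comp (ContinuousLinearMap.inl ℝ V ℝ), f (0, 1), fun v a => ?_⟩
  have : ((v, a) : V × ℝ) = (v, 0) + a • ((0, 1) : V × ℝ) := by simp
  rw [this, map_add, map_smul, smul_eq_mul, mul_comm]
  rfl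

/-- A separating form blind to the exponent can be multiplied by any positive constant. Since
exponents in `lowerPairs` are nonpositive, its multiples stay admissible and make the rate
arbitrarily large. -/
theorem le_cramerRate_of_separated_vertical [IsProbabilityMeasure μ] {x : V} {M u : ℝ}
    {L : V →L[ℝ] ℝ} (h : ∀ p ∈ lowerPairs μ, L p.1 ≤ u) (hx : u < L x) :
    (M : EReal) ≤ cramerRate μ x := by
  have hpos : 0 < L x - u := by linarith
  have ht0 : 0 ≤ |M| / (L x - u) := div_nonneg (abs_nonneg _) hpos.le
  have h1 := sub_le_cramerRate (μ := μ) (L := (|M| / (L x - u)) • L)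
    (c := |M| / (L x - u) * u) (fun p hp => by
      have h4 := mul_le_mul_of_nonneg_left (h p hp) ht0
      have h3 := nonpos_of_mem_lowerPairs hp
      rw [_root_.smul_apply, smul_eq_mul]
      linarith) x
  refine le_trans ?_ h1
  rw [EReal.coe_le_coe_iff, _root_.smul_apply, smul_eq_mul, ← mul_sub,
    div_mul_cancel₀ _ hpos.ne']
  exact le_abs_self M

theorem le_cramerRate_of_separated [IsProbabilityMeasure μ] {x : V} {M u τ : ℝ}
    {L : V →L[ℝ] ℝ} (hτ : 0 < τ) (h : ∀ p ∈ lowerPairs μ, L p.1 + τ * p.2 ≤ u)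
    (hx : u ≤ L x - τ * M) : (M : EReal) ≤ cramerRate μ x := by
  have h1 := sub_le_cramerRate (μ := μ) (L := τ⁻¹ • L) (c := τ⁻¹ * u) (fun p hp => by
      have h4 := mul_le_mul_of_nonneg_left (h p hp) (inv_pos.2 hτ).le
      rw [mul_add, inv_mul_cancel_left₀ hτ.ne'] at h4
      rw [_root_.smul_apply, smul_eq_mul]
      exact h4) x
  refine le_trans ?_ h1
  rw [EReal.coe_le_coe_iff, _root_.smul_apply, smul_eq_mul, ← mul_sub]
  calc M = τ⁻¹ * (τ * M) := by rw [inv_mul_cancel_left₀ hτ.ne']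
    _ ≤ τ⁻¹ * (L x - u) := by gcongr; linarith

/-- The lower bound of Cramér's theorem, without any moment condition. -/
theorem mem_lowerPairs_of_cramerRate_lt [IsProbabilityMeasure μ] {x : V} {M : ℝ}
    (hM : cramerRate μ x < M) : (x, -M) ∈ lowerPairs μ := by
  by_contra hmem
  obtain ⟨f, u, hfu, hux⟩ :=
    geometric_hahn_banach_closed_point (E := V × ℝ) convex_lowerPairs isClosed_lowerPairs hmem
  obtain ⟨L, τ, hf⟩ := exists_eq_add_mul_snd f
  have hfu' : ∀ v a, (v, a) ∈ lowerPairs μ → L v + τ * a < u := fun v a h => by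
    rw [← hf]; exact hfu _ h
  rw [hf] at hux
  -- Exponents in `lowerPairs` can be lowered without limit, so a form bounded above on the set
  -- cannot have a negative exponent coefficient.
  have hτ0 : 0 ≤ τ := by
    by_contra! hneg
    obtain ⟨⟨v, a⟩, hva⟩ := lowerPairs_nonempty (μ := μ)
    have h1 := hfu' _ _ (mem_lowerPairs_of_le hva (min_le_left a ((u - L v) / τ)))
    have h2 : τ * ((u - L v) / τ) ≤ τ * min a ((u - L v) / τ) :=
      mul_le_mul_of_nonpos_left (min_le_right _ _) hneg.le
    rw [mul_div_cancel₀ _ hneg.ne] at h2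
    linarith
  refine absurd hM (not_lt.2 ?_)
  rcases hτ0.eq_or_lt with h0 | hpos
  · subst h0
    exact le_cramerRate_of_separated_vertical (L := L) (u := u)
      (fun p hp => by linarith [hfu' p.1 p.2 hp]) (by linarith)
  · exact le_cramerRate_of_separated (L := L) hpos (fun p hp => (hfu' p.1 p.2 hp).le)
      (by linarith)

theorem cramerRate_nonneg [IsProbabilityMeasure μ] (x : V) : 0 ≤ cramerRate μ x := by
  refine le_trans ?_ (le_iSup (fun L : V →L[ℝ] ℝ =>
    ((L x : ℝ) : EReal) - ENNReal.log (laplace μ L)) 0)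
  simp [laplace]

end Cramer

/-! ### Kernels given by a function of the parameter and of an independent noise -/

/-- The kernel that sends `y` to the law of `F y ξ`, for a noise `ξ` of law `Γ`. -/
def noiseKernel {𝕐 Ξ 𝕏 : Type*} [MeasurableSpace 𝕐] [MeasurableSpace Ξ] [MeasurableSpace 𝕏]
    (Γ : Measure Ξ) (F : 𝕐 → Ξ → 𝕏) : Kernel 𝕐 𝕏 :=
  (Kernel.id ×ₖ Kernel.const 𝕐 Γ).map (Function.uncurry F)

section NoiseKernel

variable {𝕐 Ξ 𝕏 : Type*} [MeasurableSpace 𝕐] [MeasurableSpace Ξ] [MeasurableSpace 𝕏]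
  {Γ : Measure Ξ} {F : 𝕐 → Ξ → 𝕏}

theorem noiseKernel_apply [SFinite Γ] (hF : Measurable (Function.uncurry F)) (y : 𝕐) :
    noiseKernel Γ F y = Γ.map (F y) := by
  rw [noiseKernel, Kernel.map_apply _ hF, Kernel.prod_apply, Kernel.id_apply, Kernel.const_apply,
    Measure.dirac_prod, Measure.map_map hF measurable_prodMk_left]
  rfl

theorem isMarkovKernel_noiseKernel [IsProbabilityMeasure Γ]
    (hF : Measurable (Function.uncurry F)) : IsMarkovKernel (noiseKernel Γ F) := by
  rw [noiseKernel]
  exact Kernel.IsMarkovKernel.map _ hF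

theorem noiseKernel_map [SFinite Γ] {𝕎 : Type*} [MeasurableSpace 𝕎] {f : 𝕏 → 𝕎}
    (hF : Measurable (Function.uncurry F)) (hf : Measurable f) :
    (noiseKernel Γ F).map f = noiseKernel Γ (fun y ξ => f (F y ξ)) := by
  rw [noiseKernel, noiseKernel, ← Kernel.map_comp_right _ hF hf]
  rfl

end NoiseKernel

/-! ### Empirical means -/

section Mean

variable {𝕐 Ξ V : Type*} [NormedAddCommGroup V] [NormedSpace ℝ V] [FiniteDimensional ℝ V]
  [MeasurableSpace V] [BorelSpace V] [MeasurableSpace Ξ]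

/-- The mean of the first `m` terms of a sequence `g y (ξ i)`. -/
def noiseMean (g : 𝕐 → Ξ → V) (m : ℕ) (y : 𝕐) (ξ : ℕ → Ξ) : V :=
  (m : ℝ)⁻¹ • ∑ i ∈ Finset.range m, g y (ξ i)

/-- The law of a sequence of independent variables of law `γ`. -/
abbrev iidLaw (γ : Measure Ξ) [IsProbabilityMeasure γ] : Measure (ℕ → Ξ) :=
  Measure.infinitePi fun _ => γ

variable (γ : Measure Ξ) [IsProbabilityMeasure γ]

theorem map_sum_iidLaw {f : Ξ → V} (hf : Measurable f) (m : ℕ) :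
    (iidLaw γ).map (fun ξ => ∑ i ∈ Finset.range m, f (ξ i)) = convPow (γ.map f) m := by
  refine map_sum_range_eq_convPow (X := fun i (ξ : ℕ → Ξ) => f (ξ i)) m
    (fun i _ => hf.comp (measurable_pi_apply i)) (fun i _ => ?_) ?_
  · have h := congrArg (Measure.map f) (Measure.infinitePi_map_eval (fun _ : ℕ => γ) i)
    rw [Measure.map_map hf (measurable_pi_apply i)] at h
    exact h
  · exact (iIndepFun_infinitePi (P := fun _ : ℕ => γ) (X := fun _ => f)
      fun _ => hf).precomp Fin.val_injective

theorem iidLaw_setOf_sum_mem {f : Ξ → V} (hf : Measurable f) (m : ℕ) {S : Set V}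
    (hS : MeasurableSet S) :
    iidLaw γ {ξ | ∑ i ∈ Finset.range m, f (ξ i) ∈ S} = convPow (γ.map f) m S := by
  rw [← map_sum_iidLaw γ hf, Measure.map_apply (by fun_prop) hS]
  rfl

/-- Chernoff's bound with `t` fixed: one finite exponential moment gives every rate `B`, at the
price of a level with `t A ≥ B + b`, where `e^b` bounds that moment. -/
theorem exists_iidLaw_sum_ge_le {w : Ξ → ℝ} (hw : Measurable w) {t : ℝ} (ht : 0 < t)
    (hexp : ∫⁻ ξ, ENNReal.ofReal (Real.exp (t * w ξ)) ∂γ ≠ ⊤) (B : ℝ) :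
    ∃ A : ℝ, 0 < A ∧ ∀ m : ℕ,
      iidLaw γ {ξ | m * A ≤ ∑ i ∈ Finset.range m, w (ξ i)} ≤ expBound m B := by
  have hlap : laplace (γ.map w) (t • ContinuousLinearMap.id ℝ ℝ) =
      ∫⁻ ξ, ENNReal.ofReal (Real.exp (t * w ξ)) ∂γ := by
    rw [laplace, lintegral_map (by fun_prop) hw]
    rfl
  obtain ⟨b, hb⟩ : ∃ b : ℝ, laplace (γ.map w) (t • ContinuousLinearMap.id ℝ ℝ) ≤
      ENNReal.ofReal (Real.exp b) := by
    obtain ⟨b, hb⟩ := (Real.tendsto_exp_atTop.eventually_ge_atTop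
      (laplace (γ.map w) (t • ContinuousLinearMap.id ℝ ℝ)).toReal).exists
    exact ⟨b, ENNReal.le_ofReal_iff_toReal_le (hlap ▸ hexp) (Real.exp_pos _).le |>.2 hb⟩
  refine ⟨max 1 ((B + b) / t), lt_max_of_lt_left one_pos, fun m => ?_⟩
  have h1 : B + b ≤ t * max 1 ((B + b) / t) := by
    rw [← div_le_iff₀' ht]; exact le_max_right _ _
  have h2 := iidLaw_setOf_sum_mem γ hw m
    (S := {s | (m : ℝ) * max 1 ((B + b) / t) ≤ s}) (measurableSet_le measurable_const measurable_id)
  simp only [Set.mem_ofPred_eq] at h2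
  have := Measure.isProbabilityMeasure_map (μ := γ) hw.aemeasurable
  rw [h2]
  calc convPow (γ.map w) m {s | (m : ℝ) * max 1 ((B + b) / t) ≤ s}
      ≤ convPow (γ.map w) m
          {s | m * (t * max 1 ((B + b) / t)) ≤ (t • ContinuousLinearMap.id ℝ ℝ) s} := by
        refine measure_mono fun s hs => ?_
        change m * (t * max 1 ((B + b) / t)) ≤ t * s
        have h3 := mul_le_mul_of_nonneg_left (show (m : ℝ) * max 1 ((B + b) / t) ≤ s from hs) ht.le
        linarith
    _ ≤ ENNReal.ofReal (Real.exp (-(m * (t * max 1 ((B + b) / t))))) *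
          ENNReal.ofReal (Real.exp b) ^ m := by
        refine (convPow_le_chernoff _ _ _ _).trans ?_
        gcongr
    _ ≤ expBound m B := by
        rw [← ENNReal.ofReal_pow (Real.exp_pos _).le, ← Real.exp_nat_mul,
          ← ENNReal.ofReal_mul (Real.exp_pos _).le, ← Real.exp_add, expBound]
        apply ENNReal.ofReal_le_ofReal
        apply Real.exp_le_exp.2
        have := mul_le_mul_of_nonneg_left h1 (Nat.cast_nonneg (α := ℝ) m)
        linarith

end Mean

/-! ### Change of speed -/

section Speed

variable {m : ℕ → ℕ} {α : ℝ}

theorem eventually_expBound_speed_le (hm : Tendsto (fun n : ℕ => (m n : ℝ) / n) atTop (𝓝 α))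
    {M M' : ℝ} (h : M < α * M') : ∀ᶠ n in atTop, expBound (m n) M' ≤ expBound n M := by
  filter_upwards [(hm.mul_const M').eventually_const_le h, eventually_gt_atTop 0] with n hn hn0
  apply ENNReal.ofReal_le_ofReal
  apply Real.exp_le_exp.2
  have hn1 : (0 : ℝ) < n := by exact_mod_cast hn0
  rw [div_mul_eq_mul_div, le_div_iff₀ hn1] at hn
  linarith

theorem eventually_expBound_le_speed (hm : Tendsto (fun n : ℕ => (m n : ℝ) / n) atTop (𝓝 α))
    {M M' : ℝ} (h : α * M' < M) : ∀ᶠ n in atTop, expBound n M ≤ expBound (m n) M' := by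
  filter_upwards [(hm.mul_const M').eventually_le_const h, eventually_gt_atTop 0] with n hn hn0
  apply ENNReal.ofReal_le_ofReal
  apply Real.exp_le_exp.2
  have hn1 : (0 : ℝ) < n := by exact_mod_cast hn0
  rw [div_mul_eq_mul_div, div_le_iff₀ hn1] at hn
  linarith

theorem tendsto_atTop_of_speed (hα : 0 < α)
    (hm : Tendsto (fun n : ℕ => (m n : ℝ) / n) atTop (𝓝 α)) : Tendsto m atTop atTop := by
  rw [← tendsto_natCast_atTop_iff (R := ℝ)]
  refine (hm.pos_mul_atTop hα tendsto_natCast_atTop_atTop).congr' ?_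
  filter_upwards [eventually_gt_atTop 0] with n hn
  have hn1 : (n : ℝ) ≠ 0 := by positivity
  field_simp

end Speed

/-! ### Large deviations of empirical means, locally uniformly in a parameter -/

/-- The variables `g y ξ` depend continuously on `y`, up to an error controlled by a weight `w ξ`
that has an exponential moment. -/
structure NoiseControl {𝕐 Ξ V : Type*} [TopologicalSpace 𝕐] [MeasurableSpace 𝕐]
    [MeasurableSpace Ξ] [NormedAddCommGroup V] [MeasurableSpace V]
    (γ : Measure Ξ) (w : Ξ → ℝ) (g : 𝕐 → Ξ → V) : Prop where
  measurable_w : Measurable w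
  exp_moment : ∃ t : ℝ, 0 < t ∧ ∫⁻ ξ, ENNReal.ofReal (Real.exp (t * w ξ)) ∂γ ≠ ⊤
  measurable_g : Measurable (Function.uncurry g)
  close : ∀ y, ∀ ε : ℝ, 0 < ε → ∃ U, IsOpen U ∧ y ∈ U ∧
    ∀ y' ∈ U, ∀ ξ, ‖g y' ξ - g y ξ‖ ≤ ε * w ξ
  bound : ∀ y, ∃ C : ℝ, 0 ≤ C ∧ ∀ ξ, ‖g y ξ‖ ≤ C * w ξ

section MeanLDP

variable {𝕐 Ξ V : Type*} [TopologicalSpace 𝕐] [MeasurableSpace 𝕐] [NormedAddCommGroup V]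
  [NormedSpace ℝ V] [FiniteDimensional ℝ V] [MeasurableSpace V] [BorelSpace V] [MeasurableSpace Ξ]
  {γ : Measure Ξ} [IsProbabilityMeasure γ] {w : Ξ → ℝ} {g : 𝕐 → Ξ → V} {m : ℕ → ℕ} {α : ℝ}

theorem norm_noiseMean_le {f : Ξ → V} {C : ℝ} (h : ∀ ξ, ‖f ξ‖ ≤ C * w ξ)
    {k : ℕ} {δ A : ℝ} (hδ : C * A ≤ δ) (hC : 0 < C) (hk : 0 < k) {ξ : ℕ → Ξ}
    (hle : δ ≤ ‖(k : ℝ)⁻¹ • ∑ i ∈ Finset.range k, f (ξ i)‖) :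
    k * A ≤ ∑ i ∈ Finset.range k, w (ξ i) := by
  have hk' : (0 : ℝ) < k := by exact_mod_cast hk
  rw [norm_smul, norm_inv, Real.norm_natCast, inv_mul_eq_div, le_div_iff₀ hk'] at hle
  have h1 : ‖∑ i ∈ Finset.range k, f (ξ i)‖ ≤ C * ∑ i ∈ Finset.range k, w (ξ i) := by
    rw [Finset.mul_sum]
    exact (norm_sum_le _ _).trans (Finset.sum_le_sum fun i _ => h _)
  have h2 : C * (k * A) ≤ C * ∑ i ∈ Finset.range k, w (ξ i) := by
    have := mul_le_mul_of_nonneg_right hδ hk'.le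
    linarith
  exact le_of_mul_le_mul_left h2 hC

theorem NoiseControl.exists_tail (h : NoiseControl γ w g) (hα : 0 < α)
    (hm : Tendsto (fun n : ℕ => (m n : ℝ) / n) atTop (𝓝 α)) (M : ℝ) :
    ∃ A : ℝ, 0 < A ∧ ∀ᶠ n in atTop,
      iidLaw γ {ξ | m n * A ≤ ∑ i ∈ Finset.range (m n), w (ξ i)} ≤ expBound n M := by
  obtain ⟨t, ht, hexp⟩ := h.exp_moment
  obtain ⟨A, hA, hAB⟩ := exists_iidLaw_sum_ge_le γ h.measurable_w ht hexp ((M + 1) / α)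
  refine ⟨A, hA, (eventually_expBound_speed_le hm (M := M) (M' := (M + 1) / α) ?_).mono
    fun n hn => (hAB _).trans hn⟩
  rw [mul_div_cancel₀ _ hα.ne']
  linarith

/-- Both means use the same noise. The level `A` is chosen first, from `M`, and then the
neighbourhood, with constant `δ / A`; a deviation `δ` therefore forces the mean of the weights to
reach `A`. -/
theorem NoiseControl.exists_close_mean (h : NoiseControl γ w g) (hα : 0 < α)
    (hm : Tendsto (fun n : ℕ => (m n : ℝ) / n) atTop (𝓝 α)) (y : 𝕐) {δ : ℝ} (hδ : 0 < δ) (M : ℝ) :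
    ∃ U, IsOpen U ∧ y ∈ U ∧ ∀ᶠ n in atTop, ∀ y' ∈ U,
      iidLaw γ {ξ | δ ≤ ‖noiseMean g (m n) y' ξ - noiseMean g (m n) y ξ‖} ≤ expBound n M := by
  obtain ⟨A, hA, hAB⟩ := h.exists_tail hα hm M
  obtain ⟨U, hU, hyU, hclose⟩ := h.close y (δ / A) (by positivity)
  refine ⟨U, hU, hyU, ?_⟩
  filter_upwards [hAB, (tendsto_atTop_of_speed hα hm).eventually_gt_atTop 0] with n hn hn0 y' hy'
  refine (measure_mono fun ξ hξ => ?_).trans hn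
  rw [Set.mem_ofPred_eq, noiseMean, noiseMean, ← smul_sub, ← Finset.sum_sub_distrib] at hξ
  exact norm_noiseMean_le (f := fun ξ => g y' ξ - g y ξ) (hclose y' hy')
    (div_mul_cancel₀ _ hA.ne').le (by positivity) hn0 hξ

theorem measurable_noiseMean (hg : Measurable (Function.uncurry g)) (k : ℕ) :
    Measurable (Function.uncurry (noiseMean g k)) := by
  have : ∀ i, Measurable fun p : 𝕐 × (ℕ → Ξ) => g p.1 (p.2 i) := fun i =>
    hg.comp (measurable_fst.prodMk ((measurable_pi_apply i).comp measurable_snd))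
  change Measurable fun p : 𝕐 × (ℕ → Ξ) => (k : ℝ)⁻¹ • ∑ i ∈ Finset.range k, g p.1 (p.2 i)
  fun_prop

theorem noiseKernel_noiseMean_apply (hg : Measurable (Function.uncurry g)) (k : ℕ) (y : 𝕐)
    {S : Set V} (hS : MeasurableSet S) :
    noiseKernel (iidLaw γ) (noiseMean g k) y S = iidLaw γ {ξ | noiseMean g k y ξ ∈ S} := by
  have h := measurable_noiseMean hg k
  have hy : Measurable (noiseMean g k y) := h.comp measurable_prodMk_left
  rw [noiseKernel_apply h, Measure.map_apply hy hS]
  rfl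

theorem NoiseControl.lower_aux (h : NoiseControl γ w g) (hα : 0 < α)
    (hm : Tendsto (fun n : ℕ => (m n : ℝ) / n) atTop (𝓝 α)) {y : 𝕐} {x : V} {M : ℝ}
    (hM : (α : EReal) * cramerRate (γ.map (g y)) x < M) {ρ : ℝ} (hρ : 0 < ρ) :
    ∀ᶠ n in atTop, expBound n M ≤
      iidLaw γ {ξ | noiseMean g (m n) y ξ ∈ Metric.ball x ρ} := by
  have hgy : Measurable (g y) := h.measurable_g.comp measurable_prodMk_left
  have := Measure.isProbabilityMeasure_map (μ := γ) hgy.aemeasurable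
  have hnn := cramerRate_nonneg (μ := γ.map (g y)) x
  obtain ⟨M', hM', hM''⟩ : ∃ M' : ℝ, cramerRate (γ.map (g y)) x < M' ∧ α * M' < M := by
    generalize cramerRate (γ.map (g y)) x = a at *
    induction a with
    | bot => simp at hnn
    | top => rw [EReal.coe_mul_top_of_pos hα] at hM; simp at hM
    | coe a =>
      have h1 : α * a < M := by exact_mod_cast hM
      rw [← lt_div_iff₀' hα] at h1
      obtain ⟨b, hb1, hb2⟩ := exists_between h1
      refine ⟨b, by exact_mod_cast hb1, ?_⟩
      rwa [← lt_div_iff₀' hα]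
  obtain ⟨M₂, h₂, h₂'⟩ := exists_between ((lt_div_iff₀' hα).2 hM'')
  rw [lt_div_iff₀' hα] at h₂'
  -- In `lowerPairs` the radius of the ball is also the loss in the exponent, hence the cap `M₂ -
  -- M'`. The gap between `α M₂` and `M` is left for the change of speed.
  have hev := (tendsto_atTop_of_speed hα hm).eventually
    (mem_lowerPairs_of_cramerRate_lt hM' (min ρ (M₂ - M')) (lt_min hρ (by linarith)))
  filter_upwards [hev, eventually_expBound_le_speed hm h₂',
    (tendsto_atTop_of_speed hα hm).eventually_gt_atTop 0] with n hn hn2 hn0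
  have hn0' : (0 : ℝ) < m n := by exact_mod_cast hn0
  refine (hn2.trans ((expBound_anti ?_ _).trans hn)).trans ?_
  · linarith [min_le_right ρ (M₂ - M')]
  · rw [← iidLaw_setOf_sum_mem γ hgy (m n) measurableSet_ball]
    refine measure_mono fun ξ hξ => ?_
    rw [Set.mem_ofPred_eq, Metric.mem_ball] at hξ ⊢
    have e : x = (m n : ℝ)⁻¹ • ((m n : ℝ) • x) := by rw [inv_smul_smul₀ hn0'.ne']
    rw [noiseMean, e, dist_smul₀, norm_inv, Real.norm_natCast, inv_mul_lt_iff₀ hn0']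
    exact hξ.trans_le (by gcongr; exact min_le_left _ _)

/-- A nearly optimal `L` in the Legendre supremum gives a half-space to which Chernoff's bound
applies. Its boundary is lowered by `2η` rather than `η`, leaving a margin `η` for moving the
parameter. -/
theorem NoiseControl.upper_aux (h : NoiseControl γ w g) (hα : 0 < α)
    (hm : Tendsto (fun n : ℕ => (m n : ℝ) / n) atTop (𝓝 α)) {y : 𝕐} {x : V} {M : ℝ}
    (hM : (M : EReal) < α * cramerRate (γ.map (g y)) x) :
    ∃ (L : V →L[ℝ] ℝ) (η : ℝ), 0 < η ∧ ∀ᶠ n in atTop,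
      iidLaw γ {ξ | L x - 2 * η ≤ L (noiseMean g (m n) y ξ)} ≤ expBound n M := by
  have hgy : Measurable (g y) := h.measurable_g.comp measurable_prodMk_left
  have := Measure.isProbabilityMeasure_map (μ := γ) hgy.aemeasurable
  have hM' : ((M / α : ℝ) : EReal) < cramerRate (γ.map (g y)) x := by
    generalize cramerRate (γ.map (g y)) x = a at *
    induction a with
    | bot => rw [EReal.coe_mul_bot_of_pos hα] at hM; simp at hM
    | top => exact EReal.coe_lt_top _
    | coe a =>
      have h1 : M < α * a := by exact_mod_cast hM
      rw [← div_lt_iff₀' hα] at h1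
      exact_mod_cast h1
  rw [cramerRate, lt_iSup_iff] at hM'
  obtain ⟨L, hL⟩ := hM'
  obtain ⟨b, hb, hb'⟩ : ∃ b : ℝ, laplace (γ.map (g y)) L ≤ ENNReal.ofReal (Real.exp b) ∧
      M / α < L x - b := by
    have hlog : ∀ b : ℝ, ENNReal.log (laplace (γ.map (g y)) L) ≤ b →
        laplace (γ.map (g y)) L ≤ ENNReal.ofReal (Real.exp b) := fun b hb => by
      rw [← ENNReal.log_le_log_iff, ENNReal.log_ofReal_of_pos (Real.exp_pos _), Real.log_exp]
      exact hb
    generalize ENNReal.log (laplace (γ.map (g y)) L) = a at *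
    induction a with
    | bot => exact ⟨L x - M / α - 1, hlog _ bot_le, by linarith⟩
    | top => simp at hL
    | coe a => exact ⟨a, hlog _ le_rfl, by exact_mod_cast hL⟩
  -- With `η` a quarter of the gap, lowering the half-space by `2η` spends only half of it.
  refine ⟨L, (L x - b - M / α) / 4, by linarith, ?_⟩
  set η := (L x - b - M / α) / 4 with hη
  have hspeed : M < α * (L x - 2 * η - b) := by
    rw [← div_lt_iff₀' hα]; linarith
  filter_upwards [eventually_expBound_speed_le hm hspeed,
    (tendsto_atTop_of_speed hα hm).eventually_gt_atTop 0] with n hn hn0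
  have hn0' : (0 : ℝ) < m n := by exact_mod_cast hn0
  have hms : MeasurableSet {s : V | m n * (L x - 2 * η) ≤ L s} :=
    measurableSet_le measurable_const L.continuous.measurable
  calc iidLaw γ {ξ | L x - 2 * η ≤ L (noiseMean g (m n) y ξ)}
      ≤ iidLaw γ {ξ | ∑ i ∈ Finset.range (m n), g y (ξ i) ∈
          {s : V | m n * (L x - 2 * η) ≤ L s}} := by
        refine measure_mono fun ξ hξ => ?_
        rw [Set.mem_ofPred_eq, noiseMean, map_smul, smul_eq_mul, le_inv_mul_iff₀ hn0'] at hξ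
        exact hξ
    _ = convPow (γ.map (g y)) (m n) {s : V | m n * (L x - 2 * η) ≤ L s} :=
        iidLaw_setOf_sum_mem γ hgy (m n) hms
    _ ≤ ENNReal.ofReal (Real.exp (-(m n * (L x - 2 * η)))) *
          ENNReal.ofReal (Real.exp b) ^ (m n) := by
        refine (convPow_le_chernoff _ _ _ _).trans ?_
        gcongr
    _ = expBound (m n) (L x - 2 * η - b) := by
        rw [← ENNReal.ofReal_pow (Real.exp_pos _).le, ← Real.exp_nat_mul,
          ← ENNReal.ofReal_mul (Real.exp_pos _).le, ← Real.exp_add, expBound]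
        congr 2
        ring
    _ ≤ expBound n M := hn

/-- Cramér's theorem at the fixed parameter `y` is carried to all nearby `y'` by the coupling. The
coupling fails with probability below the required exponential scale, uniformly in `y'`. -/
theorem NoiseControl.kernelLDP (h : NoiseControl γ w g) (hα : 0 < α)
    (hm : Tendsto (fun n : ℕ => (m n : ℝ) / n) atTop (𝓝 α)) :
    KernelLDP (fun n => noiseKernel (iidLaw γ) (noiseMean g (m n)))
      (fun y x => (α : EReal) * cramerRate (γ.map (g y)) x) where
  lower y x V hV hxV M hM := by
    obtain ⟨M₁, hM₁, hM₁M⟩ := EReal.lt_iff_exists_real_btwn.1 hM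
    have hM₁M' : M₁ < M := by exact_mod_cast hM₁M
    obtain ⟨ρ, hρ, hball⟩ := Metric.isOpen_iff.1 hV x hxV
    obtain ⟨U, hU, hyU, hclose⟩ := h.exists_close_mean hα hm y (half_pos hρ) M
    refine ⟨U, hU, hyU, ?_⟩
    have hc : (2 : ℝ≥0∞) ≠ ⊤ := by simp
    filter_upwards [hclose, h.lower_aux hα hm hM₁ (half_pos hρ),
      eventually_const_mul_expBound_le hc hM₁M'] with n h1 h2 h3 y' hy'
    rw [noiseKernel_noiseMean_apply h.measurable_g _ _ hV.measurableSet]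
    -- The estimate at `y` is used with the better exponent `M₁`, which yields two units of
    -- `e^{-nM}`; the failure of the coupling consumes one.
    have h4 : 2 * expBound n M ≤ iidLaw γ {ξ | noiseMean g (m n) y' ξ ∈ V} + expBound n M :=
      calc 2 * expBound n M ≤ expBound n M₁ := h3
        _ ≤ iidLaw γ {ξ | noiseMean g (m n) y ξ ∈ Metric.ball x (ρ / 2)} := h2
        _ ≤ iidLaw γ ({ξ | noiseMean g (m n) y' ξ ∈ V} ∪
              {ξ | ρ / 2 ≤ ‖noiseMean g (m n) y' ξ - noiseMean g (m n) y ξ‖}) := by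
            refine measure_mono fun ξ hξ => ?_
            by_cases hd : ρ / 2 ≤ ‖noiseMean g (m n) y' ξ - noiseMean g (m n) y ξ‖
            · exact Or.inr hd
            · refine Or.inl (hball ?_)
              rw [← dist_eq_norm, not_le] at hd
              rw [Set.mem_ofPred_eq, Metric.mem_ball] at hξ
              rw [Metric.mem_ball]
              linarith [dist_triangle (noiseMean g (m n) y' ξ) (noiseMean g (m n) y ξ) x]
        _ ≤ _ := (measure_union_le _ _).trans (by gcongr; exact h1 y' hy')
    rw [two_mul] at h4
    exact (ENNReal.add_le_add_iff_right (expBound_ne_top n M)).1 h4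
  upper y x M hM := by
    obtain ⟨M₁, hM₁, hM₁M⟩ := EReal.lt_iff_exists_real_btwn.1 hM
    obtain ⟨L, η, hη, hup⟩ := h.upper_aux hα hm hM₁M
    obtain ⟨U, hU, hyU, hclose⟩ := h.exists_close_mean hα hm y
      (show 0 < η / (‖L‖ + 1) by positivity) M₁
    have hVo : IsOpen {z : V | L x - η < L z} := isOpen_lt continuous_const L.continuous
    refine ⟨{z | L x - η < L z}, hVo, by simp [hη], U, hU, hyU, ?_⟩
    have hc : (2 : ℝ≥0∞) ≠ ⊤ := by simp
    filter_upwards [hclose, hup, eventually_const_mul_expBound_le hc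
      (show M < M₁ by exact_mod_cast hM₁)] with n h1 h2 h3 y' hy'
    rw [noiseKernel_noiseMean_apply h.measurable_g _ _ hVo.measurableSet]
    calc iidLaw γ {ξ | noiseMean g (m n) y' ξ ∈ {z | L x - η < L z}}
        ≤ iidLaw γ ({ξ | L x - 2 * η ≤ L (noiseMean g (m n) y ξ)} ∪
            {ξ | η / (‖L‖ + 1) ≤ ‖noiseMean g (m n) y' ξ - noiseMean g (m n) y ξ‖}) := by
          refine measure_mono fun ξ hξ => ?_
          by_cases hd : η / (‖L‖ + 1) ≤ ‖noiseMean g (m n) y' ξ - noiseMean g (m n) y ξ‖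
          · exact Or.inr hd
          · left
            rw [not_le, lt_div_iff₀ (by positivity)] at hd
            have h5 : L (noiseMean g (m n) y' ξ - noiseMean g (m n) y ξ) ≤ η := by
              refine ((le_abs_self _).trans (L.le_opNorm _)).trans ?_
              have := norm_nonneg (noiseMean g (m n) y' ξ - noiseMean g (m n) y ξ)
              linarith
            rw [map_sub] at h5
            have h6 : L x - η < L (noiseMean g (m n) y' ξ) := hξ
            change L x - 2 * η ≤ L (noiseMean g (m n) y ξ)
            linarith
      _ ≤ expBound n M₁ + expBound n M₁ :=
          (measure_union_le _ _).trans (add_le_add h2 (h1 y' hy'))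
      _ = 2 * expBound n M₁ := (two_mul _).symm
      _ ≤ expBound n M := h3
  tight y M := by
    obtain ⟨C, hC, hbound⟩ := h.bound y
    obtain ⟨U, hU, hyU, hclose⟩ := h.close y 1 one_pos
    obtain ⟨A, hA, hAB⟩ := h.exists_tail hα hm M
    refine ⟨Metric.closedBall 0 ((C + 1) * A), isCompact_closedBall _ _, U, hU, hyU, ?_⟩
    filter_upwards [hAB, (tendsto_atTop_of_speed hα hm).eventually_gt_atTop 0] with n hn hn0 y' hy'
    rw [noiseKernel_noiseMean_apply h.measurable_g _ _ measurableSet_closedBall.compl]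
    refine (measure_mono fun ξ hξ => ?_).trans hn
    rw [Set.mem_ofPred_eq, Set.mem_compl_iff, mem_closedBall_zero_iff, not_le] at hξ
    refine norm_noiseMean_le (f := g y') (C := C + 1) (fun ξ => ?_) le_rfl (by positivity)
      hn0 hξ.le
    have h1 := norm_sub_norm_le (g y' ξ) (g y ξ)
    linarith [hbound ξ, hclose y' hy' ξ]

end MeanLDP

/-! ### The space of positive semidefinite matrices -/

section Matrix

variable {ι : Type*} [Fintype ι]

instance instMeasurableSpaceMatrixReal : MeasurableSpace (Matrix ι ι ℝ) :=
  inferInstanceAs (MeasurableSpace (ι → ι → ℝ))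

instance instBorelSpaceMatrixReal : BorelSpace (Matrix ι ι ℝ) :=
  inferInstanceAs (BorelSpace (ι → ι → ℝ))

instance instSecondCountableTopologyMatrixReal : SecondCountableTopology (Matrix ι ι ℝ) :=
  inferInstanceAs (SecondCountableTopology (ι → ι → ℝ))

theorem isClosed_setOf_posSemidef : IsClosed {Q : Matrix ι ι ℝ | Q.PosSemidef} := by
  have h : {Q : Matrix ι ι ℝ | Q.PosSemidef} =
      {Q | Qᴴ = Q} ∩ ⋂ x : ι → ℝ, {Q | 0 ≤ star x ⬝ᵥ (Q *ᵥ x)} := by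
    ext Q
    simp [Matrix.posSemidef_iff_dotProduct_mulVec, Matrix.IsHermitian]
  rw [h]
  refine (isClosed_eq (by fun_prop) continuous_id).inter (isClosed_iInter fun x => ?_)
  exact isClosed_le continuous_const (by fun_prop)

/-- The inclusion of positive semidefinite matrices into arrays. -/
def covToFun (Q : {Q : Matrix ι ι ℝ // Q.PosSemidef}) : ι → ι → ℝ := Q.1

/-- Cramér's theorem is proved in a normed space. The cone is closed in it, so the resulting bounds,
exponential tightness included, pull back to the cone. -/
theorem isClosedEmbedding_covToFun : IsClosedEmbedding (covToFun (ι := ι)) :=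
  isClosed_setOf_posSemidef.isClosedEmbedding_subtypeVal

variable [DecidableEq ι]

open scoped MatrixOrder in
/-- The square root of a positive semidefinite matrix, as an operator. -/
def sqrtCLM (Q : {Q : Matrix ι ι ℝ // Q.PosSemidef}) :
    EuclideanSpace ℝ ι →L[ℝ] EuclideanSpace ℝ ι :=
  Matrix.toEuclideanCLM (𝕜 := ℝ) (CFC.sqrt Q.1)

-- Continuity holds up to singular matrices, so the coupling `√Q ξ` of the Gaussian measures is
-- continuous in `Q` on the whole cone.
open scoped Matrix.Norms.L2Operator MatrixOrder in
theorem continuous_sqrtCLM : Continuous (sqrtCLM (ι := ι)) := by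
  have h1 : ContinuousOn (CFC.sqrt : Matrix ι ι ℝ → Matrix ι ι ℝ) {a | 0 ≤ a} :=
    CFC.continuousOn_sqrt
  have h2 : Continuous fun Q : {Q : Matrix ι ι ℝ // Q.PosSemidef} => CFC.sqrt Q.1 :=
    h1.comp_continuous continuous_subtype_val fun Q => Q.2.nonneg
  have h3 : Continuous (Matrix.toEuclideanCLM (n := ι) (𝕜 := ℝ)) :=
    LinearMap.continuous_of_finiteDimensional
      { toFun := Matrix.toEuclideanCLM (n := ι) (𝕜 := ℝ)
        map_add' := map_add _
        map_smul' := map_smul _ }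
  exact h3.comp h2

theorem multivariateGaussian_eq_map_sqrtCLM (Q : {Q : Matrix ι ι ℝ // Q.PosSemidef}) :
    multivariateGaussian 0 Q.1 = (stdGaussian (EuclideanSpace ℝ ι)).map (sqrtCLM Q) := by
  simp only [multivariateGaussian, zero_add]
  rfl

end Matrix

/-! ### Functions of a parameter and a noise controlled by a weight -/

/-- `h y ξ` depends continuously on `y`, up to an error controlled by the weight `w ξ`. -/
structure WeightControlled {𝕐 Ξ V : Type*} [TopologicalSpace 𝕐] [SeminormedAddCommGroup V]
    (w : Ξ → ℝ) (h : 𝕐 → Ξ → V) : Prop where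
  close : ∀ y, ∀ ε : ℝ, 0 < ε → ∀ᶠ y' in 𝓝 y, ∀ ξ, ‖h y' ξ - h y ξ‖ ≤ ε * w ξ
  bound : ∀ y, ∃ C : ℝ, 0 ≤ C ∧ ∀ ξ, ‖h y ξ‖ ≤ C * w ξ

namespace WeightControlled

variable {𝕐 Ξ V : Type*} [TopologicalSpace 𝕐] [SeminormedAddCommGroup V] {w : Ξ → ℝ}

/-- Each factor is controlled by `w`, so the product is controlled by `w ^ 2`: with `w` affine in
the norm, this is the scale on which a Gaussian still has an exponential moment. -/
theorem mul (hw : ∀ ξ, 0 ≤ w ξ) {f g : 𝕐 → Ξ → ℝ} (hf : WeightControlled w f)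
    (hg : WeightControlled w g) :
    WeightControlled (fun ξ => w ξ ^ 2) (fun y ξ => f y ξ * g y ξ) where
  close y ε hε := by
    obtain ⟨C, hC, hfC⟩ := hf.bound y
    obtain ⟨D, hD, hgD⟩ := hg.bound y
    have hδ : 0 < min 1 (ε / (C + D + 1)) := lt_min one_pos (by positivity)
    filter_upwards [hf.close y _ hδ, hg.close y _ hδ] with y' h1 h2 ξ
    set δ := min 1 (ε / (C + D + 1))
    have hδ1 : δ ≤ 1 := min_le_left _ _
    have hδε : δ * (C + D + 1) ≤ ε := by
      rw [← le_div_iff₀ (by positivity)]; exact min_le_right _ _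
    have e : f y' ξ * g y' ξ - f y ξ * g y ξ =
        (f y' ξ - f y ξ) * (g y' ξ - g y ξ) + (f y' ξ - f y ξ) * g y ξ +
          f y ξ * (g y' ξ - g y ξ) := by ring
    have hw0 := hw ξ
    rw [e]
    calc _ ≤ ‖f y' ξ - f y ξ‖ * ‖g y' ξ - g y ξ‖ + ‖f y' ξ - f y ξ‖ * ‖g y ξ‖ +
            ‖f y ξ‖ * ‖g y' ξ - g y ξ‖ := by
          rw [← norm_mul, ← norm_mul, ← norm_mul]
          exact norm_add₃_le
      _ ≤ (δ * w ξ) * (1 * w ξ) + (δ * w ξ) * (D * w ξ) + (C * w ξ) * (δ * w ξ) := by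
          have h3 : ‖g y' ξ - g y ξ‖ ≤ 1 * w ξ := (h2 ξ).trans (by gcongr)
          gcongr
          · exact h1 ξ
          · exact h1 ξ
          · exact hgD ξ
          · exact hfC ξ
          · exact h2 ξ
      _ = (δ * (C + D + 1)) * w ξ ^ 2 := by ring
      _ ≤ ε * w ξ ^ 2 := by gcongr
  bound y := by
    obtain ⟨C, hC, hfC⟩ := hf.bound y
    obtain ⟨D, hD, hgD⟩ := hg.bound y
    refine ⟨C * D, by positivity, fun ξ => ?_⟩
    have hw0 := hw ξ
    calc ‖f y ξ * g y ξ‖ = ‖f y ξ‖ * ‖g y ξ‖ := norm_mul _ _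
      _ ≤ (C * w ξ) * (D * w ξ) := by
          gcongr
          · exact hfC ξ
          · exact hgD ξ
      _ = C * D * w ξ ^ 2 := by ring

theorem sum {κ : Type*} [Fintype κ] {f : κ → 𝕐 → Ξ → V}
    (hw : ∀ ξ, 0 ≤ w ξ) (hf : ∀ k, WeightControlled w (f k)) :
    WeightControlled w (fun y ξ => ∑ k, f k y ξ) where
  close y ε hε := by
    have h : ∀ k, ∀ᶠ y' in 𝓝 y, ∀ ξ, ‖f k y' ξ - f k y ξ‖ ≤ ε / (Fintype.card κ + 1) * w ξ :=
      fun k => (hf k).close y _ (by positivity)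
    filter_upwards [eventually_all.2 h] with y' hy' ξ
    rw [← Finset.sum_sub_distrib]
    have hw0 := hw ξ
    calc ‖∑ k, (f k y' ξ - f k y ξ)‖ ≤ ∑ k, ‖f k y' ξ - f k y ξ‖ := norm_sum_le _ _
      _ ≤ ∑ _k : κ, ε / (Fintype.card κ + 1) * w ξ := Finset.sum_le_sum fun k _ => hy' k ξ
      _ = (Fintype.card κ) / (Fintype.card κ + 1) * (ε * w ξ) := by
          rw [Finset.sum_const, nsmul_eq_mul, Finset.card_univ]; ring
      _ ≤ 1 * (ε * w ξ) := by
          gcongr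
          rw [div_le_one (by positivity)]
          linarith
      _ = ε * w ξ := one_mul _
  bound y := by
    choose C hC hfC using fun k => (hf k).bound y
    refine ⟨∑ k, C k, Finset.sum_nonneg fun k _ => hC k, fun ξ => ?_⟩
    rw [Finset.sum_mul]
    exact (norm_sum_le _ _).trans (Finset.sum_le_sum fun k _ => hfC k ξ)

theorem const_mul (hw : ∀ ξ, 0 ≤ w ξ) {f : 𝕐 → Ξ → ℝ} (hf : WeightControlled w f) (c : ℝ) :
    WeightControlled w (fun y ξ => c * f y ξ) where
  close y ε hε := by
    filter_upwards [hf.close y (ε / (|c| + 1)) (by positivity)] with y' hy' ξ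
    rw [← mul_sub, norm_mul, Real.norm_eq_abs]
    have hw0 := hw ξ
    calc |c| * ‖f y' ξ - f y ξ‖ ≤ (|c| + 1) * (ε / (|c| + 1) * w ξ) := by
          gcongr
          · linarith
          · exact hy' ξ
      _ = ε * w ξ := by field_simp
  bound y := by
    obtain ⟨C, hC, hfC⟩ := hf.bound y
    refine ⟨|c| * C, by positivity, fun ξ => ?_⟩
    rw [norm_mul, Real.norm_eq_abs, mul_assoc]
    gcongr
    exact hfC ξ

theorem pi {κ : Type*} [Fintype κ] {E : κ → Type*} [∀ k, SeminormedAddCommGroup (E k)]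
    {f : 𝕐 → Ξ → ∀ k, E k} (hw : ∀ ξ, 0 ≤ w ξ)
    (hf : ∀ k, WeightControlled w (fun y ξ => f y ξ k)) : WeightControlled w f where
  close y ε hε := by
    filter_upwards [eventually_all.2 fun k => (hf k).close y ε hε] with y' hy' ξ
    have hw0 := hw ξ
    exact (pi_norm_le_iff_of_nonneg (by positivity)).2 fun k => hy' k ξ
  bound y := by
    choose C hC hfC using fun k => (hf k).bound y
    refine ⟨∑ k, C k, Finset.sum_nonneg fun k _ => hC k, fun ξ => ?_⟩
    have hw0 := hw ξ
    have hs : 0 ≤ ∑ k, C k := Finset.sum_nonneg fun k _ => hC k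
    refine (pi_norm_le_iff_of_nonneg (by positivity)).2 fun k => (hfC k ξ).trans ?_
    gcongr
    exact Finset.single_le_sum (fun k _ => hC k) (Finset.mem_univ k)

theorem mono {f : 𝕐 → Ξ → V} {w' : Ξ → ℝ}
    (hww : ∀ ξ, w ξ ≤ w' ξ) (h : WeightControlled w f) : WeightControlled w' f where
  close y ε hε := (h.close y ε hε).mono fun y' hy' ξ => (hy' ξ).trans (by gcongr; exact hww ξ)
  bound y := by
    obtain ⟨C, hC, hfC⟩ := h.bound y
    exact ⟨C, hC, fun ξ => (hfC ξ).trans (by gcongr; exact hww ξ)⟩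

theorem noiseControl {V : Type*} [NormedAddCommGroup V] [MeasurableSpace V] [MeasurableSpace 𝕐]
    [MeasurableSpace Ξ] {γ : Measure Ξ} {f : 𝕐 → Ξ → V} (h : WeightControlled w f)
    (hw : Measurable w)
    (hexp : ∃ t : ℝ, 0 < t ∧ ∫⁻ ξ, ENNReal.ofReal (Real.exp (t * w ξ)) ∂γ ≠ ⊤)
    (hf : Measurable (Function.uncurry f)) : NoiseControl γ w f where
  measurable_w := hw
  exp_moment := hexp
  measurable_g := hf
  close y ε hε := by
    obtain ⟨U, hU, hUo, hyU⟩ := eventually_nhds_iff.1 (h.close y ε hε)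
    exact ⟨U, hUo, hyU, hU⟩
  bound := h.bound

end WeightControlled

/-! ### Asymptotically Lipschitz functions -/

/-- `f` is Lipschitz at large scales, up to a sublinear error. -/
def LipschitzAtInfinity {E F : Type*} [SeminormedAddCommGroup E] [SeminormedAddCommGroup F]
    (f : E → F) : Prop :=
  ∃ K : ℝ, 0 ≤ K ∧ ∀ ε : ℝ, 0 < ε → ∃ C : ℝ, 0 ≤ C ∧
    ∀ x y, ‖f x - f y‖ ≤ K * ‖x - y‖ + ε * (‖x‖ + ‖y‖) + C

namespace LipschitzAtInfinity

variable {E F H : Type*} [NormedAddCommGroup E] [NormedAddCommGroup F] [NormedAddCommGroup H]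

theorem of_isLittleO [ProperSpace E] {f : E → F} (hf : Continuous f) {K : ℝ} (hK : 0 ≤ K)
    {ρ : E → ℝ} (hρ : ρ =o[cobounded E] fun x => ‖x‖)
    (h : ∀ x y, ‖f x - f y‖ ≤ K * ‖x - y‖ + ρ x + ρ y) : LipschitzAtInfinity f := by
  refine ⟨K, hK, fun ε hε => ?_⟩
  have hev := hρ.bound hε
  rw [← comap_norm_atTop, eventually_comap, eventually_atTop] at hev
  obtain ⟨r, hr⟩ := hev
  have hr' : ∀ x : E, max r 0 < ‖x‖ → |ρ x| ≤ ε * ‖x‖ := fun x hx => by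
    have := hr ‖x‖ ((le_max_left r 0).trans hx.le) x rfl
    rwa [norm_norm, Real.norm_eq_abs] at this
  obtain ⟨B, hB⟩ := (isCompact_closedBall (0 : E) (max r 0)).exists_bound_of_continuousOn
    hf.continuousOn
  have hr0 : 0 ≤ max r 0 := le_max_right _ _
  have hB0 : 0 ≤ B := (norm_nonneg _).trans (hB 0 (Metric.mem_closedBall_self hr0))
  -- Nothing bounds `ρ` on the ball. A point of the ball is moved to `0`, at a cost bounded through
  -- the continuity of `f`; a point outside stays, and there `ρ` is at most `ε ‖x‖`.
  have key : ∀ x : E, ∃ x' : E, ‖f x - f x'‖ ≤ 2 * B ∧ ‖x - x'‖ ≤ max r 0 ∧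
      ρ x' ≤ ε * ‖x‖ + |ρ 0| := by
    intro x
    rcases lt_or_ge (max r 0) ‖x‖ with hx | hx
    · refine ⟨x, by simp [hB0], by simp, ?_⟩
      linarith [le_abs_self (ρ x), hr' x hx, abs_nonneg (ρ 0)]
    · refine ⟨0, ?_, by simpa using hx, ?_⟩
      · linarith [norm_sub_le (f x) (f 0), hB x (mem_closedBall_zero_iff.2 hx),
          hB 0 (Metric.mem_closedBall_self hr0)]
      · have := norm_nonneg x
        have : 0 ≤ ε * ‖x‖ := by positivity
        linarith [le_abs_self (ρ 0)]
  refine ⟨4 * B + 2 * (K * max r 0) + 2 * |ρ 0|, by positivity, fun x y => ?_⟩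
  obtain ⟨x', hx1, hx2, hx3⟩ := key x
  obtain ⟨y', hy1, hy2, hy3⟩ := key y
  have e1 : ‖f x - f y‖ ≤ ‖f x - f x'‖ + ‖f x' - f y'‖ + ‖f y - f y'‖ := by
    have : f x - f y = (f x - f x') + (f x' - f y') + -(f y - f y') := by abel
    rw [this, ← norm_neg (f y - f y')]
    exact norm_add₃_le
  have e2 : ‖x' - y'‖ ≤ ‖x - y‖ + 2 * max r 0 := by
    have h3 : x' - y' = -(x - x') + (x - y) + (y - y') := by abel
    have h4 : ‖x' - y'‖ ≤ ‖x - x'‖ + ‖x - y‖ + ‖y - y'‖ := by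
      rw [h3, ← norm_neg (x - x')]
      exact norm_add₃_le
    linarith
  have e3 := mul_le_mul_of_nonneg_left e2 hK
  linarith [h x' y']

theorem exists_linear_growth {f : E → F} (hf : LipschitzAtInfinity f) :
    ∃ C : ℝ, 0 ≤ C ∧ ∀ x, ‖f x‖ ≤ C * (1 + ‖x‖) := by
  obtain ⟨K, hK, h⟩ := hf
  obtain ⟨C, hC, hC'⟩ := h 1 one_pos
  refine ⟨K + 1 + C + ‖f 0‖, by positivity, fun x => ?_⟩
  have h1 := hC' x 0
  simp only [sub_zero, norm_zero, add_zero] at h1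
  have h2 := norm_sub_norm_le (f x) (f 0)
  have h3 := norm_nonneg x
  have h4 := norm_nonneg (f 0)
  nlinarith [mul_nonneg hC h3, mul_nonneg h4 h3]

theorem comp {g : F → H} {f : E → F} (hg : LipschitzAtInfinity g) (hf : LipschitzAtInfinity f) :
    LipschitzAtInfinity (g ∘ f) := by
  obtain ⟨D, hD, hfD⟩ := hf.exists_linear_growth
  obtain ⟨K, hK, hg⟩ := hg
  obtain ⟨K', hK', hf⟩ := hf
  refine ⟨K * K', by positivity, fun ε hε => ?_⟩
  -- The error of `g` is measured at `f x` and brought back to `x` by the linear growth constant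
  -- `D`. The error of `f` is amplified by `K`. Each receives half of `ε`.
  obtain ⟨C, hC, hgC⟩ := hg (ε / (2 * (D + 1))) (by positivity)
  obtain ⟨C', hC', hfC⟩ := hf (ε / (2 * (K + 1))) (by positivity)
  refine ⟨K * C' + ε + C, by positivity, fun x y => ?_⟩
  have h1 := hgC (f x) (f y)
  have h2 := mul_le_mul_of_nonneg_left (hfC x y) hK
  have hx := norm_nonneg x
  have hy := norm_nonneg y
  have h3 : K * (ε / (2 * (K + 1)) * (‖x‖ + ‖y‖)) ≤ ε / 2 * (‖x‖ + ‖y‖) := by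
    rw [← mul_assoc]
    gcongr
    rw [mul_div_assoc', div_le_iff₀ (by positivity)]
    nlinarith
  have h4 : ε / (2 * (D + 1)) * (‖f x‖ + ‖f y‖) ≤ ε / 2 * (2 + ‖x‖ + ‖y‖) := by
    calc ε / (2 * (D + 1)) * (‖f x‖ + ‖f y‖)
        ≤ ε / (2 * (D + 1)) * ((D + 1) * (2 + ‖x‖ + ‖y‖)) := by
          gcongr
          nlinarith [hfD x, hfD y]
      _ = ε / 2 * (2 + ‖x‖ + ‖y‖) := by field_simp
  simp only [Function.comp_apply]
  nlinarith

theorem of_norm_sub_le {f : E → F} (h : ∀ x y, ‖f x - f y‖ ≤ ‖x - y‖) : LipschitzAtInfinity f :=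
  ⟨1, zero_le_one, fun ε hε => ⟨0, le_rfl, fun x y => (h x y).trans (by
    have : 0 ≤ ε * (‖x‖ + ‖y‖) := by positivity
    linarith)⟩⟩

/-- Composing an asymptotically Lipschitz function with linear maps that depend continuously on a
parameter. -/
theorem weightControlled {𝕐 : Type*} [TopologicalSpace 𝕐] [NormedSpace ℝ E] [NormedSpace ℝ F]
    [ProperSpace E] {φ : F → H} (hφ : LipschitzAtInfinity φ) (hφc : Continuous φ)
    {A : 𝕐 → E →L[ℝ] F} (hA : Continuous A) :
    WeightControlled (fun ξ => 1 + ‖ξ‖) (fun y ξ => φ (A y ξ)) where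
  close y ε hε := by
    obtain ⟨K, hK, h⟩ := hφ
    have hA0 := norm_nonneg (A y)
    obtain ⟨C, hC, hφC⟩ := h (ε / (3 * (2 * ‖A y‖ + 1))) (by positivity)
    set δ := min 1 (ε / (3 * (K + 1))) with hδ
    have hδ0 : 0 < δ := lt_min one_pos (by positivity)
    have hKδ : K * δ ≤ ε / 3 := by
      calc K * δ ≤ (K + 1) * (ε / (3 * (K + 1))) := by
            gcongr
            · linarith
            · exact min_le_right _ _
        _ = ε / 3 := by field_simp
    have h1 : ∀ᶠ y' in 𝓝 y, ‖A y' - A y‖ < δ := by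
      have := hA.continuousAt (x := y) |>.eventually (Metric.ball_mem_nhds _ hδ0)
      exact this.mono fun y' hy' => by rwa [← dist_eq_norm]
    -- Bounded `ξ` are handled by compactness and continuity. Beyond the radius `3C/ε` the additive
    -- constant is below `ε ‖ξ‖ / 3`, and the Lipschitz and sublinear terms get the other two
    -- thirds.
    have h2 : ∀ᶠ y' in 𝓝 y, ∀ ξ ∈ Metric.closedBall (0 : E) (3 * C / ε),
        ‖φ (A y' ξ) - φ (A y ξ)‖ < ε := by
      refine (isCompact_closedBall _ _).eventually_forall_of_forall_eventually fun ξ _ => ?_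
      have hc : Continuous fun p : 𝕐 × E => ‖φ (A p.1 p.2) - φ (A y p.2)‖ := by
        have hc1 : Continuous fun p : 𝕐 × E => A p.1 p.2 :=
          (hA.comp continuous_fst).clm_apply continuous_snd
        exact ((hφc.comp hc1).sub (hφc.comp ((A y).continuous.comp continuous_snd))).norm
      have := hc.continuousAt (x := (y, ξ)) |>.eventually_lt_const (u := ε) (by simpa using hε)
      exact this
    filter_upwards [h1, h2] with y' hy1 hy2 ξ
    have hξ := norm_nonneg ξ
    by_cases hξC : ‖ξ‖ ≤ 3 * C / ε
    · refine (hy2 ξ (mem_closedBall_zero_iff.2 hξC)).le.trans ?_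
      nlinarith
    · rw [not_le, div_lt_iff₀ hε] at hξC
      have e1 : ‖A y' ξ - A y ξ‖ ≤ δ * ‖ξ‖ := by
        rw [← _root_.sub_apply]
        exact ((A y' - A y).le_opNorm ξ).trans (by gcongr)
      have e2 : ‖A y ξ‖ ≤ ‖A y‖ * ‖ξ‖ := (A y).le_opNorm ξ
      have e3 : ‖A y' ξ‖ ≤ ‖A y‖ * ‖ξ‖ + 1 * ‖ξ‖ := by
        have h5 := norm_sub_norm_le (A y' ξ) (A y ξ)
        have h6 : δ * ‖ξ‖ ≤ 1 * ‖ξ‖ := by gcongr; exact min_le_left _ _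
        linarith
      have e4 : ε / (3 * (2 * ‖A y‖ + 1)) * (‖A y' ξ‖ + ‖A y ξ‖) ≤ ε / 3 * ‖ξ‖ := by
        calc ε / (3 * (2 * ‖A y‖ + 1)) * (‖A y' ξ‖ + ‖A y ξ‖)
            ≤ ε / (3 * (2 * ‖A y‖ + 1)) * ((2 * ‖A y‖ + 1) * ‖ξ‖) := by
              gcongr
              linarith
          _ = ε / 3 * ‖ξ‖ := by field_simp
      have e5 : K * ‖A y' ξ - A y ξ‖ ≤ ε / 3 * ‖ξ‖ := by
        calc K * ‖A y' ξ - A y ξ‖ ≤ K * (δ * ‖ξ‖) := by gcongr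
          _ = K * δ * ‖ξ‖ := by ring
          _ ≤ ε / 3 * ‖ξ‖ := by gcongr
      have := hφC (A y' ξ) (A y ξ)
      nlinarith
  bound y := by
    obtain ⟨C, hC, hφC⟩ := hφ.exists_linear_growth
    refine ⟨C * (1 + ‖A y‖), by positivity, fun ξ => (hφC _).trans ?_⟩
    have h1 := (A y).le_opNorm ξ
    have h2 := norm_nonneg (A y)
    have h3 := norm_nonneg ξ
    rw [mul_assoc]
    gcongr
    nlinarith

end LipschitzAtInfinity

/-- The square of an affine function of the norm has an exponential moment under a Gaussian
measure. -/
theorem exists_lintegral_exp_sq_ne_top {E : Type*} [NormedAddCommGroup E] [NormedSpace ℝ E]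
    [MeasurableSpace E] [BorelSpace E] [SecondCountableTopology E] [CompleteSpace E]
    (γ : Measure E) [IsGaussian γ] :
    ∃ t : ℝ, 0 < t ∧ ∫⁻ ξ, ENNReal.ofReal (Real.exp (t * (1 + ‖ξ‖) ^ 2)) ∂γ ≠ ⊤ := by
  obtain ⟨C, hC, hint⟩ := IsGaussian.exists_integrable_exp_sq γ
  -- Since `(1 + r)² ≤ 2 + 2r²`, half of Fernique's constant suffices.
  refine ⟨C / 2, by positivity, ne_of_lt ?_⟩
  refine lt_of_le_of_lt (lintegral_mono fun ξ => ENNReal.ofReal_le_ofReal ?_)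
    (hint.const_mul (Real.exp C)).lintegral_lt_top
  rw [← Real.exp_add]
  apply Real.exp_le_exp.2
  nlinarith [sq_nonneg (1 - ‖ξ‖)]

namespace ConvNet

variable (net : ConvNet)

/-! ### The hidden layers as kernels on positive semidefinite matrices -/

/-- `G^{(ℓ)}` as a positive semidefinite matrix. -/
def covG (ℓ : ℕ) (z : EuclideanSpace ℝ (net.Site ℓ)) : net.Cov (ℓ + 1) :=
  ⟨net.G ℓ z, net.posSemidef_G ℓ z⟩

/-- The mean of the first `m` terms of a sequence of positive semidefinite matrices. -/
def covMean {ℓ : ℕ} (m : ℕ) (Q : ℕ → net.Cov ℓ) : net.Cov ℓ :=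
  ⟨(1 / (m : ℝ)) • ∑ c ∈ Finset.range m, (Q c).1,
    (Matrix.posSemidef_sum _ fun c _ => (Q c).2).smul (by positivity)⟩

/-- The mean of `m` independent copies of `G^{(ℓ)}(z)`, `z ∼ 𝒩(0, Q)`, as a function of `Q` and of
standard Gaussian vectors. -/
def hiddenMean (ℓ m : ℕ) (Q : net.Cov ℓ) (ξ : ℕ → EuclideanSpace ℝ (net.Site ℓ)) :
    net.Cov (ℓ + 1) :=
  net.covMean m fun c => net.covG ℓ (sqrtCLM Q (ξ c))

/-- The function `(Q, ξ) ↦ G^{(ℓ)}(√Q ξ)`, with values in arrays. -/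
def hiddenSample (ℓ : ℕ) (Q : net.Cov ℓ) (ξ : EuclideanSpace ℝ (net.Site ℓ)) :
    net.Site (ℓ + 1) → net.Site (ℓ + 1) → ℝ :=
  covToFun (net.covG ℓ (sqrtCLM Q ξ))

/-- The law of `K^{(ℓ+1,n)}` given `K^{(ℓ,n)}`. -/
def hiddenKernel (n ℓ : ℕ) : Kernel (net.Cov ℓ) (net.Cov (ℓ + 1)) :=
  noiseKernel (iidLaw (stdGaussian (EuclideanSpace ℝ (net.Site ℓ)))) (net.hiddenMean ℓ (net.C n ℓ))

theorem covToFun_covMean {ℓ : ℕ} (m : ℕ) (Q : ℕ → net.Cov ℓ) :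
    covToFun (net.covMean m Q) = (m : ℝ)⁻¹ • ∑ c ∈ Finset.range m, covToFun (Q c) := by
  rw [← one_div]
  rfl

theorem covToFun_hiddenMean (ℓ m : ℕ) (Q : net.Cov ℓ)
    (ξ : ℕ → EuclideanSpace ℝ (net.Site ℓ)) :
    covToFun (net.hiddenMean ℓ m Q ξ) = noiseMean (net.hiddenSample ℓ) m Q ξ :=
  net.covToFun_covMean _ _

section Slice

variable {net}

theorem norm_slice_le {ℓ : ℕ} (z : EuclideanSpace ℝ (net.Site ℓ)) (μ : Fin net.P) :
    ‖net.slice z μ‖ ≤ ‖z‖ := by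
  rw [EuclideanSpace.norm_eq, EuclideanSpace.norm_eq]
  apply Real.sqrt_le_sqrt
  rw [Fintype.sum_prod_type_right]
  exact Finset.single_le_sum (f := fun ν => ∑ i, ‖z (i, ν)‖ ^ 2)
    (fun ν _ => Finset.sum_nonneg fun i _ => by positivity) (Finset.mem_univ μ)

theorem slice_sub {ℓ : ℕ} (z z' : EuclideanSpace ℝ (net.Site ℓ)) (μ : Fin net.P) :
    net.slice z μ - net.slice z' μ = net.slice (z - z') μ := rfl

theorem continuous_slice {ℓ : ℕ} (μ : Fin net.P) :
    Continuous fun z : EuclideanSpace ℝ (net.Site ℓ) => net.slice z μ := by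
  unfold slice
  fun_prop

end Slice

variable {net}

section Lipschitz

variable (hLip : net.AsymptoticLipschitz) {ℓ : ℕ} (hℓ : ℓ ∈ Finset.Icc 1 net.L)
include hLip hℓ

theorem AsymptoticLipschitz.lipschitzAtInfinity_neuron (s : net.Site (ℓ + 1)) (m : net.mask ℓ) :
    LipschitzAtInfinity fun z : EuclideanSpace ℝ (net.Site ℓ) =>
      net.σ (net.R ℓ s.1 (net.slice z s.2) m) := by
  have hσ : LipschitzAtInfinity net.σ := by
    obtain ⟨K, hK, ρ, -, hρ, h⟩ := hLip.bound_σ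
    exact .of_isLittleO hLip.continuous_σ hK hρ h
  have hR : LipschitzAtInfinity (net.R ℓ s.1) := by
    obtain ⟨K, hK, ρ, hρ, h⟩ := hLip.bound_R ℓ hℓ s.1
    exact .of_isLittleO (hLip.continuous_R ℓ hℓ s.1) hK hρ h
  have hs : LipschitzAtInfinity fun z : EuclideanSpace ℝ (net.Site ℓ) => net.slice z s.2 :=
    .of_norm_sub_le fun x y => by rw [slice_sub]; exact norm_slice_le _ _
  have hm : LipschitzAtInfinity fun z : EuclideanSpace ℝ (net.mask ℓ) => z m :=
    .of_norm_sub_le fun x y => PiLp.norm_apply_le (x - y) m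
  exact hσ.comp (hm.comp (hR.comp hs))

theorem AsymptoticLipschitz.continuous_neuron (s : net.Site (ℓ + 1)) (m : net.mask ℓ) :
    Continuous fun z : EuclideanSpace ℝ (net.Site ℓ) =>
      net.σ (net.R ℓ s.1 (net.slice z s.2) m) := by
  have h1 := hLip.continuous_R ℓ hℓ s.1
  have h2 : Continuous fun z : EuclideanSpace ℝ (net.mask ℓ) => z m := by fun_prop
  exact hLip.continuous_σ.comp (h2.comp (h1.comp (continuous_slice s.2)))

theorem AsymptoticLipschitz.continuous_covG : Continuous (net.covG ℓ) := by
  refine Continuous.subtype_mk (continuous_matrix fun s t => ?_) _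
  have h := hLip.continuous_neuron hℓ
  simp only [G, Matrix.of_apply]
  exact continuous_const.mul (continuous_finsetSum _ fun m _ => (h s m).mul (h t m))

theorem AsymptoticLipschitz.measurable_covG_sqrt :
    Measurable fun p : net.Cov ℓ × EuclideanSpace ℝ (net.Site ℓ) =>
      net.covG ℓ (sqrtCLM p.1 p.2) := by
  have h : Continuous fun p : net.Cov ℓ × EuclideanSpace ℝ (net.Site ℓ) => sqrtCLM p.1 p.2 :=
    (continuous_sqrtCLM.comp continuous_fst).clm_apply continuous_snd
  exact ((hLip.continuous_covG hℓ).comp h).measurable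

theorem AsymptoticLipschitz.measurable_hiddenSample :
    Measurable (Function.uncurry (net.hiddenSample ℓ)) :=
  isClosedEmbedding_covToFun.continuous.measurable.comp (hLip.measurable_covG_sqrt hℓ)

theorem AsymptoticLipschitz.measurable_hiddenMean (m : ℕ) :
    Measurable (Function.uncurry (net.hiddenMean ℓ m)) := by
  rw [← isClosedEmbedding_covToFun.measurableEmbedding.measurable_comp_iff]
  have h : covToFun ∘ Function.uncurry (net.hiddenMean ℓ m) =
      Function.uncurry (noiseMean (net.hiddenSample ℓ) m) := by
    ext1 p
    exact net.covToFun_hiddenMean ℓ m p.1 p.2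
  rw [h]
  exact measurable_noiseMean (hLip.measurable_hiddenSample hℓ) m

theorem AsymptoticLipschitz.noiseControl_hiddenSample :
    NoiseControl (stdGaussian (EuclideanSpace ℝ (net.Site ℓ))) (fun ξ => (1 + ‖ξ‖) ^ 2)
      (net.hiddenSample ℓ) := by
  refine WeightControlled.noiseControl ?_ (by fun_prop) (exists_lintegral_exp_sq_ne_top _)
    (hLip.measurable_hiddenSample hℓ)
  have hw : ∀ ξ : EuclideanSpace ℝ (net.Site ℓ), 0 ≤ (1 + ‖ξ‖) ^ 2 := fun ξ => by positivity
  refine WeightControlled.pi hw fun s => WeightControlled.pi hw fun t => ?_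
  have h : ∀ (s : net.Site (ℓ + 1)) (m : net.mask ℓ),
      WeightControlled (fun ξ => 1 + ‖ξ‖) fun (Q : net.Cov ℓ) ξ =>
        net.σ (net.R ℓ s.1 (net.slice (sqrtCLM Q ξ) s.2) m) := fun s m =>
    (hLip.lipschitzAtInfinity_neuron hℓ s m).weightControlled (hLip.continuous_neuron hℓ s m)
      continuous_sqrtCLM
  exact (WeightControlled.sum hw fun m =>
    (h s m).mul (fun ξ => by positivity) (h t m)).const_mul hw _

theorem AsymptoticLipschitz.isMarkovKernel_hiddenKernel (n : ℕ) :
    IsMarkovKernel (net.hiddenKernel n ℓ) :=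
  isMarkovKernel_noiseKernel (hLip.measurable_hiddenMean hℓ _)

theorem AsymptoticLipschitz.hiddenKernel_map_covToFun (n : ℕ) :
    (net.hiddenKernel n ℓ).map covToFun =
      noiseKernel (iidLaw (stdGaussian (EuclideanSpace ℝ (net.Site ℓ))))
        (noiseMean (net.hiddenSample ℓ) (net.C n ℓ)) := by
  rw [hiddenKernel, noiseKernel_map (hLip.measurable_hiddenMean hℓ _)
    isClosedEmbedding_covToFun.continuous.measurable]
  simp_rw [covToFun_hiddenMean]

end Lipschitz

/-! ### The rate function of a hidden layer -/

theorem trace_transpose_mul_eq_sum {ι : Type*} [Fintype ι] (A B : Matrix ι ι ℝ) :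
    (Aᵀ * B).trace = ∑ i, ∑ j, A i j * B i j := by
  simp only [Matrix.trace, Matrix.diag_apply, Matrix.mul_apply, Matrix.transpose_apply]
  exact Finset.sum_comm

theorem exists_clm_eq_trace {ι : Type*} [Fintype ι] (A : Matrix ι ι ℝ) :
    ∃ L : (ι → ι → ℝ) →L[ℝ] ℝ, ∀ B : ι → ι → ℝ, L B = (Aᵀ * Matrix.of B).trace := by
  refine ⟨∑ i, ∑ j, A i j • (ContinuousLinearMap.proj (R := ℝ) (φ := fun _ : ι => ℝ) j).comp
    (ContinuousLinearMap.proj (R := ℝ) (φ := fun _ : ι => ι → ℝ) i), fun B => ?_⟩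
  rw [trace_transpose_mul_eq_sum]
  simp

/-- The supremum in `layerRate` runs over symmetric matrices and the one in `cramerRate` over all
linear forms. On symmetric arguments a form coincides with its symmetrization, so nothing is lost.
-/
theorem exists_isSymm_trace_eq_clm {ι : Type*} [Fintype ι] (L : (ι → ι → ℝ) →L[ℝ] ℝ) :
    ∃ A : Matrix ι ι ℝ, A.IsSymm ∧
      ∀ B : Matrix ι ι ℝ, B.IsSymm → (Aᵀ * B).trace = L (fun i j => B i j) := by
  classical
  set l : ι → ι → ℝ := fun i j => L (Pi.single i (Pi.single j 1)) with hl
  have hL : ∀ B : ι → ι → ℝ, L B = ∑ i, ∑ j, B i j * l i j := by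
    intro B
    have hB : B = ∑ i, ∑ j, B i j • (Pi.single i (Pi.single j 1) : ι → ι → ℝ) := by
      ext a b
      simp only [Finset.sum_apply, Pi.smul_apply, smul_eq_mul]
      rw [Finset.sum_eq_single a, Finset.sum_eq_single b]
      · simp
      · intro j _ hj
        simp [Ne.symm hj]
      · simp
      · intro i _ hi
        simp [Ne.symm hi]
      · simp
    conv_lhs => rw [hB]
    simp [map_sum, hl]
  refine ⟨Matrix.of fun i j => (l i j + l j i) / 2, ?_, fun B hB => ?_⟩
  · ext i j
    simp [add_comm]
  · rw [trace_transpose_mul_eq_sum, hL]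
    have h1 : ∑ i, ∑ j, B i j * l j i = ∑ i, ∑ j, B i j * l i j := by
      rw [Finset.sum_comm]
      refine Finset.sum_congr rfl fun i _ => Finset.sum_congr rfl fun j _ => ?_
      rw [hB.apply i j]
    have h2 : ∑ i, ∑ j, (Matrix.of fun i j => (l i j + l j i) / 2) i j * B i j =
        (∑ i, ∑ j, B i j * l i j + ∑ i, ∑ j, B i j * l j i) / 2 := by
      rw [← Finset.sum_add_distrib, Finset.sum_div]
      refine Finset.sum_congr rfl fun i _ => ?_
      rw [← Finset.sum_add_distrib, Finset.sum_div]
      refine Finset.sum_congr rfl fun j _ => ?_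
      rw [Matrix.of_apply]
      ring
    rw [h2, h1]
    ring

theorem AsymptoticLipschitz.cramerRate_hiddenSample (hLip : net.AsymptoticLipschitz) {ℓ : ℕ}
    (hℓ : ℓ ∈ Finset.Icc 1 net.L) (Q : net.Cov ℓ) (Q' : net.Cov (ℓ + 1)) :
    cramerRate ((stdGaussian (EuclideanSpace ℝ (net.Site ℓ))).map (net.hiddenSample ℓ Q))
      (covToFun Q') = net.layerRate ℓ Q'.1 Q.1 := by
  have hmeas : Measurable (net.hiddenSample ℓ Q) :=
    (hLip.measurable_hiddenSample hℓ).of_uncurry_left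
  -- The Laplace transform sees `L` only at values of `G ℓ`, so a trace form agreeing with `L` there
  -- has the same one.
  have hlap : ∀ (A : Matrix (net.Site (ℓ + 1)) (net.Site (ℓ + 1)) ℝ)
      (L : (net.Site (ℓ + 1) → net.Site (ℓ + 1) → ℝ) →L[ℝ] ℝ),
      (∀ z, L (covToFun (net.covG ℓ z)) = (Aᵀ * net.G ℓ z).trace) →
      laplace ((stdGaussian (EuclideanSpace ℝ (net.Site ℓ))).map (net.hiddenSample ℓ Q)) L =
        ∫⁻ z, ENNReal.ofReal (Real.exp (Aᵀ * net.G ℓ z).trace) ∂(multivariateGaussian 0 Q.1) := by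
    intro A L h
    have h1 : Measurable fun z => ENNReal.ofReal (Real.exp (Aᵀ * net.G ℓ z).trace) := by
      simp_rw [← h]
      have h2 := isClosedEmbedding_covToFun.continuous.comp (hLip.continuous_covG hℓ)
      exact (ENNReal.continuous_ofReal.comp
        (Real.continuous_exp.comp (L.continuous.comp h2))).measurable
    rw [laplace, lintegral_map (by fun_prop) hmeas, multivariateGaussian_eq_map_sqrtCLM,
      lintegral_map h1 (by fun_prop)]
    refine lintegral_congr fun ξ => ?_
    rw [hiddenSample, h]
  have hsymm : ∀ z, (net.G ℓ z).IsSymm := fun z => by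
    have := (net.posSemidef_G ℓ z).1
    rwa [Matrix.IsHermitian, Matrix.conjTranspose_eq_transpose_of_trivial] at this
  have hsymm' : Q'.1.IsSymm := by
    have := Q'.2.1
    rwa [Matrix.IsHermitian, Matrix.conjTranspose_eq_transpose_of_trivial] at this
  apply le_antisymm
  · refine iSup_le fun L => ?_
    obtain ⟨A, hA, hAL⟩ := exists_isSymm_trace_eq_clm L
    refine le_trans (le_of_eq ?_) (le_iSup (fun Q₀ :
      {Q : Matrix (net.Site (ℓ + 1)) (net.Site (ℓ + 1)) ℝ // Q.IsSymm} =>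
      ((Q₀.1ᵀ * Q'.1).trace : EReal) - ENNReal.log (∫⁻ z, ENNReal.ofReal
        (Real.exp (Q₀.1ᵀ * net.G ℓ z).trace) ∂(multivariateGaussian 0 Q.1))) ⟨A, hA⟩)
    simp only
    rw [hlap A L fun z => (hAL _ (hsymm z)).symm, hAL _ hsymm']
    rfl
  · refine iSup_le fun A => ?_
    obtain ⟨L, hL⟩ := exists_clm_eq_trace A.1
    refine le_trans (le_of_eq ?_) (le_iSup (fun L => ((L (covToFun Q') : ℝ) : EReal) -
      ENNReal.log (laplace ((stdGaussian (EuclideanSpace ℝ (net.Site ℓ))).map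
        (net.hiddenSample ℓ Q)) L)) L)
    simp only
    rw [hlap A.1 L fun z => hL _, hL]
    rfl

theorem AsymptoticLipschitz.kernelLDP_hiddenKernel (hLip : net.AsymptoticLipschitz) {α : ℕ → ℝ}
    (hα : net.LinearWidths α) {ℓ : ℕ} (hℓ : ℓ ∈ Finset.Icc 1 net.L) :
    KernelLDP (fun n => net.hiddenKernel n ℓ)
      (fun Q Q' => (α ℓ : EReal) * net.layerRate ℓ Q'.1 Q.1) := by
  have h := (hLip.noiseControl_hiddenSample hℓ).kernelLDP (hα ℓ hℓ).1 (hα ℓ hℓ).2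
  simp_rw [← hLip.hiddenKernel_map_covToFun hℓ] at h
  have h' := KernelLDP.of_map_isClosedEmbedding isClosedEmbedding_covToFun h
  simp_rw [hLip.cramerRate_hiddenSample hℓ] at h'
  exact h'

theorem AsymptoticLipschitz.layerRate_nonneg (hLip : net.AsymptoticLipschitz) {ℓ : ℕ}
    (hℓ : ℓ ∈ Finset.Icc 1 net.L) (Q : net.Cov ℓ) (Q' : net.Cov (ℓ + 1)) :
    0 ≤ net.layerRate ℓ Q'.1 Q.1 := by
  rw [← hLip.cramerRate_hiddenSample hℓ]
  have hmeas : Measurable (net.hiddenSample ℓ Q) :=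
    (hLip.measurable_hiddenSample hℓ).of_uncurry_left
  have := Measure.isProbabilityMeasure_map
    (μ := stdGaussian (EuclideanSpace ℝ (net.Site ℓ))) hmeas.aemeasurable
  exact cramerRate_nonneg _

end ConvNet

/-! ### Products of centered Gaussian measures -/

section GaussianChannels

variable {ι κ : Type*} [Fintype ι] [DecidableEq ι] [Fintype κ] [DecidableEq κ]

theorem charFunDual_gaussianReal_zero (v : NNReal) (L : StrongDual ℝ ℝ) :
    charFunDual (gaussianReal 0 v) L = Complex.exp (-((v * L 1 ^ 2 / 2 : ℝ) : ℂ)) := by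
  have h : ∀ x : ℝ, L x = L 1 * x := fun x => by
    rw [mul_comm, ← smul_eq_mul, ← map_smul, smul_eq_mul, mul_one]
  have h2 := charFun_gaussianReal (μ := 0) (v := v) (L 1)
  rw [charFun_apply_real] at h2
  have h3 : (fun x : ℝ => Complex.exp (L x * Complex.I)) =
      fun x : ℝ => Complex.exp ((L 1 : ℝ) * x * Complex.I) := by
    funext x
    rw [h x, Complex.ofReal_mul]
  rw [charFunDual_apply, h3, h2]
  congr 1
  push_cast
  ring

theorem charFunDual_multivariateGaussian_zero {Q : Matrix ι ι ℝ} (hQ : Q.PosSemidef)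
    (L : StrongDual ℝ (EuclideanSpace ℝ ι)) :
    charFunDual (multivariateGaussian 0 Q) L = Complex.exp (-(((fun s => L (EuclideanSpace.single s 1))
      ⬝ᵥ (Q *ᵥ fun s => L (EuclideanSpace.single s 1)) / 2 : ℝ) : ℂ)) := by
  set t := (InnerProductSpace.toDual ℝ (EuclideanSpace ℝ ι)).symm L with ht
  have hL : L = InnerProductSpace.toDualMap ℝ (EuclideanSpace ℝ ι) t := by
    ext x
    simp [ht]
  have htc : (fun s => L (EuclideanSpace.single s 1)) = t.ofLp := by
    ext s
    rw [hL, InnerProductSpace.toDualMap_apply_apply, EuclideanSpace.inner_single_right]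
    simp
  rw [htc, hL, ← charFun_eq_charFunDual_toDualMap, charFun_multivariateGaussian hQ]
  congr 1
  simp

/-- The covariance of a linear form under the product of Gaussian measures of covariance `Q`. -/
def channelForm (Q : Matrix ι ι ℝ) (l : κ → ι → ℝ) : ℝ := ∑ c, l c ⬝ᵥ (Q *ᵥ l c)

theorem channelForm_smul (Q : Matrix ι ι ℝ) (l : κ → ι → ℝ) (a : ℝ) :
    channelForm Q (fun c s => a * l c s) = a ^ 2 * channelForm Q l := by
  rw [channelForm, channelForm, Finset.mul_sum]
  refine Finset.sum_congr rfl fun c _ => ?_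
  have : (fun s => a * l c s) = a • l c := rfl
  rw [this, Matrix.mulVec_smul, dotProduct_smul, smul_dotProduct, smul_eq_mul, smul_eq_mul]
  ring

theorem charFunDual_pi_multivariateGaussian {Q : Matrix ι ι ℝ} (hQ : Q.PosSemidef)
    (L : StrongDual ℝ (κ → EuclideanSpace ℝ ι)) :
    charFunDual (Measure.pi fun _ : κ => multivariateGaussian 0 Q) L =
      Complex.exp (-((channelForm Q (fun c s => L (Pi.single c (EuclideanSpace.single s 1))) / 2 : ℝ)
        : ℂ)) := by
  rw [charFunDual_pi]
  simp_rw [charFunDual_multivariateGaussian_zero hQ]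
  rw [← Complex.exp_sum, channelForm, Finset.sum_neg_distrib, Finset.sum_div]
  push_cast
  rfl

/-- Linear combinations of independent Gaussian weights, one for each channel, are independent
Gaussian vectors. -/
theorem map_pi_gaussianReal_eq_pi_multivariateGaussian {β : Type*} [Fintype β] [DecidableEq β]
    (a : β → ι → ℝ) (v : NNReal) {Q : Matrix ι ι ℝ} (hQ : Q.PosSemidef)
    (hQa : ∀ s t, Q s t = v * ∑ b, a b s * a b t) :
    (Measure.pi fun _ : β × κ => gaussianReal 0 v).map
      (fun u c => WithLp.toLp 2 fun s => ∑ b, u (b, c) * a b s) =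
      Measure.pi fun _ : κ => multivariateGaussian 0 Q := by
  let A : (β × κ → ℝ) →L[ℝ] (κ → EuclideanSpace ℝ ι) :=
    LinearMap.toContinuousLinearMap
      { toFun := fun u c => WithLp.toLp 2 fun s => ∑ b, u (b, c) * a b s
        map_add' := fun u u' => by
          ext c s
          simp [add_mul, Finset.sum_add_distrib]
        map_smul' := fun r u => by
          ext c s
          simp [mul_assoc, Finset.mul_sum] }
  have hA : (fun (u : β × κ → ℝ) c => WithLp.toLp 2 fun s => ∑ b, u (b, c) * a b s) = A := rfl
  rw [hA]
  have : IsProbabilityMeasure ((Measure.pi fun _ : β × κ => gaussianReal 0 v).map A) :=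
    Measure.isProbabilityMeasure_map A.continuous.measurable.aemeasurable
  apply Measure.ext_of_charFunDual
  ext L
  rw [charFunDual_map, charFunDual_pi, charFunDual_pi_multivariateGaussian hQ]
  simp_rw [charFunDual_gaussianReal_zero]
  rw [← Complex.exp_sum, Finset.sum_neg_distrib, ← Complex.ofReal_sum]
  congr 3
  set l : κ → ι → ℝ := fun c s => L (Pi.single c (EuclideanSpace.single s 1)) with hl
  have hsingle : ∀ b c, ((L.comp A).comp (ContinuousLinearMap.single ℝ (fun _ : β × κ => ℝ) (b, c))) 1 =
      ∑ s, a b s * l c s := by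
    intro b c
    have h1 : A (Pi.single (b, c) (1 : ℝ)) =
        ∑ s, a b s • (Pi.single c (EuclideanSpace.single s 1) : κ → EuclideanSpace ℝ ι) := by
      ext c' s'
      change ∑ b', (Pi.single (b, c) (1 : ℝ) : β × κ → ℝ) (b', c') * a b' s' = _
      rw [Finset.sum_apply]
      by_cases hc : c' = c
      · subst hc
        simp [Pi.single_apply, Prod.ext_iff]
      · simp [Prod.ext_iff, hc]
    change L (A (Pi.single (b, c) (1 : ℝ))) = _
    rw [h1, map_sum]
    simp [hl]
  rw [Fintype.sum_prod_type_right, channelForm, Finset.sum_div]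
  refine Finset.sum_congr rfl fun c _ => ?_
  simp_rw [hsingle]
  rw [← Finset.sum_div]
  congr 1
  simp only [dotProduct, Matrix.mulVec, hQa]
  simp_rw [sq, Finset.sum_mul_sum, Finset.mul_sum, Finset.sum_mul, Finset.mul_sum]
  rw [Finset.sum_comm]
  refine Finset.sum_congr rfl fun s _ => ?_
  rw [Finset.sum_comm]
  refine Finset.sum_congr rfl fun t _ => Finset.sum_congr rfl fun b _ => ?_
  ring

end GaussianChannels

/-! ### Large deviations of rescaled Gaussian vectors -/

section Output

variable {ι κ : Type*} [Fintype ι] [DecidableEq ι] [Fintype κ] [DecidableEq κ]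

/-- The vectors `√Q ξ_c`, as an array. -/
def channelSample (Q : {Q : Matrix ι ι ℝ // Q.PosSemidef}) (ξ : κ → EuclideanSpace ℝ ι) :
    κ → ι → ℝ :=
  fun c s => sqrtCLM Q (ξ c) s

theorem continuous_channelSample :
    Continuous (Function.uncurry (channelSample (ι := ι) (κ := κ))) := by
  refine continuous_pi fun c => continuous_pi fun s => ?_
  have h : Continuous fun p : {Q : Matrix ι ι ℝ // Q.PosSemidef} × (κ → EuclideanSpace ℝ ι) =>
      sqrtCLM p.1 (p.2 c) :=
    (continuous_sqrtCLM.comp continuous_fst).clm_apply ((continuous_apply c).comp continuous_snd)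
  exact (PiLp.continuous_apply 2 _ s).comp h

instance isGaussian_pi_stdGaussian :
    IsGaussian (Measure.pi fun _ : κ => stdGaussian (EuclideanSpace ℝ ι)) := by
  set P := Measure.pi fun _ : κ => stdGaussian (EuclideanSpace ℝ ι) with hP
  have h1 : iIndepFun (fun (c : κ) (z : κ → EuclideanSpace ℝ ι) => id (z c)) P :=
    iIndepFun_pi fun _ => aemeasurable_id
  have h2 : ∀ c : κ, HasGaussianLaw (fun z : κ → EuclideanSpace ℝ ι => id (z c)) P := by
    intro c
    refine ⟨?_⟩
    have : P.map (fun z : κ → EuclideanSpace ℝ ι => id (z c)) =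
        stdGaussian (EuclideanSpace ℝ ι) := (measurePreserving_eval _ c).map_eq
    rw [this]
    infer_instance
  have h3 := (h1.hasGaussianLaw h2).isGaussian_map
  have h4 : P.map (fun z : κ → EuclideanSpace ℝ ι => fun c => id (z c)) = P := Measure.map_id
  rwa [h4] at h3

/-- The samples are linear in the noise, so the weight `1 + ‖ξ‖` controls them; it is enlarged to
its square, for which an exponential moment is known. -/
theorem noiseControl_channelSample :
    NoiseControl (Measure.pi fun _ : κ => stdGaussian (EuclideanSpace ℝ ι))
      (fun ξ => (1 + ‖ξ‖) ^ 2) (channelSample (ι := ι) (κ := κ)) := by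
  refine WeightControlled.noiseControl (WeightControlled.mono (w := fun ξ => 1 + ‖ξ‖) ?_ ?_)
    (by fun_prop) (exists_lintegral_exp_sq_ne_top _) continuous_channelSample.measurable
  · intro ξ
    nlinarith [norm_nonneg ξ]
  refine WeightControlled.pi (fun ξ => by positivity) fun c =>
    WeightControlled.pi (fun ξ => by positivity) fun s => ?_
  have h : LipschitzAtInfinity fun z : EuclideanSpace ℝ ι => z s :=
    .of_norm_sub_le fun x y => PiLp.norm_apply_le (x - y) s
  have hA : Continuous fun Q : {Q : Matrix ι ι ℝ // Q.PosSemidef} =>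
      (sqrtCLM Q).comp (ContinuousLinearMap.proj (R := ℝ) (φ := fun _ : κ => EuclideanSpace ℝ ι) c) :=
    continuous_sqrtCLM.clm_comp continuous_const
  exact h.weightControlled (PiLp.continuous_apply 2 _ s) hA

/-- The law of a Gaussian vector with independent channels of covariance `Q`. -/
def channelLaw (κ : Type*) [Fintype κ] (Q : Matrix ι ι ℝ) : Measure (κ → ι → ℝ) :=
  (Measure.pi fun _ : κ => multivariateGaussian 0 Q).map fun z c s => z c s

theorem continuous_ofLp_channels :
    Continuous fun (z : κ → EuclideanSpace ℝ ι) c s => z c s :=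
  continuous_pi fun c => continuous_pi fun s =>
    (PiLp.continuous_apply 2 _ s).comp (continuous_apply c)

instance isProbabilityMeasure_channelLaw (Q : Matrix ι ι ℝ) :
    IsProbabilityMeasure (channelLaw κ Q) :=
  Measure.isProbabilityMeasure_map continuous_ofLp_channels.measurable.aemeasurable

theorem map_channelSample (Q : {Q : Matrix ι ι ℝ // Q.PosSemidef}) :
    (Measure.pi fun _ : κ => stdGaussian (EuclideanSpace ℝ ι)).map (channelSample Q) =
      channelLaw κ Q.1 := by
  rw [channelLaw, multivariateGaussian_eq_map_sqrtCLM,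
    ← Measure.pi_map_pi (fun _ => (sqrtCLM Q).continuous.measurable.aemeasurable),
    Measure.map_map continuous_ofLp_channels.measurable
      (measurable_pi_lambda _ fun c => by fun_prop)]
  rfl

theorem charFunDual_channelLaw {Q : Matrix ι ι ℝ} (hQ : Q.PosSemidef)
    (L : StrongDual ℝ (κ → ι → ℝ)) :
    charFunDual (channelLaw κ Q) L =
      Complex.exp (-((channelForm Q (fun c s => L (Pi.single c (Pi.single s 1))) / 2 : ℝ) : ℂ)) := by
  let A : (κ → EuclideanSpace ℝ ι) →L[ℝ] (κ → ι → ℝ) :=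
    ContinuousLinearMap.piMap fun _ => (EuclideanSpace.equiv ι ℝ).toContinuousLinearMap
  have hA : (fun (z : κ → EuclideanSpace ℝ ι) c s => z c s) = A := rfl
  rw [channelLaw, hA, charFunDual_map, charFunDual_pi_multivariateGaussian hQ]
  congr 6
  ext c s
  change L (A _) = _
  congr 1
  ext c' s'
  change (Pi.single c (EuclideanSpace.single s 1) : κ → EuclideanSpace ℝ ι) c' s' = _
  by_cases hc : c' = c
  · subst hc
    simp [Pi.single_apply]
  · simp [hc]

/-- The image under `L` is a real centred Gaussian with variance the quadratic form `q`, identified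
by characteristic functions; its moment generating function at `1` is `e^{q/2}`. -/
theorem laplace_channelLaw {Q : Matrix ι ι ℝ} (hQ : Q.PosSemidef) (L : StrongDual ℝ (κ → ι → ℝ)) :
    laplace (channelLaw κ Q) L =
      ENNReal.ofReal (Real.exp (channelForm Q (fun c s => L (Pi.single c (Pi.single s 1))) / 2)) := by
  set q := channelForm Q (fun c s => L (Pi.single c (Pi.single s 1))) with hq
  have hq0 : 0 ≤ q := Finset.sum_nonneg fun c _ => by
    have := hQ.dotProduct_mulVec_nonneg (fun s => L (Pi.single c (Pi.single s 1)))
    simpa using this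
  have hmap : (channelLaw κ Q).map L = gaussianReal 0 q.toNNReal := by
    have : IsProbabilityMeasure ((channelLaw κ Q).map L) :=
      Measure.isProbabilityMeasure_map L.continuous.measurable.aemeasurable
    apply Measure.ext_of_charFunDual
    ext l
    rw [charFunDual_map, charFunDual_channelLaw hQ, charFunDual_gaussianReal_zero]
    congr 3
    have h : (fun c s => (l.comp L) (Pi.single c (Pi.single s 1))) =
        fun c s => l 1 * L (Pi.single c (Pi.single s 1)) := by
      ext c s
      rw [ContinuousLinearMap.comp_apply, mul_comm, ← smul_eq_mul, ← map_smul, smul_eq_mul, mul_one]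
    rw [h, channelForm_smul, ← hq, Real.coe_toNNReal _ hq0]
    ring
  have hmgf := mgf_gaussianReal hmap 1
  rw [mgf] at hmgf
  rw [laplace, ← ofReal_integral_eq_lintegral_ofReal]
  · congr 1
    simp only [one_mul] at hmgf
    rw [hmgf, Real.coe_toNNReal _ hq0]
    congr 1
    ring
  · have h1 : Integrable (fun x : ℝ => Real.exp (1 * x)) ((channelLaw κ Q).map L) := by
      rw [hmap]
      exact integrable_exp_mul_gaussianReal 1
    have h2 := h1.comp_measurable (f := L) L.continuous.measurable
    simpa [Function.comp_def] using h2
  · exact Eventually.of_forall fun x => (Real.exp_pos _).le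

end Output

theorem EReal.coe_finsetSum_real {ι : Type*} (s : Finset ι) (f : ι → ℝ) :
    ((∑ i ∈ s, f i : ℝ) : EReal) = ∑ i ∈ s, (f i : EReal) :=
  map_sum (⟨⟨Real.toEReal, EReal.coe_zero⟩, EReal.coe_add⟩ : ℝ →+ EReal) f s

theorem charFunDual_convPow {V : Type*} [NormedAddCommGroup V] [NormedSpace ℝ V]
    [MeasurableSpace V] [BorelSpace V] [SecondCountableTopology V] (μ : Measure V)
    [IsFiniteMeasure μ] (L : StrongDual ℝ V) :
    ∀ n, charFunDual (convPow μ n) L = charFunDual μ L ^ n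
  | 0 => by simp [convPow]
  | n + 1 => by
    rw [convPow, charFunDual_conv, charFunDual_convPow μ L n, pow_succ]

/-! ### The Cramér rate of Gaussian channels and the output kernel -/

section GaussianMean

variable {ι κ : Type*} [Fintype ι] [DecidableEq ι] [Fintype κ] [DecidableEq κ]

theorem exists_clm_eq_sum_dotProduct (l : κ → ι → ℝ) :
    ∃ L : (κ → ι → ℝ) →L[ℝ] ℝ, ∀ Z, L Z = ∑ c, l c ⬝ᵥ Z c :=
  ⟨∑ c, ∑ s, l c s • (ContinuousLinearMap.proj (R := ℝ) (φ := fun _ : ι => ℝ) s).comp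
    (ContinuousLinearMap.proj (R := ℝ) (φ := fun _ : κ => ι → ℝ) c), fun Z => by
      simp [dotProduct]⟩

theorem clm_apply_eq_sum_dotProduct (L : (κ → ι → ℝ) →L[ℝ] ℝ) (Z : κ → ι → ℝ) :
    L Z = ∑ c, (fun s => L (Pi.single c (Pi.single s 1))) ⬝ᵥ Z c := by
  have hZ : Z = ∑ c, ∑ s, Z c s • (Pi.single c (Pi.single s 1) : κ → ι → ℝ) := by
    ext a b
    simp only [Finset.sum_apply, Pi.smul_apply, smul_eq_mul]
    rw [Finset.sum_eq_single a, Finset.sum_eq_single b]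
    · simp
    · intro j _ hj
      simp [Ne.symm hj]
    · simp
    · intro i _ hi
      simp [Ne.symm hi]
    · simp
  conv_lhs => rw [hZ]
  simp [map_sum, dotProduct, mul_comm]

theorem genNormSq_nonneg {Q : Matrix ι ι ℝ} (hQ : Q.PosSemidef) (Z : ι → ℝ) :
    0 ≤ genNormSq Q Z := by
  rw [genNormSq]
  split_ifs with h
  · have := hQ.dotProduct_mulVec_nonneg h.choose
    exact_mod_cast by simpa using this
  · exact le_top

theorem genNormSq_eq_top {Q : Matrix ι ι ℝ} {Z : ι → ℝ} (h : ¬∃ V, Z = Q *ᵥ V) :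
    genNormSq Q Z = ⊤ := dif_neg h

theorem sum_genNormSq_eq_top {Q : Matrix ι ι ℝ} (hQ : Q.PosSemidef) {Z : κ → ι → ℝ}
    {c : κ} (h : ¬∃ V, Z c = Q *ᵥ V) : ∑ c, genNormSq Q (Z c) = ⊤ :=
  top_le_iff.1 <| (genNormSq_eq_top h).symm.le.trans
    (Finset.single_le_sum (f := fun c => genNormSq Q (Z c))
      (fun c _ => genNormSq_nonneg hQ (Z c)) (Finset.mem_univ c))

/-- A linear form that vanishes on the range of `Q` but not at `Z`. -/
theorem exists_dotProduct_ne_zero {Q : Matrix ι ι ℝ} {Z : ι → ℝ} (h : ¬∃ V, Z = Q *ᵥ V) :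
    ∃ w : ι → ℝ, w ⬝ᵥ (Q *ᵥ w) = 0 ∧ w ⬝ᵥ Z ≠ 0 := by
  have hZ : Z ∉ LinearMap.range Q.mulVecLin := by
    rintro ⟨V, hV⟩
    exact h ⟨V, hV.symm⟩
  obtain ⟨f, hf, hker⟩ := Submodule.exists_le_ker_of_notMem hZ
  have hfw : ∀ x : ι → ℝ, f x = (fun s => f (Pi.single s 1)) ⬝ᵥ x := by
    intro x
    conv_lhs => rw [pi_eq_sum_univ' x]
    simp [dotProduct, mul_comm]
  refine ⟨fun s => f (Pi.single s 1), ?_, ?_⟩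
  · rw [← hfw]
    exact hker ⟨_, rfl⟩
  · rwa [← hfw]

/-- If `Z c = Q V c` for all `c`, completing the square shows that `l = V` maximizes `l · Z - ½ l ·
Q l`. If some channel leaves the range of `Q`, a direction of zero variance not orthogonal to it
makes the supremum infinite. -/
theorem cramerRate_channelLaw {Q : Matrix ι ι ℝ} (hQ : Q.PosSemidef) (Z : κ → ι → ℝ) :
    cramerRate (channelLaw κ Q) Z = ((1 / 2 : ℝ) : EReal) * ∑ c, genNormSq Q (Z c) := by
  have hsymm : Q.IsSymm := by
    have := hQ.1
    rwa [Matrix.IsHermitian, Matrix.conjTranspose_eq_transpose_of_trivial] at this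
  have hterm : ∀ L : (κ → ι → ℝ) →L[ℝ] ℝ, ((L Z : ℝ) : EReal) -
      ENNReal.log (laplace (channelLaw κ Q) L) =
      ((L Z - channelForm Q (fun c s => L (Pi.single c (Pi.single s 1))) / 2 : ℝ) : EReal) := by
    intro L
    rw [laplace_channelLaw hQ, ENNReal.log_ofReal_of_pos (Real.exp_pos _), Real.log_exp,
      EReal.coe_sub]
  have hsurj : ∀ l : κ → ι → ℝ, ∃ L : (κ → ι → ℝ) →L[ℝ] ℝ, (L Z = ∑ c, l c ⬝ᵥ Z c) ∧
      (fun c s => L (Pi.single c (Pi.single s 1))) = l := by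
    intro l
    obtain ⟨L, hL⟩ := exists_clm_eq_sum_dotProduct l
    refine ⟨L, hL Z, ?_⟩
    ext c s
    rw [hL, Finset.sum_eq_single c]
    · simp
    · intro c' _ hc
      simp [hc]
    · simp
  simp_rw [cramerRate, hterm]
  by_cases h : ∀ c, ∃ V, Z c = Q *ᵥ V
  · choose V hV using h
    have hsum : ((1 / 2 : ℝ) : EReal) * ∑ c, genNormSq Q (Z c) =
        ((channelForm Q V / 2 : ℝ) : EReal) := by
      have : ∀ c, genNormSq Q (Z c) = ((V c ⬝ᵥ (Q *ᵥ V c) : ℝ) : EReal) := fun c => by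
        rw [hV c, genNormSq_mulVec hsymm]
      simp_rw [this]
      rw [← EReal.coe_finsetSum_real, ← EReal.coe_mul, channelForm]
      congr 1
      ring
    rw [hsum]
    apply le_antisymm
    · refine iSup_le fun L => EReal.coe_le_coe_iff.2 ?_
      rw [clm_apply_eq_sum_dotProduct, channelForm, channelForm, Finset.sum_div, Finset.sum_div,
        ← Finset.sum_sub_distrib]
      refine Finset.sum_le_sum fun c _ => ?_
      set l : ι → ℝ := fun s => L (Pi.single c (Pi.single s 1))
      have h1 : 0 ≤ (l - V c) ⬝ᵥ (Q *ᵥ (l - V c)) := by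
        simpa using hQ.dotProduct_mulVec_nonneg (l - V c)
      have h2 : V c ⬝ᵥ (Q *ᵥ l) = l ⬝ᵥ (Q *ᵥ V c) := by
        rw [Matrix.dotProduct_mulVec, ← Matrix.mulVec_transpose, hsymm.eq, dotProduct_comm]
      rw [Matrix.mulVec_sub, dotProduct_sub, sub_dotProduct, sub_dotProduct, h2] at h1
      rw [hV c]
      linarith
    · obtain ⟨L, hLZ, hL⟩ := hsurj V
      refine le_trans (le_of_eq ?_) (le_iSup _ L)
      rw [hL, hLZ, channelForm]
      congr 1
      simp_rw [hV]
      ring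
  · push Not at h
    obtain ⟨c, hc⟩ := h
    have hc' : ¬∃ V, Z c = Q *ᵥ V := fun ⟨V, hV⟩ => hc V hV
    rw [sum_genNormSq_eq_top hQ hc', EReal.coe_mul_top_of_pos (by norm_num)]
    obtain ⟨w, hw, hwZ⟩ := exists_dotProduct_ne_zero hc'
    rw [EReal.eq_top_iff_forall_lt]
    intro b
    -- Scaled so that the linear term is `b + 1`; the quadratic term vanishes because `w · Q w = 0`.
    obtain ⟨L, hLZ, hL⟩ := hsurj (Pi.single c (((b + 1) / (w ⬝ᵥ Z c)) • w))
    refine lt_of_lt_of_le ?_ (le_iSup _ L)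
    rw [EReal.coe_lt_coe_iff, hL, hLZ, channelForm, Finset.sum_eq_single c, Finset.sum_eq_single c]
    · rw [Pi.single_eq_same, Matrix.mulVec_smul, dotProduct_smul, smul_dotProduct, smul_dotProduct,
        hw]
      simp [hwZ]
    · intro c' _ hne
      simp [hne]
    · simp
    · intro c' _ hne
      simp [hne]
    · simp

/-- The law of the mean of `n` independent Gaussian vectors with independent channels of
covariance `Q`. -/
def gaussianMeanKernel (ι κ : Type*) [Fintype ι] [DecidableEq ι] [Fintype κ] (n : ℕ) :
    Kernel {Q : Matrix ι ι ℝ // Q.PosSemidef} (κ → ι → ℝ) :=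
  noiseKernel (iidLaw (Measure.pi fun _ : κ => stdGaussian (EuclideanSpace ℝ ι)))
    (noiseMean channelSample n)

instance isMarkovKernel_gaussianMeanKernel (n : ℕ) :
    IsMarkovKernel (gaussianMeanKernel ι κ n) :=
  isMarkovKernel_noiseKernel (measurable_noiseMean continuous_channelSample.measurable n)

/-- Both laws are centred Gaussian with covariance `Q / n` in each channel. This presents the
scaling by `n^{-1/2}` as an empirical mean, so that Cramér's theorem also covers the output. -/
theorem gaussianMeanKernel_apply {n : ℕ} (hn : n ≠ 0)
    (Q : {Q : Matrix ι ι ℝ // Q.PosSemidef}) :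
    gaussianMeanKernel ι κ n Q = (channelLaw κ Q.1).map fun z => (1 / √(n : ℝ)) • z := by
  have hQ : Measurable (channelSample (κ := κ) Q) :=
    continuous_channelSample.measurable.of_uncurry_left
  have hsum : Measurable fun ξ : ℕ → κ → EuclideanSpace ℝ ι =>
      ∑ i ∈ Finset.range n, channelSample Q (ξ i) :=
    Finset.measurable_sum _ fun i _ => hQ.comp (measurable_pi_apply i)
  have h : gaussianMeanKernel ι κ n Q =
      (convPow (channelLaw κ Q.1) n).map ((n : ℝ)⁻¹ • ContinuousLinearMap.id ℝ (κ → ι → ℝ)) := by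
    rw [gaussianMeanKernel,
      noiseKernel_apply (measurable_noiseMean continuous_channelSample.measurable n),
      ← map_channelSample, ← map_sum_iidLaw _ hQ,
      Measure.map_map (ContinuousLinearMap.measurable _) hsum]
    rfl
  have h' : (fun z : κ → ι → ℝ => (1 / √(n : ℝ)) • z) =
      ⇑((1 / √(n : ℝ)) • ContinuousLinearMap.id ℝ (κ → ι → ℝ)) := rfl
  rw [h, h']
  have : IsProbabilityMeasure ((channelLaw κ Q.1).map
      ⇑((1 / √(n : ℝ)) • ContinuousLinearMap.id ℝ (κ → ι → ℝ))) :=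
    Measure.isProbabilityMeasure_map (ContinuousLinearMap.measurable _).aemeasurable
  apply Measure.ext_of_charFunDual
  ext L
  have hL : ∀ a : ℝ, (fun c s => (L.comp (a • ContinuousLinearMap.id ℝ (κ → ι → ℝ)))
      (Pi.single c (Pi.single s 1))) = fun c s => a * L (Pi.single c (Pi.single s 1)) := by
    intro a
    ext c s
    simp
  rw [charFunDual_map, charFunDual_map, charFunDual_convPow, charFunDual_channelLaw Q.2,
    charFunDual_channelLaw Q.2, hL, hL, channelForm_smul, channelForm_smul, ← Complex.exp_nat_mul]
  congr 1
  rw [← Complex.ofReal_natCast, ← Complex.ofReal_neg, ← Complex.ofReal_mul, ← Complex.ofReal_neg]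
  congr 1
  have hn' : (0 : ℝ) < n := by exact_mod_cast Nat.pos_of_ne_zero hn
  rw [div_pow, Real.sq_sqrt hn'.le]
  field_simp

theorem kernelLDP_gaussianMeanKernel :
    KernelLDP (gaussianMeanKernel ι κ)
      (fun Q Z => ((1 / 2 : ℝ) : EReal) * ∑ c, genNormSq Q.1 (Z c)) := by
  have h := (noiseControl_channelSample (ι := ι) (κ := κ)).kernelLDP (α := 1) (m := fun n => n)
    one_pos (tendsto_const_nhds.congr' (by
      filter_upwards [eventually_ne_atTop 0] with n hn
      exact (div_self (Nat.cast_ne_zero.2 hn)).symm))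
  simp_rw [map_channelSample, cramerRate_channelLaw (Subtype.property _), EReal.coe_one,
    one_mul] at h
  exact h

end GaussianMean

/-! ### Conditioning on some of the coordinates of a product measure -/

section Glue

variable {ι : Type*} [Fintype ι] {X : ι → Type*} [∀ i, MeasurableSpace (X i)]
  (μ : ∀ i, Measure (X i)) [∀ i, IsProbabilityMeasure (μ i)]

theorem map_pi_of_injective {κ : Type*} [Fintype κ] (f : κ → ι) (hf : f.Injective) :
    (Measure.pi μ).map (fun u k => u (f k)) = Measure.pi fun k => μ (f k) := by
  have h := Measure.map_infinitePi_infinitePi_of_inj (P := μ) hf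
  rwa [Measure.infinitePi_eq_pi, Measure.infinitePi_eq_pi] at h

theorem measurable_glue (p : ι → Prop) [DecidablePred p] :
    Measurable fun q : (∀ i, X i) × (∀ i, X i) => fun i => if p i then q.1 i else q.2 i := by
  refine measurable_pi_lambda _ fun i => ?_
  split_ifs <;> fun_prop

/-- Resampling the coordinates outside `p` independently is conditioning without conditional
expectations: Fubini then fixes the coordinates in `p`. -/
theorem map_prod_pi_glue (p : ι → Prop) [DecidablePred p] :
    ((Measure.pi μ).prod (Measure.pi μ)).map
      (fun q : (∀ i, X i) × (∀ i, X i) => fun i => if p i then q.1 i else q.2 i) =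
      Measure.pi μ := by
  refine (Measure.pi_eq fun s hs => ?_).symm
  rw [Measure.map_apply (measurable_glue p) (MeasurableSet.univ_pi hs)]
  have h : (fun q : (∀ i, X i) × (∀ i, X i) => fun i => if p i then q.1 i else q.2 i) ⁻¹'
      Set.univ.pi s =
      (Set.univ.pi fun i => if p i then s i else Set.univ) ×ˢ
        (Set.univ.pi fun i => if p i then Set.univ else s i) := by
    ext q
    simp only [Set.mem_preimage, Set.mem_univ_pi, Set.mem_prod, ← forall_and]
    refine forall_congr' fun i => ?_
    by_cases hi : p i <;> simp [hi]
  rw [h, Measure.prod_prod, Measure.pi_pi, Measure.pi_pi, ← Finset.prod_mul_distrib]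
  refine Finset.prod_congr rfl fun i _ => ?_
  by_cases hi : p i <;> simp [hi]

/-- If `f` depends only on the coordinates in `p`, and `g` has law `κ (f u)` once these coordinates
are fixed, then the joint law of `f` and `g` is `(law of f) ⊗ₘ κ`. -/
theorem map_pi_prodMk_eq_compProd {𝕐 𝕏 : Type*} [MeasurableSpace 𝕐] [MeasurableSpace 𝕏]
    (p : ι → Prop) [DecidablePred p] {f : (∀ i, X i) → 𝕐} {g : (∀ i, X i) → 𝕏} {κ : Kernel 𝕐 𝕏}
    [IsMarkovKernel κ] (hf : Measurable f) (hg : Measurable g)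
    (hfp : ∀ u u' : ∀ i, X i, f (fun i => if p i then u i else u' i) = f u)
    (hgp : ∀ u : ∀ i, X i,
      (Measure.pi μ).map (fun u' => g fun i => if p i then u i else u' i) = κ (f u)) :
    (Measure.pi μ).map (fun u => (f u, g u)) = (Measure.pi μ).map f ⊗ₘ κ := by
  have := Measure.isProbabilityMeasure_map (μ := Measure.pi μ) hf.aemeasurable
  ext S hS
  have hG := measurable_glue (X := X) p
  rw [Measure.compProd_apply hS, lintegral_map (Kernel.measurable_kernel_prodMk_left hS) hf]
  conv_lhs => rw [← map_prod_pi_glue μ p]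
  rw [Measure.map_map (hf.prodMk hg) hG,
    Measure.map_apply ((hf.prodMk hg).comp hG) hS,
    Measure.prod_apply (((hf.prodMk hg).comp hG) hS)]
  refine lintegral_congr fun u => ?_
  have hgu : Measurable fun u' : ∀ i, X i => g fun i => if p i then u i else u' i :=
    hg.comp (hG.comp measurable_prodMk_left)
  rw [← hgp, Measure.map_apply hgu (measurable_prodMk_left hS)]
  congr 1
  ext u'
  simp [hfp]

end Glue

namespace ConvNet

variable (net : ConvNet)

/-! ### Layers as linear combinations of weights -/

theorem width_eq {n ℓ : ℕ} (hℓ : ℓ + 1 ≤ net.L) : net.width n (ℓ + 1) = net.C n (ℓ + 1) := by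
  have h : ℓ ≠ net.L := by omega
  simp [width, h]

theorem width_output (n : ℕ) : net.width n (net.L + 1) = net.Cout := by
  simp [width]

/-- The coefficients of the weights between layers `ℓ` and `ℓ + 1` in the pre-activations of
layer `ℓ + 1`. -/
def feature (n : ℕ) (w : net.Weights) :
    (ℓ : ℕ) → net.mask ℓ × Fin (net.width n ℓ) → net.Site (ℓ + 1) → ℝ
  | 0, b, s => 1 / √((net.maskCard 0 : ℝ) * net.Cin) * net.R 0 s.1 (net.x s.2 b.2) b.1
  | ℓ + 1, b, s => 1 / √((net.maskCard (ℓ + 1) : ℝ) * net.C n (ℓ + 1)) *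
      net.σ (net.R (ℓ + 1) s.1 (net.preAct n w (net.x s.2) ℓ b.2) b.1)

theorem layer_apply (n : ℕ) (w : net.Weights) {ℓ : ℕ} (hℓ : ℓ ≤ net.L) (c : ℕ)
    (s : net.Site (ℓ + 1)) :
    net.layer n w ℓ c s = ∑ b, w ℓ b.1 b.2 c * net.feature n w ℓ b s := by
  rw [Fintype.sum_prod_type_right]
  cases ℓ with
  | zero =>
    change 1 / √((net.maskCard 0 : ℝ) * net.Cin) * ∑ c' : Fin net.Cin, ∑ m : net.mask 0,
      w 0 m c' c * net.R 0 s.1 (net.x s.2 c') m = ∑ c' : Fin net.Cin, ∑ m : net.mask 0, _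
    rw [Finset.mul_sum]
    refine Finset.sum_congr rfl fun c' _ => ?_
    rw [Finset.mul_sum]
    refine Finset.sum_congr rfl fun m _ => ?_
    simp only [feature]
    ring
  | succ ℓ =>
    change 1 / √((net.maskCard (ℓ + 1) : ℝ) * net.C n (ℓ + 1)) *
      ∑ c' ∈ Finset.range (net.C n (ℓ + 1)), ∑ m : net.mask (ℓ + 1),
        w (ℓ + 1) m c' c * net.σ (net.R (ℓ + 1) s.1 (net.preAct n w (net.x s.2) ℓ c') m) = _
    rw [← net.width_eq (n := n) hℓ, Finset.sum_range, Finset.mul_sum]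
    refine Finset.sum_congr rfl fun c' _ => ?_
    rw [Finset.mul_sum]
    refine Finset.sum_congr rfl fun m _ => ?_
    simp only [feature, net.width_eq (n := n) hℓ]
    ring

/-- In this Gram form `covMatrix` is visibly the covariance of the layer once the features are
frozen, in the shape required by `map_pi_gaussianReal_eq_pi_multivariateGaussian`. -/
theorem covMatrix_apply (n : ℕ) (w : net.Weights) {ℓ : ℕ} (hℓ : ℓ ≤ net.L)
    (s t : net.Site (ℓ + 1)) :
    net.covMatrix n w ℓ s t =
      (net.lam ℓ)⁻¹ * ∑ b, net.feature n w ℓ b s * net.feature n w ℓ b t := by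
  have key : ∀ {M C a b : ℝ}, 0 ≤ M → 0 ≤ C →
      (1 / √(M * C) * a) * (1 / √(M * C) * b) = 1 / (M * C) * (a * b) := by
    intro M C a b hM hC
    have h : 1 / √(M * C) * (1 / √(M * C)) = 1 / (M * C) := by
      rw [div_mul_div_comm, Real.mul_self_sqrt (mul_nonneg hM hC), one_mul]
    rw [← h]
    ring
  rw [Fintype.sum_prod_type_right]
  cases ℓ with
  | zero =>
    change 1 / (net.lam 0 * net.Cin * net.maskCard 0) * ∑ c : Fin net.Cin, ∑ m : net.mask 0,
      net.R 0 s.1 (net.x s.2 c) m * net.R 0 t.1 (net.x t.2 c) m =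
      (net.lam 0)⁻¹ * ∑ c : Fin net.Cin, ∑ m : net.mask 0, _
    rw [Finset.mul_sum, Finset.mul_sum]
    refine Finset.sum_congr rfl fun c' _ => ?_
    rw [Finset.mul_sum, Finset.mul_sum]
    refine Finset.sum_congr rfl fun m _ => ?_
    simp only [feature]
    rw [key (Nat.cast_nonneg _) (Nat.cast_nonneg _)]
    simp only [one_div, mul_inv]
    ring
  | succ ℓ =>
    change ((1 / (net.C n (ℓ + 1) : ℝ)) • ∑ c ∈ Finset.range (net.C n (ℓ + 1)),
      net.G (ℓ + 1) (net.layer n w ℓ c)) s t = _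
    rw [Matrix.smul_apply, Matrix.sum_apply, smul_eq_mul]
    conv_lhs => rw [← net.width_eq (n := n) hℓ, Finset.sum_range, Finset.mul_sum]
    rw [Finset.mul_sum]
    refine Finset.sum_congr rfl fun c' _ => ?_
    change _ * (1 / (net.lam (ℓ + 1) * net.maskCard (ℓ + 1)) * ∑ m : net.mask (ℓ + 1),
      net.σ (net.R (ℓ + 1) s.1 (net.preAct n w (net.x s.2) ℓ c') m) *
      net.σ (net.R (ℓ + 1) t.1 (net.preAct n w (net.x t.2) ℓ c') m)) = _
    rw [Finset.mul_sum, Finset.mul_sum, Finset.mul_sum]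
    refine Finset.sum_congr rfl fun m _ => ?_
    simp only [feature]
    rw [key (Nat.cast_nonneg _) (Nat.cast_nonneg _)]
    simp only [net.width_eq (n := n) hℓ, one_div, mul_inv]
    ring

/-- The weights of layers `0, …, ℓ - 1` of the network of index `n` agree. -/
def AgreeBelow (n ℓ : ℕ) (w w' : net.Weights) : Prop :=
  ∀ j < ℓ, ∀ m, ∀ c' < net.width n j, ∀ c < net.width n (j + 1), w j m c' c = w' j m c' c

variable {net}

theorem AgreeBelow.mono {n ℓ ℓ' : ℕ} {w w' : net.Weights} (h : net.AgreeBelow n ℓ w w')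
    (hℓ : ℓ' ≤ ℓ) : net.AgreeBelow n ℓ' w w' :=
  fun j hj => h j (hj.trans_le hℓ)

theorem AgreeBelow.preAct_eq {n : ℕ} {w w' : net.Weights}
    (x : Fin net.Cin → EuclideanSpace ℝ (Fin (net.N 0))) :
    ∀ {ℓ : ℕ}, ℓ ≤ net.L → net.AgreeBelow n (ℓ + 1) w w' → ∀ {c : ℕ}, c < net.width n (ℓ + 1) →
      net.preAct n w x ℓ c = net.preAct n w' x ℓ c
  | 0, _, h, c, hc => by
    ext i
    change _ * ∑ c' : Fin net.Cin, ∑ m : net.mask 0, _ =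
      _ * ∑ c' : Fin net.Cin, ∑ m : net.mask 0, _
    congr 1
    refine Finset.sum_congr rfl fun c' _ => Finset.sum_congr rfl fun m _ => ?_
    rw [h 0 zero_lt_one m c' c'.2 c hc]
  | ℓ + 1, hℓ, h, c, hc => by
    ext i
    change _ * ∑ c' ∈ Finset.range (net.C n (ℓ + 1)), ∑ m : net.mask (ℓ + 1), _ =
      _ * ∑ c' ∈ Finset.range (net.C n (ℓ + 1)), ∑ m : net.mask (ℓ + 1), _
    congr 1
    refine Finset.sum_congr rfl fun c' hc' => Finset.sum_congr rfl fun m _ => ?_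
    rw [Finset.mem_range, ← net.width_eq hℓ] at hc'
    rw [h (ℓ + 1) (lt_add_one _) m c' hc' c hc,
      (h.mono (Nat.le_succ _)).preAct_eq x (Nat.le_of_succ_le hℓ) hc']

theorem AgreeBelow.feature_eq {n : ℕ} {w w' : net.Weights} {ℓ : ℕ} (hℓ : ℓ ≤ net.L)
    (h : net.AgreeBelow n ℓ w w') : net.feature n w ℓ = net.feature n w' ℓ := by
  ext b s
  cases ℓ with
  | zero => rfl
  | succ ℓ =>
    rw [feature, feature, h.preAct_eq _ (Nat.le_of_succ_le hℓ) b.2.2]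

theorem AgreeBelow.covMatrix_eq {n : ℕ} {w w' : net.Weights} {ℓ : ℕ} (hℓ : ℓ ≤ net.L)
    (h : net.AgreeBelow n ℓ w w') : net.covMatrix n w ℓ = net.covMatrix n w' ℓ := by
  ext s t
  rw [net.covMatrix_apply n w hℓ, net.covMatrix_apply n w' hℓ, h.feature_eq hℓ]

theorem AgreeBelow.rescaledOutput_eq {n : ℕ} {w w' : net.Weights}
    (h : net.AgreeBelow n (net.L + 1) w w') :
    net.rescaledOutput n w = net.rescaledOutput n w' := by
  ext c s
  have hc : (c : ℕ) < net.width n (net.L + 1) := by rw [width_output]; exact c.2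
  simp only [rescaledOutput, layer]
  rw [h.preAct_eq _ le_rfl hc]

end ConvNet

namespace ConvNet

variable (net : ConvNet)

/-! ### The joint law of the covariance matrices and of the output -/

/-- The law of the weights of the network of index `n`. -/
def weightLaw (n : ℕ) : Measure (net.WeightIndex n → ℝ) :=
  Measure.pi fun k => gaussianReal 0 (net.lam k.1)⁻¹.toNNReal

instance isProbabilityMeasure_weightLaw (n : ℕ) : IsProbabilityMeasure (net.weightLaw n) := by
  unfold weightLaw
  infer_instance

/-- The extension by `0` of the weights of the network of index `n`. -/
def extendWeights (n : ℕ) (u : net.WeightIndex n → ℝ) : net.Weights := fun ℓ m c' c =>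
  if h : ℓ < net.L + 1 ∧ c' < net.width n ℓ ∧ c < net.width n (ℓ + 1) then
    u ⟨⟨ℓ, h.1⟩, m, ⟨c', h.2.1⟩, ⟨c, h.2.2⟩⟩
  else 0

theorem extendWeights_apply {n ℓ : ℕ} (u : net.WeightIndex n → ℝ) (hℓ : ℓ < net.L + 1)
    (m : net.mask ℓ) (c' : Fin (net.width n ℓ)) (c : Fin (net.width n (ℓ + 1))) :
    net.extendWeights n u ℓ m c' c = u ⟨⟨ℓ, hℓ⟩, m, c', c⟩ :=
  dif_pos ⟨hℓ, c'.2, c.2⟩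

theorem measurable_extendWeights (n : ℕ) : Measurable (net.extendWeights n) := by
  refine measurable_pi_lambda _ fun ℓ => measurable_pi_lambda _ fun m =>
    measurable_pi_lambda _ fun c' => measurable_pi_lambda _ fun c => ?_
  unfold extendWeights
  split_ifs <;> fun_prop

/-- The weights `u` in layers `0, …, ℓ - 1` and `u'` in the next layers. -/
def glueWeights (n ℓ : ℕ) (u u' : net.WeightIndex n → ℝ) : net.WeightIndex n → ℝ :=
  fun k => if (k.1 : ℕ) < ℓ then u k else u' k

theorem agreeBelow_glueWeights (n ℓ : ℕ) (u u' : net.WeightIndex n → ℝ) :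
    net.AgreeBelow n ℓ (net.extendWeights n (net.glueWeights n ℓ u u')) (net.extendWeights n u) := by
  intro j hj m c' hc' c hc
  unfold extendWeights
  split_ifs with h
  · exact if_pos hj
  · rfl

/-- `K^{(ℓ+1,n)}` as an element of the space of positive semidefinite matrices. -/
def cov (n : ℕ) (w : net.Weights) (ℓ : ℕ) : net.Cov (ℓ + 1) :=
  ⟨net.covMatrix n w ℓ, net.posSemidef_covMatrix n w ℓ⟩

/-- The features depend only on the weights `u` below layer `ℓ`, while the weights of layer `ℓ` come
from `u'`. The number of channels is a separate variable `k`, so that both `C n (ℓ + 1)` and `Cout`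
can be substituted for the width. -/
theorem map_layer_glueWeights (n : ℕ) {ℓ k : ℕ} (hℓ : ℓ < net.L + 1)
    (hk : k = net.width n (ℓ + 1)) (u : net.WeightIndex n → ℝ) :
    (net.weightLaw n).map (fun u' (c : Fin k) =>
      net.layer n (net.extendWeights n (net.glueWeights n ℓ u u')) ℓ c) =
      Measure.pi fun _ : Fin k =>
        multivariateGaussian 0 (net.cov n (net.extendWeights n u) ℓ).1 := by
  classical
  subst hk
  have hℓ' : ℓ ≤ net.L := Nat.lt_succ_iff.1 hℓ
  set a := net.feature n (net.extendWeights n u) ℓ with ha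
  let f : (net.mask ℓ × Fin (net.width n ℓ)) × Fin (net.width n (ℓ + 1)) → net.WeightIndex n :=
    fun p => ⟨⟨ℓ, hℓ⟩, p.1.1, p.1.2, p.2⟩
  have hf : f.Injective := by
    rintro ⟨⟨m, c'⟩, c⟩ ⟨⟨m', d'⟩, d⟩ h
    simpa [f, and_assoc] using h
  have hlayer : (fun u' (c : Fin (net.width n (ℓ + 1))) =>
      net.layer n (net.extendWeights n (net.glueWeights n ℓ u u')) ℓ c) =
      (fun (v : _ → ℝ) c => WithLp.toLp 2 fun s => ∑ b, v (b, c) * a b s) ∘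
        fun u' p => u' (f p) := by
    ext u' c s
    rw [net.layer_apply n _ hℓ', (net.agreeBelow_glueWeights n ℓ u u').feature_eq hℓ', ← ha]
    change _ = ∑ b, u' (f (b, c)) * a b s
    refine Finset.sum_congr rfl fun b _ => ?_
    rw [net.extendWeights_apply _ hℓ]
    congr 1
    exact if_neg (lt_irrefl ℓ)
  have hmarg := map_pi_of_injective
    (fun k : net.WeightIndex n => gaussianReal 0 (net.lam k.1)⁻¹.toNNReal) f hf
  rw [hlayer, ← Measure.map_map _ (by fun_prop), weightLaw, hmarg]
  · refine map_pi_gaussianReal_eq_pi_multivariateGaussian a (net.lam ℓ)⁻¹.toNNReal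
      (net.cov n _ ℓ).2 fun s t => ?_
    rw [Real.coe_toNNReal _ (inv_nonneg.2 (net.lam_pos ℓ).le)]
    exact net.covMatrix_apply n _ hℓ' s t
  · refine measurable_pi_lambda _ fun c => (WithLp.measurable_toLp 2 _).comp ?_
    fun_prop

/-- The mean of the matrices `G^{(ℓ)}(z c)`. -/
def meanG (ℓ : ℕ) {k : ℕ} (z : Fin k → EuclideanSpace ℝ (net.Site ℓ)) : net.Cov (ℓ + 1) :=
  ⟨(1 / (k : ℝ)) • ∑ c, net.G ℓ (z c),
    (Matrix.posSemidef_sum _ fun c _ => net.posSemidef_G ℓ (z c)).smul (by positivity)⟩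

theorem cov_succ (n : ℕ) (w : net.Weights) (ℓ : ℕ) :
    net.cov n w (ℓ + 1) =
      net.meanG (ℓ + 1) fun c : Fin (net.C n (ℓ + 1)) => net.layer n w ℓ c := by
  apply Subtype.ext
  change (1 / (net.C n (ℓ + 1) : ℝ)) • ∑ c ∈ Finset.range (net.C n (ℓ + 1)), _ = _
  rw [Finset.sum_range]
  rfl

variable {net}

theorem AsymptoticLipschitz.measurable_meanG (hLip : net.AsymptoticLipschitz) {ℓ : ℕ}
    (hℓ : ℓ ∈ Finset.Icc 1 net.L) (k : ℕ) : Measurable (net.meanG ℓ (k := k)) := by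
  refine Continuous.measurable (Continuous.subtype_mk ?_ _)
  have h : Continuous (net.G ℓ) := continuous_subtype_val.comp (hLip.continuous_covG hℓ)
  exact (continuous_finsetSum _ fun c _ => h.comp (continuous_apply c)).const_smul (1 / (k : ℝ))

/-- The kernel is built on an infinite noise sequence so that one noise space serves all `n`; only
the first `C n ℓ` terms enter, and their joint law is a product. -/
theorem AsymptoticLipschitz.hiddenKernel_apply (hLip : net.AsymptoticLipschitz) {ℓ : ℕ}
    (hℓ : ℓ ∈ Finset.Icc 1 net.L) (n : ℕ) (Q : net.Cov ℓ) :
    net.hiddenKernel n ℓ Q =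
      (Measure.pi fun _ : Fin (net.C n ℓ) => multivariateGaussian 0 Q.1).map (net.meanG ℓ) := by
  have h1 := Measure.map_infinitePi_infinitePi_of_inj
    (P := fun _ : ℕ => stdGaussian (EuclideanSpace ℝ (net.Site ℓ)))
    (f := fun c : Fin (net.C n ℓ) => (c : ℕ)) Fin.val_injective
  rw [Measure.infinitePi_eq_pi (ι := Fin (net.C n ℓ))] at h1
  have h2 : net.hiddenMean ℓ (net.C n ℓ) Q = net.meanG ℓ ∘
      (fun (z : Fin (net.C n ℓ) → EuclideanSpace ℝ (net.Site ℓ)) c => sqrtCLM Q (z c)) ∘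
        fun ξ c => ξ c := by
    ext1 ξ
    apply Subtype.ext
    change (1 / (net.C n ℓ : ℝ)) • ∑ c ∈ Finset.range (net.C n ℓ), _ = _
    rw [Finset.sum_range]
    rfl
  have h3 : Measurable fun (z : Fin (net.C n ℓ) → EuclideanSpace ℝ (net.Site ℓ)) c =>
      sqrtCLM Q (z c) := measurable_pi_lambda _ fun c => by fun_prop
  rw [hiddenKernel, noiseKernel_apply (hLip.measurable_hiddenMean hℓ _), h2,
    ← Measure.map_map (hLip.measurable_meanG hℓ _) (h3.comp (by fun_prop)),
    ← Measure.map_map h3 (by fun_prop), h1, multivariateGaussian_eq_map_sqrtCLM,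
    ← Measure.pi_map_pi (fun _ => (sqrtCLM Q).continuous.measurable.aemeasurable)]

theorem AsymptoticLipschitz.measurable_preAct (hLip : net.AsymptoticLipschitz) (n : ℕ)
    (x : Fin net.Cin → EuclideanSpace ℝ (Fin (net.N 0))) :
    ∀ {ℓ : ℕ}, ℓ ≤ net.L → ∀ c, Measurable fun w : net.Weights => net.preAct n w x ℓ c
  | 0, _, c => by
    refine (WithLp.measurable_toLp 2 _).comp (measurable_pi_lambda _ fun i => ?_)
    fun_prop
  | ℓ + 1, hℓ, c => by
    refine (WithLp.measurable_toLp 2 _).comp (measurable_pi_lambda _ fun i => ?_)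
    refine measurable_const.mul (Finset.measurable_sum _ fun c' _ =>
      Finset.measurable_sum _ fun m _ => Measurable.mul (by fun_prop) ?_)
    have h1 := hLip.measurable_preAct n x (Nat.le_of_succ_le hℓ) c'
    have h2 := hLip.continuous_R (ℓ + 1) (Finset.mem_Icc.2 ⟨by omega, hℓ⟩) i
    have h3 := hLip.continuous_σ.comp ((PiLp.continuous_apply 2 _ m).comp h2)
    exact h3.measurable.comp h1

theorem AsymptoticLipschitz.measurable_layer (hLip : net.AsymptoticLipschitz) (n : ℕ) {ℓ : ℕ}
    (hℓ : ℓ ≤ net.L) (c : ℕ) : Measurable fun w : net.Weights => net.layer n w ℓ c := by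
  refine (WithLp.measurable_toLp 2 _).comp (measurable_pi_lambda _ fun s => ?_)
  exact (PiLp.continuous_apply 2 _ s.1).measurable.comp (hLip.measurable_preAct n (net.x s.2) hℓ c)

theorem AsymptoticLipschitz.measurable_cov (hLip : net.AsymptoticLipschitz) (n : ℕ) {ℓ : ℕ}
    (hℓ : ℓ ≤ net.L) : Measurable fun w : net.Weights => net.cov n w ℓ := by
  cases ℓ with
  | zero =>
    exact (measurable_const : Measurable fun _ : net.Weights =>
      (⟨net.K₁, net.posSemidef_K₁⟩ : net.Cov 1))
  | succ ℓ =>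
    simp_rw [cov_succ]
    exact (hLip.measurable_meanG (Finset.mem_Icc.2 ⟨by omega, hℓ⟩) _).comp
      (measurable_pi_lambda _ fun c => hLip.measurable_layer n (Nat.le_of_succ_le hℓ) c)

theorem AsymptoticLipschitz.measurable_rescaledOutput (hLip : net.AsymptoticLipschitz) (n : ℕ) :
    Measurable fun w : net.Weights => net.rescaledOutput n w := by
  refine measurable_pi_lambda _ fun c => measurable_pi_lambda _ fun s => ?_
  exact measurable_const.mul
    ((PiLp.continuous_apply 2 _ s).measurable.comp (hLip.measurable_layer n le_rfl c))

variable (net) in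
/-- The law of `K^{(ℓ+1,n)}`. -/
def covLaw (ℓ n : ℕ) : Measure (net.Cov (ℓ + 1)) :=
  (net.weightLaw n).map fun u => net.cov n (net.extendWeights n u) ℓ

theorem AsymptoticLipschitz.measurable_cov_extendWeights (hLip : net.AsymptoticLipschitz) (n : ℕ)
    {ℓ : ℕ} (hℓ : ℓ ≤ net.L) :
    Measurable fun u : net.WeightIndex n → ℝ => net.cov n (net.extendWeights n u) ℓ :=
  (hLip.measurable_cov n hℓ).comp (net.measurable_extendWeights n)

theorem AsymptoticLipschitz.isProbabilityMeasure_covLaw (hLip : net.AsymptoticLipschitz) {ℓ : ℕ}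
    (hℓ : ℓ ≤ net.L) (n : ℕ) : IsProbabilityMeasure (net.covLaw ℓ n) :=
  Measure.isProbabilityMeasure_map (hLip.measurable_cov_extendWeights n hℓ).aemeasurable

theorem covLaw_zero (n : ℕ) : net.covLaw 0 n = Measure.dirac ⟨net.K₁, net.posSemidef_K₁⟩ := by
  have h : (fun u : net.WeightIndex n → ℝ => net.cov n (net.extendWeights n u) 0) =
      fun _ => ⟨net.K₁, net.posSemidef_K₁⟩ := rfl
  rw [covLaw, h, Measure.map_const, measure_univ, one_smul]

theorem cov_glueWeights {n ℓ : ℕ} (hℓ : ℓ ≤ net.L) (u u' : net.WeightIndex n → ℝ) :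
    net.cov n (net.extendWeights n (net.glueWeights n ℓ u u')) ℓ =
      net.cov n (net.extendWeights n u) ℓ :=
  Subtype.ext ((net.agreeBelow_glueWeights n ℓ u u').covMatrix_eq hℓ)

theorem measurable_glueWeights (n ℓ : ℕ) (u : net.WeightIndex n → ℝ) :
    Measurable (net.glueWeights n ℓ u) := by
  refine measurable_pi_lambda _ fun k => ?_
  unfold glueWeights
  split_ifs <;> fun_prop

theorem AsymptoticLipschitz.measurable_layers (hLip : net.AsymptoticLipschitz) (n : ℕ) {ℓ : ℕ}
    (hℓ : ℓ ≤ net.L) (k : ℕ) (u : net.WeightIndex n → ℝ) :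
    Measurable fun u' (c : Fin k) =>
      net.layer n (net.extendWeights n (net.glueWeights n ℓ u u')) ℓ c :=
  measurable_pi_lambda _ fun c => (hLip.measurable_layer n hℓ c).comp
    ((net.measurable_extendWeights n).comp (measurable_glueWeights n ℓ u))

/-- The Markov property: the weights below the layer influence the next matrix only through the
current one. -/
theorem AsymptoticLipschitz.covLaw_succ (hLip : net.AsymptoticLipschitz) {ℓ : ℕ}
    (hℓ : ℓ + 1 ≤ net.L) (n : ℕ) :
    net.covLaw (ℓ + 1) n = (net.covLaw ℓ n ⊗ₘ net.hiddenKernel n (ℓ + 1)).map Prod.snd := by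
  have hmem : ℓ + 1 ∈ Finset.Icc 1 net.L := Finset.mem_Icc.2 ⟨by omega, hℓ⟩
  have hle : ℓ ≤ net.L := Nat.le_of_succ_le hℓ
  have := hLip.isMarkovKernel_hiddenKernel hmem n
  have hf := hLip.measurable_cov_extendWeights n hle
  have hg := hLip.measurable_cov_extendWeights n hℓ
  have h := map_pi_prodMk_eq_compProd
    (fun k : net.WeightIndex n => gaussianReal 0 (net.lam k.1)⁻¹.toNNReal)
    -- The index is shifted: `cov` at `ℓ` is `K^{(ℓ+1,n)}`, which depends on the weights of layers
    -- `0, …, ℓ - 1` only.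
    (fun k => (k.1 : ℕ) < ℓ) (κ := net.hiddenKernel n (ℓ + 1)) hf hg
    (cov_glueWeights hle) fun u => by
      change (net.weightLaw n).map (fun u' =>
        net.cov n (net.extendWeights n (net.glueWeights n ℓ u u')) (ℓ + 1)) = _
      rw [hLip.hiddenKernel_apply hmem,
        ← net.map_layer_glueWeights n (Nat.lt_succ_of_le hle) (net.width_eq hℓ).symm u,
        Measure.map_map (hLip.measurable_meanG hmem _) (hLip.measurable_layers n hle _ u)]
      simp_rw [cov_succ]
      rfl
  have h' : net.covLaw ℓ n ⊗ₘ net.hiddenKernel n (ℓ + 1) = (net.weightLaw n).map fun u =>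
      (net.cov n (net.extendWeights n u) ℓ, net.cov n (net.extendWeights n u) (ℓ + 1)) := h.symm
  rw [h', Measure.map_map measurable_snd (hf.prodMk hg)]
  rfl

theorem AsymptoticLipschitz.map_cov_rescaledOutput (hLip : net.AsymptoticLipschitz) {n : ℕ}
    (hn : n ≠ 0) :
    (net.weightLaw n).map (fun u => (net.cov n (net.extendWeights n u) net.L,
      net.rescaledOutput n (net.extendWeights n u))) =
      net.covLaw net.L n ⊗ₘ gaussianMeanKernel (net.Site (net.L + 1)) (Fin net.Cout) n := by
  refine map_pi_prodMk_eq_compProd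
    (fun k : net.WeightIndex n => gaussianReal 0 (net.lam k.1)⁻¹.toNNReal)
    (fun k => (k.1 : ℕ) < net.L) (hLip.measurable_cov_extendWeights n le_rfl)
    ((hLip.measurable_rescaledOutput n).comp (net.measurable_extendWeights n))
    (cov_glueWeights le_rfl) fun u => ?_
  change (net.weightLaw n).map (fun u' =>
    net.rescaledOutput n (net.extendWeights n (net.glueWeights n net.L u u'))) = _
  rw [gaussianMeanKernel_apply hn, channelLaw,
    ← net.map_layer_glueWeights n (lt_add_one _) (net.width_output n).symm u,
    Measure.map_map continuous_ofLp_channels.measurable (hLip.measurable_layers n le_rfl _ u),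
    Measure.map_map (by fun_prop) (continuous_ofLp_channels.measurable.comp
      (hLip.measurable_layers n le_rfl _ u))]
  rfl

/-! ### The law of the weights under the prior -/

theorem GaussianPrior.map_eq_weightLaw {Ω : Type*} [MeasurableSpace Ω] {Pr : Measure Ω}
    [IsProbabilityMeasure Pr] {W : ℕ → Ω → net.Weights} (hW : net.GaussianPrior Pr W) (n : ℕ) :
    AEMeasurable (fun ω (k : net.WeightIndex n) => W n ω k.1 k.2.1 k.2.2.1 k.2.2.2) Pr ∧
    Pr.map (fun ω (k : net.WeightIndex n) => W n ω k.1 k.2.1 k.2.2.1 k.2.2.2) =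
      net.weightLaw n := by
  obtain ⟨h1, h2⟩ := hW n
  refine ⟨aemeasurable_pi_lambda _ fun k => (h1 k).aemeasurable, ?_⟩
  rw [(iIndepFun_iff_map_fun_eq_pi_map fun k => (h1 k).aemeasurable).1 h2, weightLaw]
  congr 1
  ext1 k
  exact (h1 k).map_eq

theorem agreeBelow_extendWeights (n : ℕ) (w : net.Weights) :
    net.AgreeBelow n (net.L + 1)
      (net.extendWeights n fun k => w k.1 k.2.1 k.2.2.1 k.2.2.2) w :=
  fun _ hj _ _ hc' _ hc => dif_pos ⟨hj, hc', hc⟩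

/-- The prior prescribes the law of the weights of the network only. The others may be replaced by
`0`, since the outputs do not depend on them. -/
theorem GaussianPrior.measure_setOf_mem {Ω : Type*} [MeasurableSpace Ω] {Pr : Measure Ω}
    [IsProbabilityMeasure Pr] {W : ℕ → Ω → net.Weights} (hW : net.GaussianPrior Pr W)
    (hLip : net.AsymptoticLipschitz) (n : ℕ) {S : Set (net.Output × net.Cov (net.L + 1))}
    (hS : MeasurableSet S) :
    Pr {ω | (net.rescaledOutput n (W n ω), net.outputCov n (W n ω)) ∈ S} =
      ((net.weightLaw n).map fun u => (net.rescaledOutput n (net.extendWeights n u),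
        net.cov n (net.extendWeights n u) net.L)) S := by
  obtain ⟨hmeas, hmap⟩ := hW.map_eq_weightLaw n
  have hF : Measurable fun u : net.WeightIndex n → ℝ =>
      (net.rescaledOutput n (net.extendWeights n u),
        net.cov n (net.extendWeights n u) net.L) :=
    ((hLip.measurable_rescaledOutput n).comp (net.measurable_extendWeights n)).prodMk
      (hLip.measurable_cov_extendWeights n le_rfl)
  rw [Measure.map_apply hF hS, ← hmap, Measure.map_apply_of_aemeasurable hmeas (hF hS)]
  congr 1
  ext ω
  have h := net.agreeBelow_extendWeights n (W n ω)
  have h1 : net.cov n (net.extendWeights n fun k => W n ω k.1 k.2.1 k.2.2.1 k.2.2.2) net.L =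
      net.outputCov n (W n ω) := Subtype.ext ((h.mono (Nat.le_succ _)).covMatrix_eq le_rfl)
  change _ ↔ (net.rescaledOutput n (net.extendWeights n fun k => W n ω k.1 k.2.1 k.2.2.1 k.2.2.2),
    net.cov n (net.extendWeights n fun k => W n ω k.1 k.2.1 k.2.2.1 k.2.2.2) net.L) ∈ S
  rw [h1, h.rescaledOutput_eq]
  rfl

end ConvNet

/-! ### The deterministic first layer -/

instance secondCountableTopology_posSemidef {ι : Type*} [Fintype ι] :
    SecondCountableTopology {Q : Matrix ι ι ℝ // Q.PosSemidef} :=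
  IsInducing.subtypeVal.secondCountableTopology

theorem GoodLDP.dirac {𝕏 : Type*} [TopologicalSpace 𝕏] [T1Space 𝕏] [MeasurableSpace 𝕏]
    [OpensMeasurableSpace 𝕏] (a : 𝕏) [DecidablePred (· = a)] :
    GoodLDP (fun _ => Measure.dirac a) (fun x => if x = a then 0 else ⊤) where
  lower x V hV hxV M hM := by
    split_ifs at hM with h
    · subst h
      have hM' : 0 < M := by exact_mod_cast hM
      refine Eventually.of_forall fun n => ?_
      rw [Measure.dirac_apply' _ hV.measurableSet, Set.indicator_of_mem hxV, Pi.one_apply, expBound]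
      refine ENNReal.ofReal_le_one.2 (Real.exp_le_one_iff.2 ?_)
      have : 0 ≤ (n : ℝ) * M := by positivity
      linarith
    · exact absurd hM (not_lt.2 le_top)
  upper x M hM := by
    split_ifs at hM with h
    · have hM' : M < 0 := by exact_mod_cast hM
      refine ⟨Set.univ, isOpen_univ, trivial, Eventually.of_forall fun n => ?_⟩
      rw [measure_univ]
      exact one_le_expBound hM'.le n
    · refine ⟨{a}ᶜ, isOpen_compl_singleton, h, Eventually.of_forall fun n => ?_⟩
      rw [Measure.dirac_apply' _ isOpen_compl_singleton.measurableSet]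
      simp
  tight M := by
    refine ⟨{a}, isCompact_singleton, Eventually.of_forall fun n => ?_⟩
    rw [Measure.dirac_apply' _ isOpen_compl_singleton.measurableSet]
    simp

namespace ConvNet

variable {net : ConvNet}

/-! ### The rate function of the covariance matrices -/

/-- The cost `∑_{k ≤ ℓ} α_k I_k(q_{k+1} | q_k)` of a sequence of covariance matrices. -/
def pathCost (α : ℕ → ℝ) (ℓ : ℕ) (q : ∀ k, net.Cov k) : EReal :=
  ∑ k ∈ Finset.Icc 1 ℓ, (α k : EReal) * net.layerRate k (q (k + 1)).1 (q k).1

/-- The least cost of a sequence of covariance matrices from `K^{(1)}` to `Q`. -/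
def pathRate (α : ℕ → ℝ) (ℓ : ℕ) (Q : net.Cov (ℓ + 1)) : EReal :=
  ⨅ (q : ∀ k, net.Cov k) (_ : q 1 = ⟨net.K₁, net.posSemidef_K₁⟩ ∧ q (ℓ + 1) = Q), pathCost α ℓ q

theorem AsymptoticLipschitz.mul_layerRate_nonneg (hLip : net.AsymptoticLipschitz) {α : ℕ → ℝ}
    (hα : net.LinearWidths α) {ℓ : ℕ} (hℓ : ℓ ∈ Finset.Icc 1 net.L) (Q : net.Cov ℓ)
    (Q' : net.Cov (ℓ + 1)) : 0 ≤ (α ℓ : EReal) * net.layerRate ℓ Q'.1 Q.1 :=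
  mul_nonneg (EReal.coe_nonneg.2 (hα ℓ hℓ).1.le) (hLip.layerRate_nonneg hℓ Q Q')

theorem AsymptoticLipschitz.pathRate_nonneg (hLip : net.AsymptoticLipschitz) {α : ℕ → ℝ}
    (hα : net.LinearWidths α) {ℓ : ℕ} (hℓ : ℓ ≤ net.L) (Q : net.Cov (ℓ + 1)) :
    0 ≤ pathRate α ℓ Q :=
  le_iInf₂ fun _ _ => Finset.sum_nonneg fun _ hk =>
    hLip.mul_layerRate_nonneg hα (Finset.Icc_subset_Icc_right hℓ hk) _ _

open Classical in
theorem pathRate_zero (α : ℕ → ℝ) (Q : net.Cov 1) :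
    pathRate α 0 Q = if Q = ⟨net.K₁, net.posSemidef_K₁⟩ then 0 else ⊤ := by
  have h0 : ∀ q, pathCost (net := net) α 0 q = 0 := fun q => rfl
  simp_rw [pathRate, h0]
  split_ifs with h
  · refine le_antisymm (iInf₂_le (Function.update (fun _ => ⟨0, Matrix.PosSemidef.zero⟩) 1 Q)
      ⟨?_, ?_⟩) (le_iInf₂ fun _ _ => le_rfl)
    · rw [Function.update_self, h]
    · exact Function.update_self _ _ _
  · refine top_le_iff.1 (le_iInf₂ fun q hq => absurd ?_ h)
    rw [← hq.1]
    exact hq.2.symm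

theorem pathCost_succ (α : ℕ → ℝ) (ℓ : ℕ) (q : ∀ k, net.Cov k) :
    pathCost α (ℓ + 1) q = pathCost α ℓ q +
      (α (ℓ + 1) : EReal) * net.layerRate (ℓ + 1) (q (ℓ + 2)).1 (q (ℓ + 1)).1 :=
  Finset.sum_Icc_succ_top (by omega) _

theorem pathCost_update (α : ℕ → ℝ) (ℓ : ℕ) (q : ∀ k, net.Cov k) (Q : net.Cov (ℓ + 2)) :
    pathCost α ℓ (Function.update q (ℓ + 2) Q) = pathCost α ℓ q := by
  refine Finset.sum_congr rfl fun k hk => ?_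
  have hk' := (Finset.mem_Icc.1 hk).2
  rw [Function.update_of_ne (by omega), Function.update_of_ne (by omega)]

/-- Dynamic programming: the right-hand side is the rate produced by composing with one more kernel
and contracting along the second projection. -/
theorem AsymptoticLipschitz.pathRate_succ (hLip : net.AsymptoticLipschitz) {α : ℕ → ℝ}
    (hα : net.LinearWidths α) {ℓ : ℕ} (hℓ : ℓ + 1 ≤ net.L) (Q : net.Cov (ℓ + 2)) :
    pathRate α (ℓ + 1) Q = ⨅ (p : net.Cov (ℓ + 1) × net.Cov (ℓ + 2)) (_ : p.2 = Q),
      (pathRate α ℓ p.1 + (α (ℓ + 1) : EReal) * net.layerRate (ℓ + 1) p.2.1 p.1.1) := by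
  have hmem : ℓ + 1 ∈ Finset.Icc 1 net.L := Finset.mem_Icc.2 ⟨by omega, hℓ⟩
  apply le_antisymm
  -- The infimum need not be attained, so a nearly optimal path is used. Overwriting its entry at `ℓ
  -- + 2` does not change its cost up to `ℓ`.
  · refine le_iInf₂ fun p hp => le_of_forall_gt fun M hM => ?_
    obtain ⟨M', hM', hM'M⟩ := EReal.lt_iff_exists_real_btwn.1 hM
    refine lt_of_le_of_lt ?_ hM'M
    obtain ⟨a, b, ha, hb, hab⟩ := EReal.exists_lt_coe_lt_coe_add_le_of_add_lt
      (hLip.pathRate_nonneg hα (Nat.le_of_succ_le hℓ) p.1)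
      (hLip.mul_layerRate_nonneg hα hmem p.1 p.2) hM'
    simp only [pathRate, iInf_lt_iff] at ha
    obtain ⟨q, hq, hqa⟩ := ha
    have hq1 : Function.update q (ℓ + 2) Q 1 = ⟨net.K₁, net.posSemidef_K₁⟩ := by
      rw [Function.update_of_ne (by omega), hq.1]
    refine (iInf₂_le (Function.update q (ℓ + 2) Q) ⟨hq1, Function.update_self _ _ _⟩).trans ?_
    rw [pathCost_succ, pathCost_update, Function.update_self, Function.update_of_ne (by omega),
      hq.2, ← hp]
    exact (add_le_add hqa.le hb.le).trans (by exact_mod_cast hab)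
  · refine le_iInf₂ fun q hq => ?_
    rw [pathCost_succ]
    refine (iInf₂_le (q (ℓ + 1), q (ℓ + 2)) hq.2).trans (add_le_add_left ?_ _)
    exact iInf₂_le q ⟨hq.1, rfl⟩

theorem AsymptoticLipschitz.goodLDP_covLaw (hLip : net.AsymptoticLipschitz) {α : ℕ → ℝ}
    (hα : net.LinearWidths α) : ∀ {ℓ : ℕ}, ℓ ≤ net.L → GoodLDP (net.covLaw ℓ) (pathRate α ℓ)
  | 0, _ => by
    classical
    have h1 : net.covLaw 0 = fun _ => Measure.dirac ⟨net.K₁, net.posSemidef_K₁⟩ :=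
      funext covLaw_zero
    have h2 : pathRate α 0 =
        fun Q : net.Cov 1 => if Q = ⟨net.K₁, net.posSemidef_K₁⟩ then 0 else ⊤ :=
      funext (pathRate_zero α)
    rw [h1, h2]
    exact GoodLDP.dirac _
  | ℓ + 1, hℓ => by
    have hmem : ℓ + 1 ∈ Finset.Icc 1 net.L := Finset.mem_Icc.2 ⟨by omega, hℓ⟩
    have hle : ℓ ≤ net.L := Nat.le_of_succ_le hℓ
    have := hLip.isProbabilityMeasure_covLaw hle
    have := hLip.isMarkovKernel_hiddenKernel hmem
    have h := ((hLip.goodLDP_covLaw hα hle).compProd (hLip.kernelLDP_hiddenKernel hα hmem)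
      (hLip.pathRate_nonneg hα hle) (hLip.mul_layerRate_nonneg hα hmem)).map continuous_snd
    have h1 : net.covLaw (ℓ + 1) = fun n =>
        (net.covLaw ℓ n ⊗ₘ net.hiddenKernel n (ℓ + 1)).map Prod.snd :=
      funext (hLip.covLaw_succ hℓ)
    rw [h1, funext (hLip.pathRate_succ hα hℓ)]
    exact h

/-- `jointRate` ignores `q 1` and uses `K₁` directly, while `pathCost` reads the starting point from
the path; writing `K₁` into entry `1` reconciles them. -/
theorem jointRate_eq_pathCost (hL : 1 ≤ net.L) (α : ℕ → ℝ) (q : ∀ k, net.Cov k) :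
    net.jointRate α q =
      pathCost α net.L (Function.update q 1 ⟨net.K₁, net.posSemidef_K₁⟩) := by
  have hIcc : Finset.Icc 1 net.L = insert 1 (Finset.Icc 2 net.L) := by
    ext k
    simp only [Finset.mem_Icc, Finset.mem_insert]
    omega
  rw [jointRate, pathCost, hIcc, Finset.sum_insert (by simp), Function.update_self,
    Function.update_of_ne (by norm_num)]
  congr 1
  refine Finset.sum_congr rfl fun k hk => ?_
  have hk' := (Finset.mem_Icc.1 hk).1
  rw [Function.update_of_ne (by omega), Function.update_of_ne (by omega)]

theorem pathRate_eq_covRate (hL : 1 ≤ net.L) (α : ℕ → ℝ) :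
    pathRate α net.L = net.covRate α := by
  ext1 Q
  apply le_antisymm
  · refine le_iInf₂ fun q hq => ?_
    rw [jointRate_eq_pathCost hL]
    refine iInf₂_le _ ⟨Function.update_self _ _ _, ?_⟩
    rw [Function.update_of_ne (by omega), hq]
  · refine le_iInf₂ fun q hq => (iInf₂_le q hq.2).trans (le_of_eq ?_)
    rw [jointRate_eq_pathCost hL, ← hq.1, Function.update_eq_self]

/-! ### The joint large deviation principle -/

theorem half_mul_sum_genNormSq_nonneg {ι κ : Type*} [Fintype ι] [DecidableEq ι] [Fintype κ]
    (Q : {Q : Matrix ι ι ℝ // Q.PosSemidef}) (Z : κ → ι → ℝ) :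
    0 ≤ ((1 / 2 : ℝ) : EReal) * ∑ c, genNormSq Q.1 (Z c) :=
  mul_nonneg (EReal.coe_nonneg.2 (by norm_num))
    (Finset.sum_nonneg fun c _ => genNormSq_nonneg Q.2 (Z c))

variable (net) in
/-- The joint law of the rescaled output and of `K^{(L+1,n)}`. -/
def outputLaw (n : ℕ) : Measure (net.Output × net.Cov (net.L + 1)) :=
  (net.weightLaw n).map fun u => (net.rescaledOutput n (net.extendWeights n u),
    net.cov n (net.extendWeights n u) net.L)

theorem AsymptoticLipschitz.goodLDP_outputLaw (hLip : net.AsymptoticLipschitz) (hL : 1 ≤ net.L)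
    {α : ℕ → ℝ} (hα : net.LinearWidths α) :
    GoodLDP net.outputLaw (fun p => net.outputRate α p.2 p.1) := by
  have := hLip.isProbabilityMeasure_covLaw (le_refl net.L)
  have h := ((hLip.goodLDP_covLaw hα (le_refl net.L)).compProd
    (kernelLDP_gaussianMeanKernel (ι := net.Site (net.L + 1)) (κ := Fin net.Cout))
    (hLip.pathRate_nonneg hα le_rfl) half_mul_sum_genNormSq_nonneg).map continuous_swap
  -- The joint law is obtained in the order (covariance, output). The swap is a bijection, so the
  -- infimum in the contraction principle runs over one point.
  have hrate : (fun p : net.Output × net.Cov (net.L + 1) => net.outputRate α p.2 p.1) =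
      fun z => ⨅ (p : net.Cov (net.L + 1) × net.Output) (_ : p.swap = z),
        (pathRate α net.L p.1 + ((1 / 2 : ℝ) : EReal) * ∑ c, genNormSq p.1.1 (p.2 c)) := by
    ext1 z
    rw [pathRate_eq_covRate hL]
    refine le_antisymm (le_iInf₂ ?_) ((iInf₂_le z.swap z.swap_swap).trans (add_comm _ _).le)
    rintro p rfl
    exact (add_comm _ _).le
  rw [hrate]
  refine h.congr ?_
  filter_upwards [eventually_ne_atTop 0] with n hn
  rw [← hLip.map_cov_rescaledOutput hn, Measure.map_map measurable_swap]
  · rfl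
  · exact (hLip.measurable_cov_extendWeights n le_rfl).prodMk
      ((hLip.measurable_rescaledOutput n).comp (net.measurable_extendWeights n))

theorem AsymptoticLipschitz.outputRate_nonneg (hLip : net.AsymptoticLipschitz) (hL : 1 ≤ net.L)
    {α : ℕ → ℝ} (hα : net.LinearWidths α) (Q : net.Cov (net.L + 1)) (Z : net.Output) :
    0 ≤ net.outputRate α Q Z := by
  refine add_nonneg (half_mul_sum_genNormSq_nonneg Q Z) ?_
  rw [← pathRate_eq_covRate hL]
  exact hLip.pathRate_nonneg hα le_rfl Q

end ConvNet

end

/-! ### The large deviation principles for the output and its covariance -/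

theorem mainTheorem6 {Ω : Type*} [MeasurableSpace Ω] (Pr : Measure Ω) [IsProbabilityMeasure Pr]
    (net : ConvNet) (hL : 1 ≤ net.L) (α : ℕ → ℝ) (W : ℕ → Ω → net.Weights)
    (hW : net.GaussianPrior Pr W) (hα : net.LinearWidths α) (hLip : net.AsymptoticLipschitz) :
    SatisfiesLDP Pr (fun n ω => (net.rescaledOutput n (W n ω), net.outputCov n (W n ω)))
      (fun p : net.Output × net.Cov (net.L + 1) => net.outputRate α p.2 p.1) ∧
    SatisfiesLDP Pr (fun n ω => net.rescaledOutput n (W n ω))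
      (fun Z : net.Output => ⨅ Q : net.Cov (net.L + 1), net.outputRate α Q Z) := by
  have h := hLip.goodLDP_outputLaw hL hα
  have h0 := hLip.outputRate_nonneg hL hα
  refine ⟨h.satisfiesLDP (fun p => (EReal.bot_lt_zero.trans_le (h0 p.2 p.1)).ne')
    fun n S hS => hW.measure_setOf_mem hLip n hS, ?_⟩
  have hrate : (fun Z : net.Output => ⨅ Q : net.Cov (net.L + 1), net.outputRate α Q Z) =
      fun Z => ⨅ (p : net.Output × net.Cov (net.L + 1)) (_ : p.1 = Z),
        net.outputRate α p.2 p.1 := by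
    ext1 Z
    refine le_antisymm (le_iInf₂ ?_) (le_iInf fun Q => iInf₂_le
      (f := fun (p : net.Output × net.Cov (net.L + 1)) (_ : p.1 = Z) => net.outputRate α p.2 p.1)
      (Z, Q) rfl)
    rintro p rfl
    exact iInf_le _ p.2
  -- The marginal principle is the contraction of the joint one along the first projection; `hrate`
  -- identifies the infimum over a fibre with that over `Q`.
  have h1 := h.map continuous_fst
  rw [← hrate] at h1
  refine h1.satisfiesLDP (fun Z => (EReal.bot_lt_zero.trans_le (le_iInf fun Q => h0 Q Z)).ne')
    fun n S hS => ?_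
  rw [Measure.map_apply measurable_fst hS]
  exact hW.measure_setOf_mem hLip n (measurable_fst hS)
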